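/- Let $(M^n,g)$ be a Hermitian manifold, with almost complex structure $J$. Let $\nabla^c$ be its Chern connection (the connection with $\nabla^c g=0$, $\nabla^c J=0$ whose torsion $T^c$ has no $(1,1)$ part) and $\nabla^b$ its Bismut connection (the connection with $\nabla^b g=0$, $\nabla^b J=0$ whose torsion, viewed as the trilinear form $\langle T^b(X,Y),Z\rangle$, is totally skew-symmetric). Extend $\langle\cdot,\cdot\rangle=g$ complex bilinearly. For a local unitary frame $e=(e_1,\dots,e_n)$ of $T^{1,0}M$ (that is, $\langle e_i,\overline{e_j}\rangle=\delta_{ij}$), with dual coframe $\varphi=(\varphi_1,\dots,\varphi_n)$, define the components $T^i_{jk}$ of the Chern torsion by $T^c(e_j,e_k)=2\sum_i T^i_{jk}e_i$, and put $|T|^2=\sum_{i,j,k}|T^i_{jk}|^2$; this sum does not depend on the unitary frame, so $|T|^2$ is a globally defined function on $M$. Denote by $T^i_{jk,\bar l}$ the components of the covariant derivative of the Chern torsion with respect to $\nabla^b$ in the direction $\overline{e_l}$. Assume that $g$ is Bismut flat, i.e. the curvature of $\nabla^b$ vanishes identically. Then $|T|^2$ is a smooth plurisubharmonic function on $M$,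 and under every local unitary $\nabla^b$-parallel frame $e$ of $T^{1,0}M$ the components $T^i_{jk}$ are smooth and $$\partial\bar\partial |T|^2=\sum_{i,j,k,l,m} T^i_{jk,\bar l}\,\overline{T^i_{jk,\bar m}}\;\varphi_m\wedge\overline{\varphi_l}.$$ In particular, if $M$ is compact, then under every unitary $\nabla^b$-parallel frame of $T^{1,0}M$ over a connected open subset of $M$ all the components $T^i_{jk}$ are constant functions. -/

import Mathlib

open scoped Manifold ContDiff TensorProduct ComplexConjugate
open Bundle

noncomputable section

namespace BismutFlat

/-! ### The underlying real manifold

A complex manifold is a space `M` charted on a finite-dimensional complex vector space `E` with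
holomorphic transition maps, `IsManifold 𝓘(ℂ, E) ω M`.  The same charts give the underlying real
smooth manifold. -/

instance isManifold_real {E : Type*} [NormedAddCommGroup E] [NormedSpace ℂ E]
    {M : Type*} [TopologicalSpace M] [ChartedSpace E M] [IsManifold 𝓘(ℂ, E) ω M] :
    IsManifold 𝓘(ℝ, E) ∞ M := by
  refine isManifold_of_contDiffOn 𝓘(ℝ, E) ∞ M fun e₁ e₂ h₁ h₂ => ?_
  have h := (contDiffGroupoid ω 𝓘(ℂ, E)).compatible h₁ h₂
  rw [contDiffGroupoid, mem_groupoid_of_pregroupoid] at h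
  exact (ContDiffOn.restrict_scalars ℝ h.1).of_le le_top

section Pointwise

variable {E : Type*} [NormedAddCommGroup E] [NormedSpace ℂ E]
  {M : Type*} [TopologicalSpace M] [ChartedSpace E M]

/-- The (real) tangent space of the underlying real manifold. -/
abbrev TM (E : Type*) [NormedAddCommGroup E] [NormedSpace ℂ E]
    {M : Type*} [TopologicalSpace M] [ChartedSpace E M] (x : M) : Type _ :=
  TangentSpace 𝓘(ℝ, E) x

/-- The complexified tangent space `ℂ ⊗ T_x M`. -/
abbrev CTM (E : Type*) [NormedAddCommGroup E] [NormedSpace ℂ E]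
    {M : Type*} [TopologicalSpace M] [ChartedSpace E M] (x : M) : Type _ :=
  ℂ ⊗[ℝ] TM E x

/-- The almost complex structure.  The tangent space at `x` is `E`, through the preferred
(holomorphic) chart at `x`, and `J` is multiplication by the imaginary unit; since the transition
maps are holomorphic, it does not depend on the chart. -/
def J (x : M) : TM E x →L[ℝ] TM E x :=
  (Complex.I • ContinuousLinearMap.id ℝ E : E →L[ℝ] E)

lemma J_J (x : M) (v : TM E x) : J x (J x v) = -v := by
  have h : ∀ w : E, Complex.I • (Complex.I • w) = -w := fun w => by
    rw [smul_smul, Complex.I_mul_I, neg_one_smul]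
  exact h v

/-- The vector `v - √-1 J v` of type `(1,0)`. -/
def type10 {x : M} (v : TM E x) : CTM E x := (1 : ℂ) ⊗ₜ[ℝ] v - Complex.I ⊗ₜ[ℝ] J x v

/-- The vector `v + √-1 J v` of type `(0,1)`, the conjugate of `v - √-1 J v`. -/
def type01 {x : M} (v : TM E x) : CTM E x := (1 : ℂ) ⊗ₜ[ℝ] v + Complex.I ⊗ₜ[ℝ] J x v

/-- The differential of a complex-valued function, extended complex linearly to complexified
tangent vectors. -/
def dC (f : M → ℂ) (x : M) : CTM E x →ₗ[ℂ] ℂ :=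
  LinearMap.liftBaseChange ℂ (mvfderiv 𝓘(ℝ, E) f x).toLinearMap

end Pointwise

/-! ### Hermitian metrics and unitary frames -/

/-- A smooth Riemannian metric for which `J` is orthogonal. -/
structure HermitianMetric (E : Type*) [NormedAddCommGroup E] [NormedSpace ℂ E]
    (M : Type*) [TopologicalSpace M] [ChartedSpace E M] [IsManifold 𝓘(ℂ, E) ω M] extends
    ContMDiffRiemannianMetric 𝓘(ℝ, E) ∞ E (TangentSpace 𝓘(ℝ, E) : M → Type _) where
  hermitian : ∀ (x : M) (v w : TM E x), inner x (J x v) (J x w) = inner x v w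

/-- Existence of unitary bases, as a statement on complex vector spaces. -/
lemma exists_unitary_family {V : Type*} [AddCommGroup V] [Module ℂ V] [FiniteDimensional ℂ V]
    (B : V → V → ℝ) (hadd : ∀ u v w, B (u + v) w = B u w + B v w)
    (hsmul : ∀ (r : ℝ) v w, B ((r : ℂ) • v) w = r * B v w) (hsymm : ∀ v w, B v w = B w v)
    (hpos : ∀ v, v ≠ 0 → 0 < B v v) (hJ : ∀ v w, B (Complex.I • v) (Complex.I • w) = B v w) :
    ∃ v : Fin (Module.finrank ℂ V) → V, ∀ i j,
      2 * (B (v i) (v j) : ℂ) + 2 * Complex.I * (B (v i) (Complex.I • v j) : ℂ)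
        = if i = j then 1 else 0 := by
  have hneg : ∀ v w, B (-v) w = - B v w := fun v w => by
    have := hsmul (-1) v w
    simpa using this
  have hJl : ∀ v w, B (Complex.I • v) w = - B v (Complex.I • w) := fun v w => by
    have h := hJ v (Complex.I • w)
    rw [smul_smul Complex.I Complex.I w, Complex.I_mul_I, neg_one_smul, hsymm, hneg, hsymm] at h
    linarith
  have hself : ∀ v, B v (Complex.I • v) = 0 := fun v => by
    have h := hJl v v
    rw [hsymm] at h
    linarith
  have h0 : ∀ w, B 0 w = 0 := fun w => by
    have := hsmul 0 0 w
    simpa using this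
  let c : InnerProductSpace.Core ℂ V :=
    { inner := fun w v => 2 * (B v w : ℂ) + 2 * Complex.I * (B v (Complex.I • w) : ℂ)
      conj_inner_symm := fun w v => by
        rw [hsymm w v, hsymm w (Complex.I • v), hJl]
        apply Complex.ext <;> simp
      re_inner_nonneg := fun v => by
        rw [hself]
        by_cases hv : v = 0
        · simp [hv, h0]
        · have := hpos v hv
          simp [this.le]
      add_left := fun u v w => by
        rw [smul_add, hsymm w, hsymm w, hadd, hadd, hsymm u, hsymm v, hsymm _ w, hsymm _ w]
        push_cast
        ring
      smul_left := fun u v r => by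
        have h1 : r • u = (r.re : ℂ) • u + (r.im : ℂ) • (Complex.I • u) := by
          rw [smul_smul, ← add_smul, Complex.re_add_im]
        have h2 : Complex.I • r • u = (r.re : ℂ) • (Complex.I • u) + ((-r.im : ℝ) : ℂ) • u := by
          rw [smul_smul, smul_smul, ← add_smul]
          congr 1
          apply Complex.ext <;> simp
        rw [h2, h1, hsymm v, hsymm v, hadd, hadd, hsmul, hsmul, hsmul, hsmul, hsymm u v,
          hsymm (Complex.I • u) v]
        apply Complex.ext <;> simp <;> ring
      definite := fun v hv => by
        by_contra hne
        have h1 := hpos v hne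
        rw [hself] at hv
        simp at hv
        linarith }
  let _ : NormedAddCommGroup V := c.toNormedAddCommGroup
  let _ : InnerProductSpace ℂ V := InnerProductSpace.ofCore c.toCore
  let b := stdOrthonormalBasis ℂ V
  refine ⟨fun i => b i, fun i j => ?_⟩
  have := orthonormal_iff_ite.1 b.orthonormal j i
  simp only [eq_comm (a := i)]
  exact this

section Metric

variable {E : Type*} [NormedAddCommGroup E] [NormedSpace ℂ E]
  {M : Type*} [TopologicalSpace M] [ChartedSpace E M] [IsManifold 𝓘(ℂ, E) ω M]

/-- The complex bilinear extension of the metric to the complexified tangent space. -/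
def HermitianMetric.gC (g : HermitianMetric E M) (x : M) : LinearMap.BilinForm ℂ (CTM E x) :=
  LinearMap.BilinForm.baseChange ℂ (g.inner x).toBilinForm

/-- The vectors `e_i = v_i - √-1 J v_i` form a unitary basis of `T^{1,0}_x M`. -/
def IsUnitaryAt (g : HermitianMetric E M) (x : M) (v : Fin (Module.finrank ℂ E) → TM E x) : Prop :=
  ∀ i j, g.gC x (type10 (v i)) (type01 (v j)) = if i = j then 1 else 0

/-- The coframe dual to the unitary frame `e_i = v_i - √-1 J v_i`, i.e. `φ_k = ⟨·, ē_k⟩`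
(see the two facts below). -/
def coframe (g : HermitianMetric E M) (x : M) (v : Fin (Module.finrank ℂ E) → TM E x)
    (k : Fin (Module.finrank ℂ E)) : CTM E x →ₗ[ℂ] ℂ :=
  (g.gC x).flip (type01 (v k))

lemma HermitianMetric.inner_J_left (g : HermitianMetric E M) (x : M) (v w : TM E x) :
    g.inner x (J x v) w = - g.inner x v (J x w) := by
  have h := g.hermitian x v (J x w)
  rw [J_J, map_neg] at h
  linarith

lemma HermitianMetric.gC_type10_type01 (g : HermitianMetric E M) (x : M) (v w : TM E x) :
    g.gC x (type10 v) (type01 w)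
      = 2 * (g.inner x v w : ℂ) + 2 * Complex.I * (g.inner x v (J x w) : ℂ) := by
  simp only [gC, type10, type01, map_sub, map_add, LinearMap.sub_apply,
    LinearMap.BilinForm.baseChange_tmul, ContinuousLinearMap.toBilinForm_apply,
    g.hermitian, g.inner_J_left]
  simp only [Complex.real_smul, Complex.ofReal_neg]
  linear_combination (-(g.inner x v w : ℂ)) * Complex.I_mul_I

lemma HermitianMetric.gC_type01_type01 (g : HermitianMetric E M) (x : M) (v w : TM E x) :
    g.gC x (type01 v) (type01 w) = 0 := by
  simp only [gC, type01, map_add, LinearMap.add_apply,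
    LinearMap.BilinForm.baseChange_tmul, ContinuousLinearMap.toBilinForm_apply,
    g.hermitian, g.inner_J_left]
  simp only [Complex.real_smul, Complex.ofReal_neg]
  linear_combination (g.inner x v w : ℂ) * Complex.I_mul_I

lemma coframe_type10 (g : HermitianMetric E M) {x : M} {v : Fin (Module.finrank ℂ E) → TM E x}
    (hv : IsUnitaryAt g x v) (k j : Fin (Module.finrank ℂ E)) :
    coframe g x v k (type10 (v j)) = if j = k then 1 else 0 := hv j k

lemma coframe_type01 (g : HermitianMetric E M) (x : M) (v : Fin (Module.finrank ℂ E) → TM E x)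
    (k : Fin (Module.finrank ℂ E)) (w : TM E x) :
    coframe g x v k (type01 w) = 0 := g.gC_type01_type01 x w (v k)

/-- Every tangent space of a Hermitian manifold has a unitary basis. -/
lemma exists_isUnitaryAt [FiniteDimensional ℂ E] (g : HermitianMetric E M) (x : M) :
    ∃ v : Fin (Module.finrank ℂ E) → TM E x, IsUnitaryAt g x v := by
  let B : E → E → ℝ := fun v w => g.inner x v w
  have hadd : ∀ u v w : E, B (u + v) w = B u w + B v w := fun u v w => by
    have h : ∀ u v w : TM E x, g.inner x (u + v) w = g.inner x u w + g.inner x v w := by simp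
    exact h u v w
  have hsmul : ∀ (r : ℝ) (v w : E), B ((r : ℂ) • v) w = r * B v w := fun r v w => by
    have h : ∀ v w : TM E x, g.inner x (r • v) w = r * g.inner x v w := by simp
    rw [Complex.coe_smul]
    exact h v w
  obtain ⟨v, hv⟩ := exists_unitary_family B hadd hsmul (fun v w => g.symm x v w)
    (fun v hv => g.pos x v hv) (fun v w => g.hermitian x v w)
  exact ⟨v, fun i j => (g.gC_type10_type01 x (v i) (v j)).trans (hv i j)⟩

end Metric

/-! ### Connections -/

/-- Affine connections, i.e. covariant derivatives on the real tangent bundle. -/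
abbrev Connection (E : Type*) [NormedAddCommGroup E] [NormedSpace ℂ E]
    (M : Type*) [TopologicalSpace M] [ChartedSpace E M] [IsManifold 𝓘(ℂ, E) ω M] : Type _ :=
  CovariantDerivative 𝓘(ℝ, E) E (TangentSpace 𝓘(ℝ, E) : M → Type _)

/-- (Not necessarily continuous) real vector fields. -/
abbrev VF (E : Type*) [NormedAddCommGroup E] [NormedSpace ℂ E]
    (M : Type*) [TopologicalSpace M] [ChartedSpace E M] : Type _ :=
  ∀ y : M, TangentSpace 𝓘(ℝ, E) y

/-- The vector field `X` is (real) differentiable at `x`. -/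
def VF.DifferentiableAt {E : Type*} [NormedAddCommGroup E] [NormedSpace ℂ E]
    {M : Type*} [TopologicalSpace M] [ChartedSpace E M] [IsManifold 𝓘(ℂ, E) ω M]
    (X : VF E M) (x : M) : Prop :=
  MDifferentiableAt 𝓘(ℝ, E) 𝓘(ℝ, E).tangent (fun y => (⟨y, X y⟩ : TangentBundle 𝓘(ℝ, E) M)) x

/-- The vector field `X` is smooth on `U`. -/
def VF.SmoothOn {E : Type*} [NormedAddCommGroup E] [NormedSpace ℂ E]
    {M : Type*} [TopologicalSpace M] [ChartedSpace E M] [IsManifold 𝓘(ℂ, E) ω M]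
    (X : VF E M) (U : Set M) : Prop :=
  ContMDiffOn 𝓘(ℝ, E) 𝓘(ℝ, E).tangent ∞ (fun y => (⟨y, X y⟩ : TangentBundle 𝓘(ℝ, E) M)) U

section Connections

variable {E : Type*} [NormedAddCommGroup E] [NormedSpace ℂ E]
  {M : Type*} [TopologicalSpace M] [ChartedSpace E M] [IsManifold 𝓘(ℂ, E) ω M]

/-- A smooth connection which is compatible with the metric and with the almost complex structure:
`d⟨Y, Z⟩ = ⟨∇Y, Z⟩ + ⟨Y, ∇Z⟩` and `∇(J Y) = J ∇Y`. -/
structure IsHermitianConnection (g : HermitianMetric E M) (D : Connection E M) : Prop where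
  smooth : CovariantDerivative.ContMDiffCovariantDerivative D ∞
  metric : ∀ (x : M) (Y Z : VF E M), Y.DifferentiableAt x → Z.DifferentiableAt x →
    ∀ w : TM E x, mvfderiv 𝓘(ℝ, E) (fun y => g.inner y (Y y) (Z y)) x w
      = g.inner x (D Y x w) (Z x) + g.inner x (Y x) (D Z x w)
  complex : ∀ (x : M) (Y : VF E M), Y.DifferentiableAt x →
    ∀ w : TM E x, D (fun y => J y (Y y)) x w = J x (D Y x w)

/-- The curvature of `D` vanishes:
`D_X D_Y Z - D_Y D_X Z - D_[X,Y] Z = 0` for all local smooth vector fields. -/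
def IsFlat (D : Connection E M) : Prop :=
  ∀ (U : Set M), IsOpen U → ∀ X Y Z : VF E M,
    X.SmoothOn U → Y.SmoothOn U → Z.SmoothOn U → ∀ x ∈ U,
      D (fun y => D Z y (Y y)) x (X x) - D (fun y => D Z y (X y)) x (Y x)
        - D Z x (VectorField.mlieBracket 𝓘(ℝ, E) X Y x) = 0

/-- The complex linear extension of `w ↦ D_w e` for the complex vector field
`e = v - √-1 J v`. -/
def covC (D : Connection E M) (v : VF E M) (x : M) : CTM E x →ₗ[ℂ] CTM E x :=
  LinearMap.baseChange ℂ (D v x).toLinearMap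
    - Complex.I • LinearMap.baseChange ℂ (D (fun y => J y (v y)) x).toLinearMap

/-- The connection matrix `θ_{ij}` of `D` in the unitary frame `e_i = v_i - √-1 J v_i`,
given by `D e_i = ∑_j θ_{ij} e_j`. -/
def connForm (g : HermitianMetric E M) (D : Connection E M)
    (v : Fin (Module.finrank ℂ E) → VF E M) (i j : Fin (Module.finrank ℂ E)) (x : M) :
    CTM E x →ₗ[ℂ] ℂ :=
  coframe g x (fun r => v r x) j ∘ₗ covC D (v i) x

/-- The vector fields `v_i` are smooth on the open set `U` and `e_i = v_i - √-1 J v_i` is a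
unitary frame of `T^{1,0} M` over `U`.  (Every vector field of type `(1,0)` is of the form
`v - √-1 J v` for a unique real vector field `v`.) -/
structure IsUnitaryFrameOn (g : HermitianMetric E M)
    (v : Fin (Module.finrank ℂ E) → VF E M) (U : Set M) : Prop where
  isOpen : IsOpen U
  smooth : ∀ i, (v i).SmoothOn U
  unitary : ∀ x ∈ U, IsUnitaryAt g x (fun i => v i x)

/-- The frame `e_i = v_i - √-1 J v_i` is parallel on `U`: `D e_i = 0`. -/
def IsParallelOn (D : Connection E M) (v : Fin (Module.finrank ℂ E) → VF E M)
    (U : Set M) : Prop :=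
  ∀ i, ∀ x ∈ U, covC D (v i) x = 0

variable [CompleteSpace E] [FiniteDimensional ℂ E]

/-- The complex bilinear extension of the torsion
`T(X, Y) = D_X Y - D_Y X - [X, Y]` to the complexified tangent space. -/
def torsionC (D : Connection E M) (x : M) : CTM E x →ₗ[ℂ] CTM E x →ₗ[ℂ] CTM E x :=
  LinearMap.BilinMap.baseChange ℂ (CovariantDerivative.torsion D x).toLinearMap₁₂

/-- The Chern connection: the Hermitian connection whose torsion has no `(1,1)` part. -/
structure IsChern (g : HermitianMetric E M) (D : Connection E M) : Prop
    extends IsHermitianConnection g D where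
  torsion_type : ∀ (x : M) (v w : TM E x), torsionC D x (type10 v) (type01 w) = 0

/-- The Bismut connection: the Hermitian connection for which `⟨T(X, Y), Z⟩` is totally
skew-symmetric. -/
structure IsBismut (g : HermitianMetric E M) (D : Connection E M) : Prop
    extends IsHermitianConnection g D where
  torsion_skew : ∀ (x : M) (u v w : TM E x),
    g.inner x (CovariantDerivative.torsion D x u v) w
      = - g.inner x (CovariantDerivative.torsion D x u w) v

/-- The torsion components at `x`: the numbers `T^i_{jk}` with
`T(e_j, e_k) = 2 ∑_i T^i_{jk} e_i`, for the unitary basis `e_i = v_i - √-1 J v_i` of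
`T^{1,0}_x M` and the torsion `T` of the Chern connection `D`. -/
def torsionCoeff (g : HermitianMetric E M) (D : Connection E M) (x : M)
    (v : Fin (Module.finrank ℂ E) → TM E x) (i j k : Fin (Module.finrank ℂ E)) : ℂ :=
  (1 / 2) * coframe g x v i (torsionC D x (type10 (v j)) (type10 (v k)))

/-- The function `|T|² = ∑ |T^i_{jk}|²` on `M`.  The sum is the same for all unitary bases
of `T^{1,0}_x M`; it is formed here in some such basis. -/
def torsionNormSq (g : HermitianMetric E M) (D : Connection E M) (x : M) : ℝ :=
  ∑ i, ∑ j, ∑ k, ‖torsionCoeff g D x (exists_isUnitaryAt g x).choose i j k‖ ^ 2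

/-- The torsion components `T^i_{jk}` in a unitary frame, as functions. -/
def torsionComp (g : HermitianMetric E M) (D : Connection E M)
    (v : Fin (Module.finrank ℂ E) → VF E M) (i j k : Fin (Module.finrank ℂ E)) (x : M) :
    ℂ :=
  torsionCoeff g D x (fun r => v r x) i j k

/-- The components `T^i_{jk, X}` of the covariant derivative, with respect to the connection `Db`,
of the torsion of the Chern connection `Dc`, in the direction of a complexified tangent vector
`X`. -/
def torsionCov (g : HermitianMetric E M) (Db Dc : Connection E M)
    (v : Fin (Module.finrank ℂ E) → VF E M) (i j k : Fin (Module.finrank ℂ E)) (x : M)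
    (X : CTM E x) : ℂ :=
  dC (torsionComp g Dc v i j k) x X
    - ∑ r, connForm g Db v j r x X * torsionComp g Dc v i r k x
    - ∑ r, connForm g Db v k r x X * torsionComp g Dc v i j r x
    + ∑ r, connForm g Db v r i x X * torsionComp g Dc v r j k x

end Connections

/-! ### `∂∂̄` and plurisubharmonic functions -/

section Ddbar

variable {E : Type*} [NormedAddCommGroup E] [NormedSpace ℂ E]

/-- `∂̄F`, the `(0,1)`-part of `dF`, on a complex vector space. -/
def dbar (F : E → ℂ) (y : E) : E [⋀^Fin 1]→L[ℝ] ℂ :=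
  ContinuousAlternatingMap.ofSubsingleton ℝ E ℂ 0
    ((1 / 2 : ℂ) • (fderiv ℝ F y
      + Complex.I • (fderiv ℝ F y).comp (Complex.I • ContinuousLinearMap.id ℝ E : E →L[ℝ] E)))

/-- `∂β` for a form `β` of type `(0,1)`: the `(1,1)`-part of `dβ`, evaluated on two real
vectors. -/
def del01 (β : E → E [⋀^Fin 1]→L[ℝ] ℂ) (y : E) (w₁ w₂ : E) : ℂ :=
  (1 / 2) * (extDeriv β y ![w₁, w₂] + extDeriv β y ![Complex.I • w₁, Complex.I • w₂])

variable {M : Type*} [TopologicalSpace M] [ChartedSpace E M]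

/-- The form `∂∂̄f` at `x`, evaluated on two real tangent vectors; it is computed in the preferred
holomorphic chart at `x`, through which `T_x M` is identified with `E`. -/
def deldbar (f : M → ℂ) (x : M) (w₁ w₂ : TM E x) : ℂ :=
  del01 (dbar (f ∘ (extChartAt 𝓘(ℝ, E) x).symm)) (extChartAt 𝓘(ℝ, E) x x) w₁ w₂

/-- A real-valued function is plurisubharmonic if it is upper semicontinuous and satisfies the
sub-mean value inequality on every holomorphic disc (holomorphic near the closed unit disc). -/
def IsPlurisubharmonic (E : Type*) [NormedAddCommGroup E] [NormedSpace ℂ E]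
    {M : Type*} [TopologicalSpace M] [ChartedSpace E M] (f : M → ℝ) : Prop :=
  UpperSemicontinuous f ∧
    ∀ (V : Set ℂ) (γ : ℂ → M), IsOpen V → Metric.closedBall 0 1 ⊆ V →
      MDifferentiableOn 𝓘(ℂ) 𝓘(ℂ, E) γ V →
      CircleIntegrable (f ∘ γ) 0 1 ∧ f (γ 0) ≤ Real.circleAverage (f ∘ γ) 0 1

end Ddbar

/-- The exterior product `α ∧ β̄` of a `1`-form with the conjugate of a `1`-form, evaluated on two
real vectors. -/
def wedgeConj {V : Type*} [AddCommGroup V] [Module ℝ V] (α β : ℂ ⊗[ℝ] V →ₗ[ℂ] ℂ) (w₁ w₂ : V) : ℂ :=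
  α ((1 : ℂ) ⊗ₜ[ℝ] w₁) * conj (β ((1 : ℂ) ⊗ₜ[ℝ] w₂))
    - α ((1 : ℂ) ⊗ₜ[ℝ] w₂) * conj (β ((1 : ℂ) ⊗ₜ[ℝ] w₁))

end BismutFlat

end

/-! Everything follows from one fact: in a `∇^b`-parallel unitary frame the Chern torsion components
are conjugates of holomorphic functions.

Flatness provides local parallel fields through every tangent vector (`exists_parallel_field`),
hence local parallel unitary frames. For parallel fields `[X, Y] = -T^b(X, Y)`. The Jacobi identity
then becomes a first Bianchi identity for `⟨T^b(X, Y), Z⟩`, and total skewness of `T^b` upgrades it: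
the derivative `D_W ⟨T^b(X, Y), Z⟩` changes sign when `W` and `Z` are exchanged
(`torsionDeriv_swap₁₄`). Integrability of `J` says that `T^b` has no `(3,0)` part, and this identity
may be differentiated. So if `X, Y, W` have type `(1,0)`, then `D_W ⟨T^b(X, Y), Z̄⟩ = -D_{Z̄}
⟨T^b(X, Y), W⟩ = 0` (`mdifferentiableAt_torsionHol`). Comparing the two connections gives `T^c =
-T^b` on such arguments (`torsionRe_chern`), so each `T^i_{jk}` is the conjugate of a holomorphic
function `h`.

Thus `|T|²` is locally `∑ |h_a|²` with `h_a` holomorphic. It is therefore smooth and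
plurisubharmonic, and `∂∂̄|T|² = ∑ ∂h_a ∧ conj(∂h_a)`. Since the connection forms vanish in the
frame, `T^i_{jk,l̄} = conj(e_l h)`, which is the stated formula. On a compact manifold `|T|²`
attains its maximum on each component. The maximum principle for the vector `(h_a)` in a Euclidean
space makes the vector itself, not only its norm, locally constant. -/

noncomputable section

namespace BismutFlat

/-! ### Frobenius theorem for flat linear systems -/

section FlatSystem

open Set Metric NNReal

variable {X F : Type*} [NormedAddCommGroup X] [NormedSpace ℝ X]
  [NormedAddCommGroup F] [NormedSpace ℝ F]

/-- A quadratic Taylor estimate for `C²` maps. -/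
lemma exists_quadratic_taylor {G : X → F} {c : X} (hG : ContDiffAt ℝ 2 G c) :
    ∃ r > 0, ∃ C ≥ 0, (∀ y ∈ ball c r, HasFDerivAt G (fderiv ℝ G y) y ∧ ‖G y‖ ≤ C ∧
      ‖fderiv ℝ G y‖ ≤ C) ∧ ∀ y ∈ ball c r, ∀ z ∈ ball c r,
        ‖G z - G y - fderiv ℝ G y (z - y)‖ ≤ C * ‖z - y‖ ^ 2 := by
  have h1 : ContDiffAt ℝ 1 (fderiv ℝ G) c := hG.fderiv_right (m := 1) (by norm_num)
  obtain ⟨K, t, ht, hK⟩ := h1.exists_lipschitzOnWith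
  have hd : ∀ᶠ y in nhds c, DifferentiableAt ℝ G y := by
    filter_upwards [hG.eventually (by simp)] with y hy using hy.differentiableAt (by simp)
  have hb1 : ∀ᶠ y in nhds c, ‖G y‖ < ‖G c‖ + 1 :=
    hG.continuousAt.norm.eventually_lt_const (by simp)
  have hb2 : ∀ᶠ y in nhds c, ‖fderiv ℝ G y‖ < ‖fderiv ℝ G c‖ + 1 :=
    h1.continuousAt.norm.eventually_lt_const (by simp)
  obtain ⟨r, hr, hball⟩ := Metric.eventually_nhds_iff_ball.1
    ((hd.and (hb1.and hb2)).and (show ∀ᶠ y in nhds c, y ∈ t from ht))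
  -- A single constant dominates the bound on `G`, the bound on its derivative, and the Lipschitz
  -- constant `K` of the derivative.
  refine ⟨r, hr, (‖G c‖ + 1) + (‖fderiv ℝ G c‖ + 1) + K, by positivity, fun y hy => ?_,
    fun y hy z hz => ?_⟩
  · obtain ⟨⟨h1, h2, h3⟩, -⟩ := hball y hy
    refine ⟨h1.hasFDerivAt, ?_, ?_⟩
    · linarith [norm_nonneg (fderiv ℝ G c), K.2]
    · linarith [norm_nonneg (G c), K.2]
  · have hseg : segment ℝ y z ⊆ ball c r := (convex_ball c r).segment_subset hy hz
    have := (convex_segment y z).norm_image_sub_le_of_norm_hasFDerivWithin_le' (f := G)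
      (f' := fderiv ℝ G) (φ := fderiv ℝ G y) (C := K * ‖z - y‖)
      (fun w hw => (hball w (hseg hw)).1.1.hasFDerivAt.hasFDerivWithinAt)
      (fun w hw => by
        have h := hK.dist_le_mul w (hball w (hseg hw)).2 y (hball y hy).2
        rw [dist_eq_norm, dist_eq_norm] at h
        refine h.trans (mul_le_mul_of_nonneg_left ?_ K.2)
        exact norm_sub_le_of_mem_segment hw)
      (left_mem_segment ℝ y z) (right_mem_segment ℝ y z)
    refine this.trans ?_
    rw [mul_assoc, ← sq]
    gcongr
    linarith [norm_nonneg (G c), norm_nonneg (fderiv ℝ G c)]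

/-- A linear differential equation on `[0, 1]` with small coefficients has a solution. -/
lemma exists_linear_ode [CompleteSpace F] {A : ℝ → F →L[ℝ] F} (hA : ContinuousOn A (Icc 0 1))
    (hb : ∀ t ∈ Icc (0 : ℝ) 1, ‖A t‖ ≤ 1 / 2) (u : F) :
    ∃ y : ℝ → F, y 0 = u ∧ (∀ t ∈ Icc (0 : ℝ) 1, HasDerivWithinAt y (A t (y t)) (Icc 0 1) t) ∧
      ∀ t ∈ Icc (0 : ℝ) 1, ‖y t‖ ≤ ‖u‖ * Real.exp 1 := by
  have hmul : ∀ t ∈ Icc (0 : ℝ) 1, ∀ x, ‖A t x‖ ≤ 1 / 2 * ‖x‖ := fun t ht x =>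
    (A t).le_of_opNorm_le (hb t ht) x
  -- On the ball of radius `‖u‖ + 1` about `u` the speed is at most `(2‖u‖ + 1) / 2 ≤ ‖u‖ + 1`, so
  -- the solution cannot leave this ball in time `1`.
  have hP : IsPicardLindelof (fun t x => A t x) (⟨0, by simp⟩ : Icc (0 : ℝ) 1) u
      (‖u‖₊ + 1) 0 (‖u‖₊ + 1) (1 / 2) := by
    constructor
    · intro t ht
      refine LipschitzOnWith.of_dist_le_mul fun x _ y _ => ?_
      rw [dist_eq_norm, dist_eq_norm, ← map_sub]
      simpa using hmul t ht (x - y)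
    · intro x _
      exact hA.clm_apply continuousOn_const
    · intro t ht x hx
      have h1 : ‖x‖ ≤ ‖u‖ + (‖u‖ + 1) := by
        have := norm_le_norm_add_norm_sub' x u
        rw [mem_closedBall, dist_eq_norm] at hx
        push_cast at hx
        linarith
      have h2 := hmul t ht x
      push_cast
      linarith
    · simp
  obtain ⟨y, hy0, hy⟩ := hP.exists_eq_forall_mem_Icc_hasDerivWithinAt₀
  refine ⟨y, hy0, hy, fun t ht => ?_⟩
  have h := norm_le_gronwallBound_of_norm_deriv_right_le (f := y) (f' := fun t => A t (y t))
    (δ := ‖u‖) (K := 1) (ε := 0) (a := 0) (b := 1)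
    (fun t ht => (hy t ht).continuousWithinAt)
    (fun t ht => (hy t ⟨ht.1, ht.2.le⟩).mono_of_mem_nhdsWithin (Icc_mem_nhdsGE_of_mem ht)) (by rw [← hy0])
    (fun t ht => by
      have := hmul t ⟨ht.1, ht.2.le⟩ (y t)
      linarith [norm_nonneg (y t)]) t ht
  rw [gronwallBound_ε0] at h
  refine h.trans ?_
  gcongr
  linarith [ht.2]

set_option maxSynthPendingDepth 3 in
/-- The comparison estimate behind the integrability of flat linear systems: along two rays
`c + t x` and `c + t (x + h)`, the solution along the second ray is, up to `O(‖h‖²)`, obtained from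
the solution along the first one by an infinitesimal parallel transport. -/
lemma flat_ray_comparison {G : X → X →L[ℝ] F →L[ℝ] F} {c : X} {r C : ℝ} (hr1 : r ≤ 1)
    (hC : 0 ≤ C)
    (hG : ∀ y ∈ ball c r, HasFDerivAt G (fderiv ℝ G y) y ∧ ‖G y‖ ≤ C ∧ ‖fderiv ℝ G y‖ ≤ C)
    (hT : ∀ y ∈ ball c r, ∀ z ∈ ball c r,
      ‖G z - G y - fderiv ℝ G y (z - y)‖ ≤ C * ‖z - y‖ ^ 2)
    (hflat : ∀ y ∈ ball c r, ∀ h k : X, ∀ u : F,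
      fderiv ℝ G y h k u - fderiv ℝ G y k h u + G y h (G y k u) - G y k (G y h u) = 0)
    {x h : X} (hx : ‖x‖ < r) (hxh : ‖x + h‖ < r) {y z : ℝ → F} {B : ℝ} (hyz : y 0 = z 0)
    (hy : ∀ t ∈ Icc (0 : ℝ) 1, HasDerivWithinAt y (-(G (c + t • x) x (y t))) (Icc 0 1) t)
    (hz : ∀ t ∈ Icc (0 : ℝ) 1,
      HasDerivWithinAt z (-(G (c + t • (x + h)) (x + h) (z t))) (Icc 0 1) t)
    (hyB : ∀ t ∈ Icc (0 : ℝ) 1, ‖y t‖ ≤ B) :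
    ‖z 1 - y 1 + G (c + x) h (y 1)‖
      ≤ gronwallBound 0 C ((2 * C + 4 * C ^ 2) * B * ‖h‖ ^ 2) 1 := by
  have hB : 0 ≤ B := (norm_nonneg _).trans (hyB 0 (by simp))
  have hh2 : ‖h‖ ≤ 2 := by
    have := norm_sub_le (x + h) x
    rw [add_sub_cancel_left] at this
    linarith
  have hmem : ∀ w : X, ‖w‖ < r → ∀ t ∈ Icc (0 : ℝ) 1, c + t • w ∈ ball c r := fun w hw t ht => by
    rw [mem_ball, dist_eq_norm, add_sub_cancel_left, norm_smul, Real.norm_of_nonneg ht.1]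
    nlinarith [ht.2, norm_nonneg w]
  have happ : ∀ (T : F →L[ℝ] F) (a : ℝ) (v : F) (b : ℝ), ‖T‖ ≤ a → ‖v‖ ≤ b → ‖T v‖ ≤ a * b :=
    fun T a v b hT hv => (T.le_of_opNorm_le hT v).trans
      (mul_le_mul_of_nonneg_left hv ((norm_nonneg _).trans hT))
  have hGw : ∀ q ∈ ball c r, ∀ w : X, ‖G q w‖ ≤ C * ‖w‖ := fun q hq w =>
    (G q).le_of_opNorm_le (hG q hq).2.1 w
  have hDGw : ∀ q ∈ ball c r, ∀ v w : X, ‖fderiv ℝ G q v w‖ ≤ C * ‖v‖ * ‖w‖ := fun q hq v w =>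
    (fderiv ℝ G q v).le_of_opNorm_le ((fderiv ℝ G q).le_of_opNorm_le (hG q hq).2.2 v) w
  have hray : ∀ t ∈ Icc (0 : ℝ) 1,
      HasDerivWithinAt (fun t : ℝ => G (c + t • x)) (fderiv ℝ G (c + t • x) x) (Icc 0 1) t :=
    fun t ht => by
      have h1 : HasDerivAt (fun t : ℝ => c + t • x) x t := by
        simpa using ((hasDerivAt_id t).smul_const x).const_add c
      exact ((hG _ (hmem x hx t ht)).1.comp_hasDerivAt t h1).hasDerivWithinAt
  -- Derivative of the comparison curve `y t - t • G (c + t • x) h (y t)`, the first-order transport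
  -- of `y t` from `c + t • x` to `c + t • (x + h)`.
  let p' : ℝ → F := fun t => -(G (c + t • x) x (y t)) - (G (c + t • x) h (y t) +
    t • (fderiv ℝ G (c + t • x) x h (y t) + G (c + t • x) h (-(G (c + t • x) x (y t)))))
  have hp : ∀ t ∈ Icc (0 : ℝ) 1,
      HasDerivWithinAt (fun t => y t - t • G (c + t • x) h (y t)) (p' t) (Icc 0 1) t :=
    fun t ht => by
      have h1 := ((hray t ht).clm_apply (hasDerivWithinAt_const t _ h)).clm_apply (hy t ht)
      have h2 := (hy t ht).sub ((hasDerivWithinAt_id t _).smul h1)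
      convert h2 using 1
      · rfl
      · simp [p']
        abel
  -- `z` is an exact solution and both curves start at the same point, so `εg = δ = 0`; the only
  -- error is the defect of the comparison curve, of order `‖h‖²`.
  have hcomp := dist_le_of_approx_trajectories_ODE_of_mem
    (v := fun t w => -(G (c + t • (x + h)) (x + h) w)) (s := fun _ => univ) (K := C.toNNReal)
    (f := fun t => y t - t • G (c + t • x) h (y t)) (f' := p') (a := 0) (b := 1)
    (g := z) (g' := fun t => -(G (c + t • (x + h)) (x + h) (z t)))
    (εf := (2 * C + 4 * C ^ 2) * B * ‖h‖ ^ 2) (εg := 0) (δ := 0)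
    (fun t ht => by
      refine (LipschitzWith.of_dist_le_mul fun v w => ?_).lipschitzOnWith
      rw [dist_eq_norm, dist_eq_norm, ← neg_add', ← sub_eq_add_neg, norm_neg, ← map_sub,
        Real.coe_toNNReal C hC]
      refine ContinuousLinearMap.le_of_opNorm_le _ ?_ _
      refine (hGw _ (hmem _ hxh t ⟨ht.1, ht.2.le⟩) _).trans ?_
      nlinarith)
    (fun t ht => (hp t ht).continuousWithinAt)
    (fun t ht => (hp t ⟨ht.1, ht.2.le⟩).mono_of_mem_nhdsWithin (Icc_mem_nhdsGE_of_mem ht))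
    (fun t ht => by
      have ht' : t ∈ Icc (0 : ℝ) 1 := ⟨ht.1, ht.2.le⟩
      have hq := hmem x hx t ht'
      have hq' := hmem (x + h) hxh t ht'
      set q := c + t • x with hqdef
      have hqq : c + t • (x + h) - q = t • h := by rw [hqdef, smul_add]; abel
      obtain ⟨R, hR⟩ : ∃ R, R = G (c + t • (x + h)) - G q - t • fderiv ℝ G q h := ⟨_, rfl⟩
      have hRn : ‖R‖ ≤ C * ‖h‖ ^ 2 := by
        have := hT q hq _ hq'
        rw [hqq, map_smul, ← hR] at this
        refine this.trans ?_
        rw [norm_smul, Real.norm_of_nonneg ht.1]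
        have : t * ‖h‖ ≤ ‖h‖ := mul_le_of_le_one_left (norm_nonneg _) ht.2.le
        have : 0 ≤ t * ‖h‖ := mul_nonneg ht.1 (norm_nonneg _)
        gcongr
      have hG' : G (c + t • (x + h)) = G q + t • fderiv ℝ G q h + R := by rw [hR]; abel
      have hf0 := hflat q hq h x (y t)
      have hyt := hyB t ht'
      have hAh := happ _ _ _ _ (hGw q hq h) hyt
      have e1 := happ _ _ _ _ (hDGw q hq h h) hyt
      have e2 : ‖y t - t • G q h (y t)‖ ≤ B * (1 + 2 * C) := by
        refine (norm_sub_le _ _).trans ?_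
        rw [norm_smul, Real.norm_of_nonneg ht.1]
        have h1 : t * ‖G q h (y t)‖ ≤ ‖G q h (y t)‖ :=
          mul_le_of_le_one_left (norm_nonneg _) ht.2.le
        have h2 : C * ‖h‖ * B ≤ C * 2 * B := by gcongr
        linarith
      have e3 : ‖R (x + h) (y t - t • G q h (y t))‖ ≤ C * ‖h‖ ^ 2 * (B * (1 + 2 * C)) := by
        refine happ _ _ _ _ ((R.le_of_opNorm_le hRn _).trans ?_) e2
        exact mul_le_of_le_one_right (by positivity) (by linarith)
      have e4 := happ _ _ _ _ (hGw q hq h) hAh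
      have e5 : ‖fderiv ℝ G q h (x + h) (G q h (y t))‖ ≤ C * ‖h‖ * (C * ‖h‖ * B) := by
        refine happ _ _ _ _ ((hDGw q hq _ _).trans ?_) hAh
        exact mul_le_of_le_one_right (by positivity) (by linarith)
      -- Flatness exchanges `x` and `h` in the derivative of `G` and thereby removes every term of
      -- first order in `h`; the four remaining terms are at least quadratic.
      have key : p' t - -(G (c + t • (x + h)) (x + h) (y t - t • G q h (y t)))
          = t • fderiv ℝ G q h h (y t) + R (x + h) (y t - t • G q h (y t))
            - t • G q h (G q h (y t)) - t • t • fderiv ℝ G q h (x + h) (G q h (y t)) := by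
        have hf1 : fderiv ℝ G q x h (y t) = fderiv ℝ G q h x (y t) + G q h (G q x (y t))
            - G q x (G q h (y t)) := by
          rw [← sub_eq_zero, ← neg_eq_zero, ← hf0]; abel
        simp only [p', ← hqdef]
        rw [hG', hf1]
        simp only [map_add, map_sub, map_neg, map_smul, add_apply, smul_apply]
        module
      rw [dist_eq_norm, key]
      have n1 : ∀ w : F, ‖t • w‖ ≤ ‖w‖ := fun w => by
        rw [norm_smul, Real.norm_of_nonneg ht.1]
        exact mul_le_of_le_one_left (norm_nonneg _) ht.2.le
      calc _ ≤ ‖t • fderiv ℝ G q h h (y t)‖ + ‖R (x + h) (y t - t • G q h (y t))‖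
            + ‖t • G q h (G q h (y t))‖ + ‖t • t • fderiv ℝ G q h (x + h) (G q h (y t))‖ :=
            (norm_sub_le _ _).trans (add_le_add ((norm_sub_le _ _).trans
              (add_le_add (norm_add_le _ _) le_rfl)) le_rfl)
        _ ≤ C * ‖h‖ * ‖h‖ * B + C * ‖h‖ ^ 2 * (B * (1 + 2 * C)) + C * ‖h‖ * (C * ‖h‖ * B)
            + C * ‖h‖ * (C * ‖h‖ * B) :=
            add_le_add (add_le_add (add_le_add ((n1 _).trans e1) e3) ((n1 _).trans e4))
              ((n1 _).trans ((n1 _).trans e5))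
        _ = _ := by ring)
    (fun _ _ => mem_univ _)
    (fun t ht => (hz t ht).continuousWithinAt)
    (fun t ht => (hz t ⟨ht.1, ht.2.le⟩).mono_of_mem_nhdsWithin (Icc_mem_nhdsGE_of_mem ht))
    (fun t _ => by simp) (fun _ _ => mem_univ _) (by simp [hyz]) 1 (by simp)
  rw [Real.coe_toNNReal C hC, add_zero, sub_zero, dist_comm, dist_eq_norm] at hcomp
  simpa [sub_sub_eq_add_sub, add_sub_right_comm] using hcomp

set_option maxSynthPendingDepth 3 in
/-- **Frobenius theorem** for linear systems: a flat linear system has local solutions with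
arbitrary initial value. -/
theorem exists_flat_solution [CompleteSpace F] {G : X → X →L[ℝ] F →L[ℝ] F} {c : X} (hG : ContDiffAt ℝ 2 G c)
    (hflat : ∀ᶠ y in nhds c, ∀ h k : X, ∀ u : F,
      fderiv ℝ G y h k u - fderiv ℝ G y k h u + G y h (G y k u) - G y k (G y h u) = 0) (u : F) :
    ∃ r > 0, ∃ s : X → F, s c = u ∧
      ∀ y ∈ ball c r, HasFDerivAt s (-((G y).flip (s y))) y := by
  obtain ⟨r₁, hr₁, C, hC, hG1, hT1⟩ := exists_quadratic_taylor hG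
  obtain ⟨r₂, hr₂, hflat⟩ := Metric.eventually_nhds_iff_ball.1 hflat
  -- The bound `1` is needed for `flat_ray_comparison`, and the last bound gives `C * r ≤ 1 / 2`,
  -- the smallness required by `exists_linear_ode` on every ray.
  let r := min (min r₁ r₂) (min 1 (1 / (2 * (C + 1))))
  have hr : 0 < r := by positivity
  have hrr₁ : r ≤ r₁ := (min_le_left _ _).trans (min_le_left _ _)
  have hrr₂ : r ≤ r₂ := (min_le_left _ _).trans (min_le_right _ _)
  have hr1 : r ≤ 1 := (min_le_right _ _).trans (min_le_left _ _)
  have hrC : C * r ≤ 1 / 2 := by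
    have h1 : r ≤ 1 / (2 * (C + 1)) := (min_le_right _ _).trans (min_le_right _ _)
    rw [le_div_iff₀ (by positivity)] at h1
    nlinarith
  have hb₁ := ball_subset_ball (x := c) hrr₁
  have hb₂ := ball_subset_ball (x := c) hrr₂
  have hmem : ∀ w : X, ‖w‖ < r → ∀ t ∈ Icc (0 : ℝ) 1, c + t • w ∈ ball c r := fun w hw t ht => by
    rw [mem_ball, dist_eq_norm, add_sub_cancel_left, norm_smul, Real.norm_of_nonneg ht.1]
    nlinarith [ht.2, norm_nonneg w]
  have hsol : ∀ w : X, ‖w‖ < r → ∃ y : ℝ → F, y 0 = u ∧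
      (∀ t ∈ Icc (0 : ℝ) 1, HasDerivWithinAt y (-(G (c + t • w) w (y t))) (Icc 0 1) t) ∧
      ∀ t ∈ Icc (0 : ℝ) 1, ‖y t‖ ≤ ‖u‖ * Real.exp 1 := fun w hw => by
    refine exists_linear_ode (A := fun t => -(G (c + t • w) w)) ?_ ?_ u
    · refine (ContinuousOn.clm_apply (fun t ht => ?_) continuousOn_const).neg
      exact ((hG1 _ (hb₁ (hmem w hw t ht))).1.continuousAt.comp (f := fun t : ℝ => c + t • w)
        (by fun_prop : Continuous fun t : ℝ => c + t • w).continuousAt).continuousWithinAt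
    · intro t ht
      rw [norm_neg]
      refine ((G _).le_of_opNorm_le (hG1 _ (hb₁ (hmem w hw t ht))).2.1 w).trans ?_
      nlinarith [norm_nonneg w]
  choose! Y hY0 hY hYB using hsol
  -- The solution at `q` is the endpoint of the transport of `u` along the straight ray from `c` to
  -- `q`.
  refine ⟨r, hr, fun q => Y (q - c) 1, ?_, fun q hq => ?_⟩
  · have h0 : ‖(0 : X)‖ < r := by simpa using hr
    have hd := (hY 0 h0)
    simp only [map_zero, zero_apply, neg_zero] at hd
    have := constant_of_has_deriv_right_zero (fun t ht => (hd t ht).continuousWithinAt)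
      (fun t ht => (hd t ⟨ht.1, ht.2.le⟩).mono_of_mem_nhdsWithin (Icc_mem_nhdsGE_of_mem ht)) 1
      (by simp)
    simp only [sub_self, this, hY0 0 h0]
  · obtain ⟨L, hL⟩ : ∃ L, L = gronwallBound 0 C ((2 * C + 4 * C ^ 2) * (‖u‖ * Real.exp 1)) 1 :=
      ⟨_, rfl⟩
    -- With zero initial gap the Gronwall bound is linear in the defect, so the comparison error is
    -- `O(‖q' - q‖²)`, which is the required differentiability.
    have hscale : ∀ a : ℝ, gronwallBound 0 C ((2 * C + 4 * C ^ 2) * (‖u‖ * Real.exp 1) * a) 1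
        = L * a := fun a => by
      rw [hL]
      unfold gronwallBound
      split_ifs <;> ring
    have hqr : ‖q - c‖ < r := by rwa [mem_ball, dist_eq_norm] at hq
    refine HasFDerivAt.of_isLittleO ?_
    refine Asymptotics.IsBigO.trans_isLittleO (g := fun q' => ‖q' - q‖ ^ 2) ?_ ?_
    · refine Asymptotics.IsBigO.of_bound L ?_
      filter_upwards [isOpen_ball.mem_nhds hq] with q' hq'
      have hqr' : ‖(q - c) + (q' - q)‖ < r := by
        rw [mem_ball, dist_eq_norm] at hq'
        rwa [add_comm, sub_add_sub_cancel]
      have := flat_ray_comparison hr1 hC (fun y hy => hG1 y (hb₁ hy))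
        (fun y hy z hz => hT1 y (hb₁ hy) z (hb₁ hz)) (fun y hy => hflat y (hb₂ hy)) hqr hqr'
        ((hY0 _ hqr).trans (hY0 _ hqr').symm) (hY _ hqr) (hY _ hqr') (hYB _ hqr)
      rw [hscale] at this
      have e1 : q - c + (q' - q) = q' - c := by abel
      have e2 : c + (q - c) = q := by abel
      rw [e1, e2] at this
      rw [norm_pow, norm_norm]
      simpa [-map_sub] using this
    · have := (Asymptotics.isLittleO_pow_id (𝕜 := ℝ) one_lt_two).comp_tendsto
        (show Filter.Tendsto (fun q' => ‖q' - q‖) (nhds q) (nhds 0) by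
          simpa using ((continuous_id.sub continuous_const).norm.tendsto q :
            Filter.Tendsto (fun q' => ‖q' - q‖) _ _))
      exact this.norm_right.congr_right (fun _ => by simp) |>.of_norm_right

set_option maxSynthPendingDepth 3 in
/-- Solutions of a smooth linear system are smooth. -/
lemma contDiffOn_of_hasFDerivAt_linear {G : X → X →L[ℝ] F →L[ℝ] F} {U : Set X} (hU : IsOpen U)
    (hG : ContDiffOn ℝ ∞ G U) {s : X → F}
    (hs : ∀ y ∈ U, HasFDerivAt s (-((G y).flip (s y))) y) : ContDiffOn ℝ ∞ s U := by
  refine contDiffOn_infty.2 fun n => ?_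
  induction n with
  | zero =>
    exact contDiffOn_zero.2 fun y hy => (hs y hy).continuousAt.continuousWithinAt
  | succ n ih =>
    push_cast
    rw [contDiffOn_succ_iff_fderiv_of_isOpen hU]
    refine ⟨fun y hy => (hs y hy).differentiableAt.differentiableWithinAt, by simp, ?_⟩
    -- Bootstrap: the equation expresses the derivative of `s` through `G` and `s`, so it is as
    -- regular as `s` already is.
    have h1 : ContDiffOn ℝ n (fun y => -((G y).flip (s y))) U := by
      refine ContDiffOn.neg (ContDiffOn.clm_apply ?_ ih)
      exact (ContinuousLinearMap.flipₗᵢ ℝ X F F).contDiff.comp_contDiffOn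
        (contDiffOn_infty.1 hG n)
    exact h1.congr fun y hy => (hs y hy).fderiv

end FlatSystem

/-! ### Sub-mean value inequality, from small discs to the unit disc -/

section SubMeanValue

open Set Metric Real

/-- The square norm of a holomorphic map satisfies the sub-mean value inequality. -/
lemma normSq_le_circleAverage {W : Type*} [NormedAddCommGroup W] [InnerProductSpace ℂ W]
    [CompleteSpace W] {f : ℂ → W} {c : ℂ} {r : ℝ} (hr : 0 < r)
    (hf : DifferentiableOn ℂ f (closedBall c r)) :
    ‖f c‖ ^ 2 ≤ circleAverage (fun z => ‖f z‖ ^ 2) c r := by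
  have hd : DiffContOnCl ℂ f (ball c |r|) := by
    rw [abs_of_pos hr]
    exact (hf.mono (by rw [closure_ball _ hr.ne'])).diffContOnCl
  have hc : ContinuousOn f (sphere c |r|) := by
    rw [abs_of_pos hr]
    exact hf.continuousOn.mono sphere_subset_closedBall
  have h1 : circleAverage f c r = f c := hd.circleAverage
  -- Expanding `0 ≤ ‖f c - f z‖²` gives `2 * L (f z) - ‖f c‖² ≤ ‖f z‖²`, and by the mean value
  -- property of `f` the left side has average exactly `‖f c‖²`.
  let L : W →L[ℝ] ℝ := Complex.reCLM.comp ((innerSL ℂ (f c)).restrictScalars ℝ)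
  have hL : ∀ w, L w = (inner ℂ (f c) w : ℂ).re := fun w => rfl
  have hi : CircleIntegrable f c r := hc.circleIntegrable'
  have h2 : circleAverage (fun z => 2 * L (f z) - ‖f c‖ ^ 2) c r = ‖f c‖ ^ 2 := by
    have h3 : circleAverage (L ∘ f) c r = ‖f c‖ ^ 2 := by
      rw [L.circleAverage_comp_comm hi, h1, hL]
      exact inner_self_eq_norm_sq (𝕜 := ℂ) (f c)
    have hi' : CircleIntegrable (L ∘ f) c r := (L.continuous.comp_continuousOn hc).circleIntegrable'
    have h4 := circleAverage_fun_sub (f₁ := fun z => (2 : ℝ) • (L ∘ f) z) (f₂ := fun _ => ‖f c‖ ^ 2)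
      (c := c) (R := r) (hi'.const_fun_smul) (circleIntegrable_const _ _ _)
    rw [circleAverage_const, circleAverage_fun_smul, h3, smul_eq_mul] at h4
    exact h4.trans (by ring)
  rw [← h2]
  refine circleAverage_mono (ContinuousOn.circleIntegrable' ?_)
    (ContinuousOn.circleIntegrable' ?_) fun z _ => ?_
  · fun_prop
  · fun_prop
  · have := norm_sub_sq (𝕜 := ℂ) (f c) (f z)
    have h3 : 0 ≤ ‖f c - f z‖ ^ 2 := by positivity
    simp only [RCLike.re_to_complex] at this
    rw [hL]
    linarith

/-- Starting the parametrisation at the argument of `z` exhibits the radial mean at `z` as an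
average of the rotated copies of `u`, so it inherits linear inequalities from them. -/
lemma circleAverage_norm_eq {u : ℂ → ℝ} (z : ℂ) :
    circleAverage u 0 ‖z‖ = (2 * π)⁻¹ • ∫ α in 0..2 * π, u (z * Complex.exp (α * Complex.I)) := by
  rw [circleAverage_eq_integral_add z.arg]
  congr 2
  ext α
  congr 1
  rw [circleMap_zero]
  push_cast
  rw [add_mul, Complex.exp_add, mul_left_comm, Complex.norm_mul_exp_arg_mul_I]
  ring

/-- A continuous function with the local sub-mean value property in the unit disc has the sub-mean
value property on the unit disc. -/
lemma le_circleAverage_of_local {u : ℂ → ℝ} (hu : Continuous u) {δ : ℝ} (hδ : 0 < δ)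
    (hsub : ∀ c ρ, 0 < ρ → ρ < δ → closedBall c ρ ⊆ closedBall (0 : ℂ) 1 →
      u c ≤ circleAverage u c ρ) :
    u 0 ≤ circleAverage u 0 1 := by
  let A : ℝ → ℝ := circleAverage u 0
  have hA : Continuous A := hu.circleAverage
  -- The radial function `z ↦ A ‖z‖` inherits the local inequality from the rotations of `u` by
  -- Fubini; real centres `r ≥ 0` suffice.
  have hloc : ∀ r ρ, 0 ≤ r → 0 < ρ → ρ < δ → r + ρ ≤ 1 →
      A r ≤ (2 * π)⁻¹ * ∫ t in 0..2 * π, A ‖(r : ℂ) + circleMap 0 ρ t‖ := by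
    intro r ρ hr hρ hρδ hrρ
    have h1 : ∀ t, A ‖(r : ℂ) + circleMap 0 ρ t‖ = (2 * π)⁻¹ * ∫ α in 0..2 * π,
        u (circleMap 0 r α + circleMap 0 ρ (t + α)) := fun t => by
      simp only [A]
      rw [circleAverage_norm_eq, smul_eq_mul]
      congr 2
      ext α
      congr 1
      simp only [circleMap_zero]
      push_cast
      rw [add_mul _ _ Complex.I, Complex.exp_add]
      ring
    simp only [h1]
    rw [intervalIntegral.integral_const_mul,
      MeasureTheory.intervalIntegral_intervalIntegral_swap]
    · have h2 : ∀ α, ∫ t in 0..2 * π, u (circleMap 0 r α + circleMap 0 ρ (t + α))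
          = (2 * π) * circleAverage u (circleMap 0 r α) ρ := fun α => by
        rw [circleAverage_eq_integral_add α, smul_eq_mul, ← mul_assoc,
          mul_inv_cancel₀ (by positivity), one_mul]
        simp [circleMap]
      simp only [h2, intervalIntegral.integral_const_mul]
      rw [← mul_assoc (2 * π)⁻¹ (2 * π), inv_mul_cancel₀ (by positivity), one_mul]
      change (2 * π)⁻¹ • _ ≤ _
      rw [smul_eq_mul]
      refine mul_le_mul_of_nonneg_left ?_ (by positivity)
      refine intervalIntegral.integral_mono_on (by positivity) ?_ ?_ fun α _ => ?_
      · exact (hu.comp (continuous_circleMap 0 r)).intervalIntegrable _ _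
      · refine Continuous.intervalIntegrable ?_ _ _
        refine Continuous.const_smul (c := (2 * π)⁻¹)
          (intervalIntegral.continuous_parametric_intervalIntegral_of_continuous' ?_ _ _)
        simp only [Function.uncurry_def, circleMap]
        fun_prop
      · refine hsub _ ρ hρ hρδ (closedBall_subset_closedBall' ?_)
        simp [abs_of_nonneg hr]
        linarith
    · have : Continuous (Function.uncurry fun t α : ℝ =>
          u (circleMap 0 r α + circleMap 0 ρ (t + α))) := by
        simp only [Function.uncurry_def, circleMap]
        fun_prop
      rw [uIoc_of_le (by positivity)]
      exact (this.continuousOn.integrableOn_compact (isCompact_Icc.prod isCompact_Icc)).mono_set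
        (prod_mono Ioc_subset_Icc_self Ioc_subset_Icc_self)
  obtain ⟨r₀, hr₀, hmax⟩ := isCompact_Icc.exists_isMaxOn (s := Icc (0 : ℝ) 1) ⟨0, by simp⟩
    hA.continuousOn
  let S : Set ℝ := Icc 0 1 ∩ {r | A r = A r₀}
  have hS : IsCompact S := isCompact_Icc.inter_right (isClosed_eq hA continuous_const)
  -- Choose the largest maximiser of `A` on `[0, 1]`. If it were below `1`, a small circle about it
  -- would contain the point `r + ρ`, where `A` is strictly smaller, against `hloc`. So `A` is
  -- maximal at `1`, while `A 0 = u 0`.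
  obtain ⟨r, hrS, hr⟩ := hS.exists_isGreatest ⟨r₀, hr₀, rfl⟩
  have hle : ∀ s ∈ Icc (0 : ℝ) 1, A s ≤ A r := fun s hs => (hmax hs).trans hrS.2.ge
  have h0 : A 0 = u 0 := by simp [A]
  have hr1 : r = 1 := by
    by_contra hne
    have hlt : r < 1 := lt_of_le_of_ne hrS.1.2 hne
    let ρ := min (δ / 2) (1 - r)
    have hρ : 0 < ρ := lt_min (by positivity) (by linarith)
    have hρ1 : ρ ≤ 1 - r := min_le_right _ _
    have hρ2 : ρ < δ := (min_le_left _ _).trans_lt (by linarith)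
    have h1 := hloc r ρ hrS.1.1 hρ hρ2 (by linarith)
    have hb : ∀ t, ‖(r : ℂ) + circleMap 0 ρ t‖ ∈ Icc (0 : ℝ) 1 := fun t => by
      refine ⟨norm_nonneg _, (norm_add_le _ _).trans ?_⟩
      simp [abs_of_pos hρ, abs_of_nonneg hrS.1.1]
      linarith
    have h2 : ∫ t in 0..2 * π, A ‖(r : ℂ) + circleMap 0 ρ t‖ < ∫ t in 0..2 * π, A r := by
      refine intervalIntegral.integral_lt_integral_of_continuousOn_of_le_of_exists_lt
        (by positivity) ?_ continuousOn_const (fun t _ => hle _ (hb t)) ⟨0, by simp [pi_pos.le], ?_⟩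
      · refine Continuous.continuousOn (hA.comp ?_)
        simp only [circleMap]
        fun_prop
      · refine lt_of_le_of_ne (hle _ (hb 0)) fun heq => ?_
        have h3 := hr ⟨hb 0, heq.trans hrS.2⟩
        have h4 : (r : ℂ) + circleMap 0 ρ 0 = ((r + ρ : ℝ) : ℂ) := by simp [circleMap]
        rw [h4, Complex.norm_real, norm_of_nonneg (by linarith [hrS.1.1])] at h3
        linarith
    rw [intervalIntegral.integral_const, sub_zero, smul_eq_mul] at h2
    have h3 := mul_lt_mul_of_pos_left h2 (show 0 < (2 * π)⁻¹ by positivity)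
    rw [← mul_assoc, inv_mul_cancel₀ (by positivity), one_mul] at h3
    exact absurd h1 (not_le.2 h3)
  rw [← h0, ← hr1]
  exact hle 0 (by simp)

/-- A function which is locally the square norm of a holomorphic map satisfies the sub-mean value
inequality on the unit disc. -/
theorem circleIntegrable_and_le_circleAverage {W : Type*} [NormedAddCommGroup W]
    [InnerProductSpace ℂ W] [CompleteSpace W] {u : ℂ → ℝ}
    (hloc : ∀ z ∈ closedBall (0 : ℂ) 1, ∃ U : Set ℂ, IsOpen U ∧ z ∈ U ∧ ∃ f : ℂ → W,
      DifferentiableOn ℂ f U ∧ ∀ w ∈ U, u w = ‖f w‖ ^ 2) :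
    CircleIntegrable u 0 1 ∧ u 0 ≤ circleAverage u 0 1 := by
  choose! U hU hzU f hf huf using hloc
  have hcont : ContinuousOn u (closedBall 0 1) := fun z hz => by
    have h1 : ContinuousOn u (U z) :=
      ((hf z hz).continuousOn.norm.pow 2).congr (huf z hz)
    exact (h1.continuousAt ((hU z hz).mem_nhds (hzU z hz))).continuousWithinAt
  -- Nothing is known about `u` away from the closed disc; a Tietze extension supplies the globally
  -- continuous function that `le_circleAverage_of_local` needs.
  obtain ⟨v, hv⟩ := ContinuousMap.exists_restrict_eq (Y := ℝ) (isClosed_closedBall (x := (0 : ℂ)) (ε := 1))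
    ⟨_, hcont.domRestrict⟩
  have hvu : ∀ z ∈ closedBall (0 : ℂ) 1, v z = u z := fun z hz =>
    congrArg (fun f => f ⟨z, hz⟩) hv
  have hs : sphere (0 : ℂ) |1| ⊆ closedBall 0 1 := by rw [abs_one]; exact sphere_subset_closedBall
  refine ⟨(hcont.mono hs).circleIntegrable', ?_⟩
  -- The Lebesgue number makes the admissible radius uniform over all centres.
  obtain ⟨δ, hδ, hL⟩ := lebesgue_number_lemma_of_metric (isCompact_closedBall (0 : ℂ) 1)
    (c := fun z : closedBall (0 : ℂ) 1 => U z) (fun z => hU z z.2)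
    (fun z hz => mem_iUnion.2 ⟨⟨z, hz⟩, hzU z hz⟩)
  have h := le_circleAverage_of_local v.continuous hδ fun c ρ hρ hρδ hsub => by
    obtain ⟨⟨z, hz⟩, hz'⟩ := hL c (hsub (mem_closedBall_self hρ.le))
    have hcU : closedBall c ρ ⊆ U z := (closedBall_subset_ball hρδ).trans hz'
    have h1 := normSq_le_circleAverage hρ ((hf z hz).mono hcU)
    have hcc := mem_closedBall_self (x := c) hρ.le
    rw [← huf z hz c (hcU hcc), ← hvu c (hsub hcc)] at h1
    refine h1.trans_eq (circleAverage_congr_sphere fun w hw => ?_)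
    have hw' : w ∈ closedBall c ρ := by
      rw [abs_of_pos hρ] at hw
      exact sphere_subset_closedBall hw
    exact (huf z hz w (hcU hw')).symm.trans (hvu w (hsub hw')).symm
  rw [hvu 0 (by simp)] at h
  exact h.trans_eq (circleAverage_congr_sphere fun w hw => hvu w (hs hw))

end SubMeanValue

/-! ### Holomorphic maps, and vector fields in a chart -/

section Holomorphic

variable {E : Type*} [NormedAddCommGroup E] [NormedSpace ℂ E]
  {M : Type*} [TopologicalSpace M] [ChartedSpace E M]
  {E' : Type*} [NormedAddCommGroup E'] [NormedSpace ℂ E']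
  {M' : Type*} [TopologicalSpace M'] [ChartedSpace E' M']

/-- A holomorphic map is real differentiable, with the same derivative. -/
lemma hasMFDerivAt_restrictScalars {f : M → M'} {x : M} {f' : E →L[ℂ] E'}
    (h : HasMFDerivAt 𝓘(ℂ, E) 𝓘(ℂ, E') f x f') :
    HasMFDerivAt 𝓘(ℝ, E) 𝓘(ℝ, E') f x (f'.restrictScalars ℝ : E →L[ℝ] E') :=
  ⟨h.1, HasFDerivWithinAt.restrictScalars ℝ h.2⟩

/-- The derivative of a holomorphic map commutes with the almost complex structures. -/
lemma mfderiv_J_of_complex {f : M → M'} {x : M} (h : MDifferentiableAt 𝓘(ℂ, E) 𝓘(ℂ, E') f x)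
    (v : TM E x) :
    mfderiv 𝓘(ℝ, E) 𝓘(ℝ, E') f x (J x v) = J (f x) (mfderiv 𝓘(ℝ, E) 𝓘(ℝ, E') f x v) := by
  rw [(hasMFDerivAt_restrictScalars h.hasMFDerivAt).mfderiv]
  exact (mfderiv 𝓘(ℂ, E) 𝓘(ℂ, E') f x).map_smul Complex.I v

/-- A real differentiable function whose derivative commutes with multiplication by the imaginary
unit is holomorphic. -/
lemma mdifferentiableAt_complex_of_real {F : Type*} [NormedAddCommGroup F] [NormedSpace ℂ F]
    {f : M → F} {x : M} (h : MDifferentiableAt 𝓘(ℝ, E) 𝓘(ℝ, F) f x)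
    (hJ : ∀ v : TM E x, mvfderiv 𝓘(ℝ, E) f x (J x v) = Complex.I • mvfderiv 𝓘(ℝ, E) f x v) :
    MDifferentiableAt 𝓘(ℂ, E) 𝓘(ℂ, F) f x := by
  obtain ⟨A, hA⟩ : ∃ A : E →L[ℝ] F, A = mvfderiv 𝓘(ℝ, E) f x := ⟨_, rfl⟩
  have hA' : ∀ v : E, A (Complex.I • v) = Complex.I • A v := fun v => by
    rw [hA]; exact hJ v
  let B : E →L[ℂ] F :=
    { toFun := A
      map_add' := A.map_add
      map_smul' := fun c v => by
        have h1 : c • v = c.re • v + c.im • (Complex.I • v) := by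
          conv_lhs => rw [← Complex.re_add_im c]
          rw [add_smul, mul_smul, Complex.coe_smul, Complex.coe_smul]
        have h2 : c • A v = c.re • A v + c.im • (Complex.I • A v) := by
          conv_lhs => rw [← Complex.re_add_im c]
          rw [add_smul, mul_smul, Complex.coe_smul, Complex.coe_smul]
        simp only [RingHom.id_apply]
        rw [h1, h2, A.map_add, A.map_smul, A.map_smul, hA']
      cont := A.cont }
  have hm := h.hasMFDerivAt
  have h2 : HasFDerivWithinAt (𝕜 := ℂ) (writtenInExtChartAt 𝓘(ℂ, E) 𝓘(ℂ, F) x f) B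
      (Set.range 𝓘(ℂ, E)) (extChartAt 𝓘(ℂ, E) x x) := by
    refine HasFDerivWithinAt.of_restrictScalars ℝ (f' := B) (g' := A) ?_ (ContinuousLinearMap.ext fun _ => rfl)
    rw [hA]
    exact hm.2
  exact (show HasMFDerivAt 𝓘(ℂ, E) 𝓘(ℂ, F) f x B from ⟨hm.1, h2⟩).mdifferentiableAt

instance isManifold_real_minSmoothness_two [IsManifold 𝓘(ℂ, E) ω M] :
    IsManifold 𝓘(ℝ, E) (minSmoothness ℝ 2) M :=
  IsManifold.of_le (n := ∞) (by rw [minSmoothness_of_isRCLikeNormedField]; exact ENat.LEInfty.out)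

instance isManifold_real_minSmoothness_three [IsManifold 𝓘(ℂ, E) ω M] :
    IsManifold 𝓘(ℝ, E) (minSmoothness ℝ 3) M :=
  IsManifold.of_le (n := ∞) (by rw [minSmoothness_of_isRCLikeNormedField]; exact ENat.LEInfty.out)

variable [IsManifold 𝓘(ℂ, E) ω M]

/-- The derivative of the chart at `p`, at the point `y`. -/
def chartDeriv (p y : M) : TM E y →L[ℝ] E :=
  mfderiv 𝓘(ℝ, E) 𝓘(ℝ, E) (extChartAt 𝓘(ℝ, E) p) y

lemma hasMFDerivAt_extChartAt_chartDeriv {p y : M} (hy : y ∈ (chartAt E p).source) :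
    HasMFDerivAt 𝓘(ℝ, E) 𝓘(ℝ, E) (extChartAt 𝓘(ℝ, E) p) y (chartDeriv p y) :=
  (mdifferentiableAt_extChartAt hy).hasMFDerivAt

/-- `J` at `y` is defined through the chart at `y`, not the one at `p`; the charts being
holomorphically compatible makes the two agree. -/
lemma chartDeriv_J {p y : M} (hy : y ∈ (chartAt E p).source) (v : TM E y) :
    chartDeriv p y (J y v) = Complex.I • chartDeriv p y v := by
  have : IsManifold 𝓘(ℂ, E) 1 M := IsManifold.of_le (n := ω) le_top
  exact mfderiv_J_of_complex (f := extChartAt 𝓘(ℝ, E) p)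
    (mdifferentiableAt_extChartAt (I := 𝓘(ℂ, E)) hy) v

lemma isInvertible_chartDeriv {p y : M} (hy : y ∈ (chartAt E p).source) :
    (chartDeriv (E := E) p y).IsInvertible :=
  isInvertible_mfderiv_extChartAt (I := 𝓘(ℝ, E)) (x := p) (y := y) (by simpa using hy)

/-- The vector field on a chart domain with prescribed components in the chart. -/
def chartField (p : M) (s : E → E) : VF E M :=
  VectorField.mpullback 𝓘(ℝ, E) 𝓘(ℝ, E) (extChartAt 𝓘(ℝ, E) p) s

lemma chartField_apply (p : M) (s : E → E) (y : M) :
    chartField p s y = (chartDeriv p y).inverse (s (extChartAt 𝓘(ℝ, E) p y)) := rfl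

lemma chartDeriv_chartField {p y : M} (hy : y ∈ (chartAt E p).source) (s : E → E) :
    chartDeriv p y (chartField p s y) = s (extChartAt 𝓘(ℝ, E) p y) :=
  (isInvertible_chartDeriv hy).self_apply_inverse _

lemma eq_chartField {p y : M} (hy : y ∈ (chartAt E p).source) {s : E → E} {v : TM E y}
    (hv : chartDeriv p y v = s (extChartAt 𝓘(ℝ, E) p y)) : v = chartField p s y :=
  (isInvertible_chartDeriv hy).injective (hv.trans (chartDeriv_chartField hy s).symm)

lemma J_chartField {p y : M} (hy : y ∈ (chartAt E p).source) (s : E → E) :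
    J y (chartField p s y) = chartField p (fun q => Complex.I • s q) y := by
  refine eq_chartField hy ?_
  rw [chartDeriv_J hy, chartDeriv_chartField hy]

lemma mdifferentiableAt_vectorSpace {s : E → E} {q : E} (hs : ContDiffAt ℝ 1 s q) :
    MDifferentiableAt 𝓘(ℝ, E) 𝓘(ℝ, E).tangent
      (fun q => (⟨q, s q⟩ : TangentBundle 𝓘(ℝ, E) E)) q := by
  have h : ContMDiffAt 𝓘(ℝ, E) 𝓘(ℝ, E).tangent 1
      (fun q => (⟨q, s q⟩ : TangentBundle 𝓘(ℝ, E) E)) q :=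
    contMDiffAt_vectorSpace_iff_contDiffAt.2 hs
  exact h.mdifferentiableAt one_ne_zero

lemma mlieBracket_vectorSpace (s t : E → E) :
    VectorField.mlieBracket 𝓘(ℝ, E) (fun q => (s q : TangentSpace 𝓘(ℝ, E) q)) t
      = VectorField.lieBracket ℝ s t := by
  have h := VectorField.mlieBracketWithin_eq_lieBracketWithin (𝕜 := ℝ) (E := E)
    (V := fun q => (s q : TangentSpace 𝓘(ℝ, E) q)) (W := fun q => (t q : TangentSpace 𝓘(ℝ, E) q))
    (s := Set.univ)
  exact VectorField.mlieBracketWithin_univ.symm.trans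
    (h.trans VectorField.lieBracketWithin_univ)

variable [CompleteSpace E]

lemma contMDiffAt_chartField {p y : M} (hy : y ∈ (chartAt E p).source) {s : E → E}
    (hs : ContDiffAt ℝ ∞ s (extChartAt 𝓘(ℝ, E) p y)) :
    ContMDiffAt 𝓘(ℝ, E) 𝓘(ℝ, E).tangent ∞
      (fun z => (⟨z, chartField p s z⟩ : TangentBundle 𝓘(ℝ, E) M)) y := by
  have h1 : ContMDiffAt 𝓘(ℝ, E) 𝓘(ℝ, E) ∞ (extChartAt 𝓘(ℝ, E) p) y := contMDiffAt_extChartAt' hy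
  have h2 : ContMDiffAt 𝓘(ℝ, E) 𝓘(ℝ, E).tangent ∞
      (fun q => (⟨q, s q⟩ : TangentBundle 𝓘(ℝ, E) E)) (extChartAt 𝓘(ℝ, E) p y) :=
    contMDiffAt_vectorSpace_iff_contDiffAt.2 hs
  exact ContMDiffAt.mpullback_vectorField_preimage h2 h1 (isInvertible_chartDeriv (E := E) hy) (by simp)

lemma mdifferentiableAt_chartField {p y : M} (hy : y ∈ (chartAt E p).source) {s : E → E}
    (hs : ContDiffAt ℝ 1 s (extChartAt 𝓘(ℝ, E) p y : E)) :
    (chartField p s).DifferentiableAt y := by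
  have h1 : ContMDiffAt 𝓘(ℝ, E) 𝓘(ℝ, E) ∞ (extChartAt 𝓘(ℝ, E) p) y := contMDiffAt_extChartAt' hy
  have h2 := mdifferentiableAt_vectorSpace (E := E) (s := s) hs
  exact MDifferentiableAt.mpullback_vectorField (V := s) h2 h1
    (isInvertible_chartDeriv (E := E) hy) (by exact ENat.LEInfty.out)

/-- Naturality of the Lie bracket under pullback by the chart; brackets can then be computed with
`fderiv` in `E`. -/
lemma mlieBracket_chartField {p y : M} (hy : y ∈ (chartAt E p).source) {s t : E → E}
    (hs : ContDiffAt ℝ 1 s (extChartAt 𝓘(ℝ, E) p y : E))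
    (ht : ContDiffAt ℝ 1 t (extChartAt 𝓘(ℝ, E) p y : E)) :
    VectorField.mlieBracket 𝓘(ℝ, E) (chartField p s) (chartField p t) y
      = chartField p (VectorField.lieBracket ℝ s t) y := by
  have h1 : ContMDiffAt 𝓘(ℝ, E) 𝓘(ℝ, E) ∞ (extChartAt 𝓘(ℝ, E) p) y := contMDiffAt_extChartAt' hy
  have h2 := mdifferentiableAt_vectorSpace (E := E) (s := s) hs
  have h3 := mdifferentiableAt_vectorSpace (E := E) (s := t) ht
  have h := VectorField.mpullback_mlieBracket (I := 𝓘(ℝ, E)) (I' := 𝓘(ℝ, E)) (V := s) (W := t)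
    (n := ∞) (f := extChartAt 𝓘(ℝ, E) p) (x₀ := y) h2 h3 h1
    (by rw [minSmoothness_of_isRCLikeNormedField]; exact ENat.LEInfty.out)
  exact h.symm.trans (congrArg (fun r => VectorField.mpullback 𝓘(ℝ, E) 𝓘(ℝ, E)
    (extChartAt 𝓘(ℝ, E) p) r y) (mlieBracket_vectorSpace s t))

end Holomorphic

/-! ### Components of vector fields in a chart -/

section ChartComponents

variable {E : Type*} [NormedAddCommGroup E] [NormedSpace ℂ E]
  {M : Type*} [TopologicalSpace M] [ChartedSpace E M] [IsManifold 𝓘(ℂ, E) ω M]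

/-- Smoothness of a vector field at a point. -/
def VF.SmoothAt (X : VF E M) (x : M) : Prop :=
  ContMDiffAt 𝓘(ℝ, E) 𝓘(ℝ, E).tangent ∞ (fun y => (⟨y, X y⟩ : TangentBundle 𝓘(ℝ, E) M)) x

lemma VF.SmoothAt.differentiableAt {X : VF E M} {x : M} (h : X.SmoothAt x) :
    X.DifferentiableAt x :=
  ContMDiffAt.mdifferentiableAt h (by simp)

lemma VF.SmoothOn.smoothAt {X : VF E M} {U : Set M} {x : M} (h : X.SmoothOn U) (hU : IsOpen U)
    (hx : x ∈ U) : X.SmoothAt x :=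
  ContMDiffOn.contMDiffAt h (hU.mem_nhds hx)

lemma VF.SmoothAt.congr {X Y : VF E M} {x : M} (h : X.SmoothAt x) (hY : ∀ᶠ y in nhds x, Y y = X y) :
    Y.SmoothAt x :=
  ContMDiffAt.congr_of_eventuallyEq h (hY.mono fun y hy => by simp only [hy])

lemma VF.smoothOn_of_smoothAt {X : VF E M} {U : Set M} (h : ∀ x ∈ U, X.SmoothAt x) :
    X.SmoothOn U :=
  fun x hx => (h x hx).contMDiffWithinAt

/-- The components of a vector field in the chart at `p`. -/
def chartRep (p : M) (X : VF E M) (q : E) : E :=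
  chartDeriv p ((extChartAt 𝓘(ℝ, E) p).symm q) (X ((extChartAt 𝓘(ℝ, E) p).symm q))

lemma extChartAt_symm_apply {p y : M} (hy : y ∈ (chartAt E p).source) :
    (extChartAt 𝓘(ℝ, E) p).symm (extChartAt 𝓘(ℝ, E) p y) = y :=
  (extChartAt 𝓘(ℝ, E) p).left_inv (by simpa using hy)

lemma chartRep_extChartAt {p y : M} (hy : y ∈ (chartAt E p).source) (X : VF E M) :
    chartRep p X (extChartAt 𝓘(ℝ, E) p y) = chartDeriv p y (X y) := by
  rw [chartRep, extChartAt_symm_apply hy]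

lemma chartField_chartRep {p y : M} (hy : y ∈ (chartAt E p).source) (X : VF E M) :
    chartField p (chartRep p X) y = X y :=
  (eq_chartField hy (chartRep_extChartAt hy X).symm).symm

lemma contMDiffAt_extChartAt_symm {p y : M} (hy : y ∈ (chartAt E p).source) :
    ContMDiffAt 𝓘(ℝ, E) 𝓘(ℝ, E) ∞ (extChartAt 𝓘(ℝ, E) p).symm (extChartAt 𝓘(ℝ, E) p y) := by
  have ht : extChartAt 𝓘(ℝ, E) p y ∈ (extChartAt 𝓘(ℝ, E) p).target :=
    (extChartAt 𝓘(ℝ, E) p).map_source (by simpa using hy)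
  exact (contMDiffOn_extChartAt_symm (I := 𝓘(ℝ, E)) (n := ∞) p).contMDiffAt
    ((isOpen_extChartAt_target p).mem_nhds ht)

lemma contDiffAt_chartRep {p y : M} (hy : y ∈ (chartAt E p).source) {X : VF E M}
    (hX : X.SmoothAt y) : ContDiffAt ℝ ∞ (chartRep p X) (extChartAt 𝓘(ℝ, E) p y) := by
  have h1 : ContMDiffAt 𝓘(ℝ, E) 𝓘(ℝ, E) ∞ (fun z => (chartDeriv p z (X z) : E)) y := by
    have h := ((trivializationAt E (TangentSpace 𝓘(ℝ, E)) p).contMDiffAt_section_iff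
      (s := X) (by simpa using hy)).1 hX
    refine h.congr_of_eventuallyEq ?_
    filter_upwards [(chartAt E p).open_source.mem_nhds hy] with z hz
    have hz' : z ∈ (trivializationAt E (TangentSpace 𝓘(ℝ, E)) p).baseSet := by simpa using hz
    have h2 := DFunLike.congr_fun
      (TangentBundle.continuousLinearMapAt_trivializationAt (I := 𝓘(ℝ, E)) hz) (X z)
    rw [Trivialization.continuousLinearMapAt_apply, Trivialization.linearMapAt_apply,
      if_pos hz'] at h2
    exact h2.symm
  have h2 := contMDiffAt_extChartAt_symm hy
  rw [← contMDiffAt_iff_contDiffAt]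
  refine ContMDiffAt.comp (extChartAt 𝓘(ℝ, E) p y) (g := fun z => (chartDeriv p z (X z) : E)) ?_ h2
  rw [extChartAt_symm_apply hy]
  exact h1

variable [CompleteSpace E]

lemma smoothAt_chartField {p y : M} (hy : y ∈ (chartAt E p).source) {s : E → E}
    (hs : ContDiffAt ℝ ∞ s (extChartAt 𝓘(ℝ, E) p y)) : (chartField p s).SmoothAt y :=
  contMDiffAt_chartField hy hs

end ChartComponents

/-! ### Connections in a chart: locality and smoothness -/

section Connection

variable {E : Type*} [NormedAddCommGroup E] [NormedSpace ℂ E]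
  {M : Type*} [TopologicalSpace M] [ChartedSpace E M] [IsManifold 𝓘(ℂ, E) ω M]

lemma connection_congr (D : Connection E M) {X Y : VF E M} {x : M} (hX : X.DifferentiableAt x)
    (h : ∀ᶠ y in nhds x, Y y = X y) : D Y x = D X x := by
  have hY : Y.DifferentiableAt x :=
    MDifferentiableAt.congr_of_eventuallyEq hX (h.mono fun y hy => by simp only [hy])
  exact D.isCovariantDerivativeOn.congr_of_eventuallyEq (s := Set.univ) hY hX Filter.univ_mem h

lemma connection_sum (D : Connection E M) {ι : Type*} (s : Finset ι) {X : ι → VF E M} {x : M}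
    (hX : ∀ i ∈ s, (X i).DifferentiableAt x) :
    D (fun y => ∑ i ∈ s, X i y) x = ∑ i ∈ s, D (X i) x := by
  classical
  induction s using Finset.induction_on with
  | empty =>
    have : (fun y : M => ∑ i ∈ (∅ : Finset ι), X i y) = (0 : VF E M) := by
      funext y; simp
    rw [this, D.zero]; rfl
  | insert i s hi ih =>
    have h : (fun y => ∑ j ∈ insert i s, X j y) = X i + fun y => ∑ j ∈ s, X j y := by
      funext y; simp [Finset.sum_insert hi]
    rw [h, D.isCovariantDerivativeOnUniv.add (hX i (Finset.mem_insert_self i s))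
      (MDifferentiableAt.sum_section fun j hj => hX j (Finset.mem_insert_of_mem hj)),
      ih fun j hj => hX j (Finset.mem_insert_of_mem hj), Finset.sum_insert hi]

variable [FiniteDimensional ℂ E] [CompleteSpace E]

/-- Covariant derivatives in terms of the components in a chart. -/
lemma connection_chartField (D : Connection E M) {p x : M} (hx : x ∈ (chartAt E p).source)
    {s : E → E} (hs : ContDiffAt ℝ 1 s (extChartAt 𝓘(ℝ, E) p x : E)) (w : TM E x) :
    D (chartField p s) x w
      = chartField p (fun q => fderiv ℝ s q (chartDeriv p x w)) x
        + D (chartField p (fun _ => s (extChartAt 𝓘(ℝ, E) p x))) x w := by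
  let b := Module.finBasis ℝ E
  let c : M → Fin (Module.finrank ℝ E) → ℝ := fun y i => b.equivFunL (s (extChartAt 𝓘(ℝ, E) p y)) i
  let X : Fin (Module.finrank ℝ E) → VF E M := fun i => chartField p (fun _ => b i)
  have hX : ∀ i, (X i).DifferentiableAt x := fun i => mdifferentiableAt_chartField hx contDiffAt_const
  have hexp : ∀ (y : M) (u : E), ((chartDeriv p y).inverse u : TM E y)
      = ∑ i, b.equivFunL u i • X i y := fun y u => by
    conv_lhs => rw [← b.sum_equivFun u]
    rw [map_sum]
    exact Finset.sum_congr rfl fun i _ => map_smul _ _ _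
  have hsd : HasMFDerivAt 𝓘(ℝ, E) 𝓘(ℝ, E) (fun y => s (extChartAt 𝓘(ℝ, E) p y)) x
      ((fderiv ℝ s (extChartAt 𝓘(ℝ, E) p x)).comp (chartDeriv p x)) :=
    HasMFDerivAt.comp x (hs.differentiableAt one_ne_zero).hasFDerivAt.hasMFDerivAt
      (hasMFDerivAt_extChartAt_chartDeriv hx)
  have hc : ∀ i, HasMFDerivAt 𝓘(ℝ, E) 𝓘(ℝ, ℝ) (fun y => c y i) x
      (((ContinuousLinearMap.proj i).comp (b.equivFunL : E →L[ℝ] (Fin (Module.finrank ℝ E) → ℝ))).comp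
        ((fderiv ℝ s (extChartAt 𝓘(ℝ, E) p x)).comp (chartDeriv p x))) := fun i =>
    HasMFDerivAt.comp x
      ((ContinuousLinearMap.proj (φ := fun _ => ℝ) i).comp
        (b.equivFunL : E →L[ℝ] (Fin (Module.finrank ℝ E) → ℝ))).hasMFDerivAt hsd
  -- Expanding in a real basis puts the variation of `s` into scalar coefficients, where the Leibniz
  -- rule applies; freezing the coefficients at `x` gives the second summand.
  have h1 : chartField p s = fun y => ∑ i, ((fun y => c y i) • X i) y := by
    funext y
    exact hexp y _
  have h2 : D (chartField p s) x = ∑ i, D ((fun y => c y i) • X i) x := by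
    rw [h1]
    exact connection_sum D _ fun i _ => (hc i).mdifferentiableAt.smul_section (hX i)
  have h3 : chartField p (fun _ => s (extChartAt 𝓘(ℝ, E) p x))
      = fun y => ∑ i, (c x i • X i) y := by
    funext y
    exact hexp y _
  have h4 : D (chartField p (fun _ => s (extChartAt 𝓘(ℝ, E) p x))) x = ∑ i, c x i • D (X i) x := by
    rw [h3, connection_sum D _ fun i _ => ?_]
    · exact Finset.sum_congr rfl fun i _ => D.isCovariantDerivativeOnUniv.smul_const _ (hX i)
    · exact MDifferentiableAt.smul_section (f := fun _ => c x i) mdifferentiableAt_const (hX i)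
  have h5 : chartField p (fun q => fderiv ℝ s q (chartDeriv p x w)) x
      = ∑ i, b.equivFunL (fderiv ℝ s (extChartAt 𝓘(ℝ, E) p x) (chartDeriv p x w)) i • X i x :=
    hexp x _
  rw [h2, h4, h5, sum_apply, sum_apply,
    ← Finset.sum_add_distrib]
  refine Finset.sum_congr rfl fun i _ => ?_
  rw [D.isCovariantDerivativeOnUniv.leibniz (hX i) (hc i).mdifferentiableAt, add_comm, add_apply]
  congr 1
  rw [ContinuousLinearMap.smulRight_apply]
  congr 1
  rw [mvfderiv, (hc i).mfderiv]
  rfl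

variable [T2Space M]

/-- A smooth connection maps smooth local vector fields to smooth local vector fields. -/
lemma smoothAt_connection {D : Connection E M}
    (hD : CovariantDerivative.ContMDiffCovariantDerivative D ∞) {X Y : VF E M} {x : M}
    {U : Set M} (hU : IsOpen U) (hx : x ∈ U) (hX : X.SmoothOn U) (hY : Y.SmoothAt x) :
    VF.SmoothAt (fun y => D X y (Y y)) x := by
  -- Smoothness of `D` is applied to a global section, so `X` is cut off by a bump function; near
  -- `x` this changes neither `X` nor `D X`.
  obtain ⟨ψ, -, hψ⟩ := (SmoothBumpFunction.nhds_basis_tsupport (I := 𝓘(ℝ, E)) x).mem_iff.1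
    (hU.mem_nhds hx)
  have hX0 : ContMDiff 𝓘(ℝ, E) 𝓘(ℝ, E).tangent ∞
      (fun y => (⟨y, ((ψ : M → ℝ) • X) y⟩ : TangentBundle 𝓘(ℝ, E) M)) :=
    ContMDiffOn.smul_section_of_tsupport (ψ.contMDiff.contMDiffOn) hU hψ hX
  have h := (hD.contMDiff.contMDiff (σ := (ψ : M → ℝ) • X) hX0.contMDiffOn).contMDiffAt
    (x := x) Filter.univ_mem
  have h2 : VF.SmoothAt (fun y => D ((ψ : M → ℝ) • X) y (Y y)) x := ContMDiffAt.clm_bundle_apply h hY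
  refine h2.congr ?_
  filter_upwards [ψ.eventuallyEq_one.eventually_nhds, hU.mem_nhds hx] with y hy hyU
  refine DFunLike.congr_fun (connection_congr D (hX0 y |>.mdifferentiableAt (by simp)) ?_) _
  filter_upwards [hy] with z hz
  simp [hz]

end Connection

/-! ### Flat connections have local parallel fields -/

section ParallelFields

variable {E : Type*} [NormedAddCommGroup E] [NormedSpace ℂ E]
  {M : Type*} [TopologicalSpace M] [ChartedSpace E M] [IsManifold 𝓘(ℂ, E) ω M]
  [FiniteDimensional ℂ E] [CompleteSpace E]

/-- The Christoffel symbols of a connection in the chart at `p`. -/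
def christoffel (D : Connection E M) (p : M) (q : E) : E →L[ℝ] E →L[ℝ] E :=
  (∑ i, ((Module.finBasis ℝ E).coord i).toContinuousLinearMap.smulRight
    (((chartDeriv p ((extChartAt 𝓘(ℝ, E) p).symm q)).comp
      (D (chartField p fun _ => Module.finBasis ℝ E i) ((extChartAt 𝓘(ℝ, E) p).symm q))).comp
      (chartDeriv p ((extChartAt 𝓘(ℝ, E) p).symm q)).inverse : E →L[ℝ] E)).flip

/-- The sum over a basis in `christoffel` only serves to bundle continuity in `u`; linearity of `D`
on constant-coefficient fields recovers every `u`. The first argument is the direction. -/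
lemma christoffel_apply (D : Connection E M) {p y : M} (hy : y ∈ (chartAt E p).source) (h u : E) :
    christoffel D p (extChartAt 𝓘(ℝ, E) p y) h u
      = chartDeriv p y (D (chartField p fun _ => u) y (chartField p (fun _ => h) y)) := by
  let b := Module.finBasis ℝ E
  have h1 : D (chartField p fun _ => u) y = ∑ i, b.coord i u • D (chartField p fun _ => b i) y := by
    have h2 : chartField p (fun _ => u) = fun y : M => ∑ i, (b.coord i u • chartField p fun _ => b i) y := by
      funext y
      simp only [chartField_apply, Pi.smul_apply]
      conv_lhs => rw [← b.sum_equivFun u]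
      rw [map_sum]
      exact Finset.sum_congr rfl fun i _ => map_smul _ _ _
    have hX : ∀ i, (chartField p fun _ => b i).DifferentiableAt y :=
      fun i => mdifferentiableAt_chartField hy contDiffAt_const
    rw [h2, connection_sum D _ fun i _ => ?_]
    · exact Finset.sum_congr rfl fun i _ => D.isCovariantDerivativeOnUniv.smul_const _ (hX i)
    · exact MDifferentiableAt.smul_section (f := fun _ => b.coord i u) mdifferentiableAt_const (hX i)
  rw [h1, christoffel, ContinuousLinearMap.flip_apply, extChartAt_symm_apply hy]
  simp only [sum_apply, map_sum, ContinuousLinearMap.smulRight_apply, smul_apply,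
    map_smul]
  rfl

/-- In a chart `D = d + Γ`, so a field is parallel exactly when its components solve the linear
system of `exists_flat_solution` with `G = Γ`. -/
lemma chartDeriv_connection_chartField (D : Connection E M) {p x : M}
    (hx : x ∈ (chartAt E p).source) {s : E → E}
    (hs : ContDiffAt ℝ 1 s (extChartAt 𝓘(ℝ, E) p x : E)) (w : TM E x) :
    chartDeriv p x (D (chartField p s) x w)
      = fderiv ℝ s (extChartAt 𝓘(ℝ, E) p x) (chartDeriv p x w)
        + christoffel D p (extChartAt 𝓘(ℝ, E) p x) (chartDeriv p x w)
          (s (extChartAt 𝓘(ℝ, E) p x)) := by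
  rw [connection_chartField D hx hs, map_add, chartDeriv_chartField hx, christoffel_apply D hx,
    ← eq_chartField (s := fun _ => chartDeriv p x w) hx rfl]

variable [T2Space M]

lemma contDiffOn_christoffel {D : Connection E M}
    (hD : CovariantDerivative.ContMDiffCovariantDerivative D ∞) (p : M) :
    ContDiffOn ℝ ∞ (christoffel D p) (extChartAt 𝓘(ℝ, E) p).target := by
  refine contDiffOn_clm_apply.2 fun h => contDiffOn_clm_apply.2 fun u => ?_
  intro q hq
  have hy : (extChartAt 𝓘(ℝ, E) p).symm q ∈ (chartAt E p).source := by
    simpa using (extChartAt 𝓘(ℝ, E) p).map_target hq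
  have hs : VF.SmoothAt (fun y => D (chartField p fun _ => u) y (chartField p (fun _ => h) y))
      ((extChartAt 𝓘(ℝ, E) p).symm q) :=
    smoothAt_connection hD (chartAt E p).open_source hy
      (VF.smoothOn_of_smoothAt fun y hy => smoothAt_chartField hy contDiffAt_const)
      (smoothAt_chartField hy contDiffAt_const)
  have h2 := contDiffAt_chartRep hy hs
  rw [(extChartAt 𝓘(ℝ, E) p).right_inv hq] at h2
  refine (h2.congr_of_eventuallyEq ?_).contDiffWithinAt
  filter_upwards [(isOpen_extChartAt_target p).mem_nhds hq] with r hr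
  have hr' : (extChartAt 𝓘(ℝ, E) p).symm r ∈ (chartAt E p).source := by
    simpa using (extChartAt 𝓘(ℝ, E) p).map_target hr
  have h3 := christoffel_apply D hr' h u
  rw [(extChartAt 𝓘(ℝ, E) p).right_inv hr] at h3
  exact h3

-- Constant-coefficient fields commute, so the curvature applied to them has no bracket term and
-- becomes the integrability condition of the linear system.
set_option synthInstance.maxHeartbeats 100000 in
lemma christoffel_flat {D : Connection E M}
    (hD : CovariantDerivative.ContMDiffCovariantDerivative D ∞) (hflat : IsFlat D) {p : M} {q : E}
    (hq : q ∈ (extChartAt 𝓘(ℝ, E) p).target) (h k u : E) :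
    fderiv ℝ (christoffel D p) q h k u - fderiv ℝ (christoffel D p) q k h u
      + christoffel D p q h (christoffel D p q k u) - christoffel D p q k (christoffel D p q h u)
      = 0 := by
  obtain ⟨y, hy, rfl⟩ : ∃ y ∈ (chartAt E p).source, extChartAt 𝓘(ℝ, E) p y = q :=
    ⟨(extChartAt 𝓘(ℝ, E) p).symm q, by simpa using (extChartAt 𝓘(ℝ, E) p).map_target hq,
      (extChartAt 𝓘(ℝ, E) p).right_inv hq⟩
  have hG := (contDiffOn_christoffel hD p).contDiffAt ((isOpen_extChartAt_target p).mem_nhds hq)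
  have hGd : DifferentiableAt ℝ (christoffel D p) (extChartAt 𝓘(ℝ, E) p y) :=
    hG.differentiableAt (by simp)
  have hsm : ∀ u : E, (chartField p fun _ => u).SmoothOn (chartAt E p).source := fun u =>
    VF.smoothOn_of_smoothAt fun y hy => smoothAt_chartField hy contDiffAt_const
  have key : ∀ h k : E, chartDeriv p y (D (fun z => D (chartField p fun _ => u) z
        (chartField p (fun _ => k) z)) y (chartField p (fun _ => h) y))
      = fderiv ℝ (christoffel D p) (extChartAt 𝓘(ℝ, E) p y) h k u
        + christoffel D p (extChartAt 𝓘(ℝ, E) p y) h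
          (christoffel D p (extChartAt 𝓘(ℝ, E) p y) k u) := fun h k => by
    have hs : ContDiffAt ℝ ∞ (fun q => christoffel D p q k u) (extChartAt 𝓘(ℝ, E) p y) :=
      (hG.clm_apply contDiffAt_const).clm_apply contDiffAt_const
    have h1 : D (fun z => D (chartField p fun _ => u) z (chartField p (fun _ => k) z)) y
        = D (chartField p fun q => christoffel D p q k u) y := by
      refine connection_congr D (smoothAt_chartField hy hs).differentiableAt ?_
      filter_upwards [(chartAt E p).open_source.mem_nhds hy] with z hz
      exact eq_chartField hz (christoffel_apply D hz k u).symm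
    rw [h1, chartDeriv_connection_chartField D hy (hs.of_le (by exact ENat.LEInfty.out)),
      chartDeriv_chartField hy]
    congr 1
    have h2 : HasFDerivAt (fun q => christoffel D p q k u) _ (extChartAt 𝓘(ℝ, E) p y) :=
      (hGd.hasFDerivAt.clm_apply (hasFDerivAt_const k _)).clm_apply (hasFDerivAt_const u _)
    rw [h2.fderiv]
    simp
  have hfl := hflat _ (chartAt E p).open_source _ _ _ (hsm h) (hsm k) (hsm u) y hy
  have hb : VectorField.mlieBracket 𝓘(ℝ, E) (chartField p fun _ => h) (chartField p fun _ => k) y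
      = 0 := by
    rw [mlieBracket_chartField hy contDiffAt_const contDiffAt_const, chartField_apply]
    have : VectorField.lieBracket ℝ (fun _ : E => h) (fun _ : E => k) (extChartAt 𝓘(ℝ, E) p y)
        = 0 := by simp [VectorField.lieBracket]
    rw [this, map_zero]
  rw [hb, map_zero, sub_zero] at hfl
  have hfl2 := congrArg (chartDeriv p y) hfl
  rw [map_sub, map_zero, key, key] at hfl2
  rw [← hfl2]
  abel

/-- A flat connection has local parallel vector fields with arbitrary initial value. -/
lemma exists_parallel_field {D : Connection E M}
    (hD : CovariantDerivative.ContMDiffCovariantDerivative D ∞) (hflat : IsFlat D) (p : M)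
    (v : TM E p) : ∃ U : Set M, IsOpen U ∧ p ∈ U ∧ ∃ X : VF E M, X.SmoothOn U ∧ X p = v ∧
      ∀ y ∈ U, D X y = 0 := by
  have hp : p ∈ (chartAt E p).source := mem_chart_source E p
  have ht : (extChartAt 𝓘(ℝ, E) p).target ∈ nhds (extChartAt 𝓘(ℝ, E) p p) :=
    (isOpen_extChartAt_target p).mem_nhds (mem_extChartAt_target p)
  have hG := contDiffOn_christoffel hD p
  obtain ⟨r, hr, s, hs0, hs⟩ := exists_flat_solution
    ((hG.contDiffAt ht).of_le (by exact ENat.LEInfty.out))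
    (by filter_upwards [ht] with q hq h k u using christoffel_flat hD hflat hq h k u)
    (chartDeriv p p v)
  let W := Metric.ball (extChartAt 𝓘(ℝ, E) p p) r ∩ (extChartAt 𝓘(ℝ, E) p).target
  have hW : IsOpen W := Metric.isOpen_ball.inter (isOpen_extChartAt_target p)
  have hsW : ContDiffOn ℝ ∞ s W := contDiffOn_of_hasFDerivAt_linear hW
    (hG.mono Set.inter_subset_right) fun y hy => hs y hy.1
  let U := (chartAt E p).source ∩ extChartAt 𝓘(ℝ, E) p ⁻¹' W
  have hU : IsOpen U := by
    have h := (continuousOn_extChartAt (I := 𝓘(ℝ, E)) p).isOpen_inter_preimage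
      (isOpen_extChartAt_source p) hW
    simpa [U, extChartAt_source] using h
  refine ⟨U, hU, ⟨hp, Metric.mem_ball_self hr, mem_extChartAt_target p⟩, chartField p s,
    VF.smoothOn_of_smoothAt fun y hy =>
      smoothAt_chartField hy.1 (hsW.contDiffAt (hW.mem_nhds hy.2)),
    (eq_chartField hp hs0.symm).symm, fun y hy => ?_⟩
  ext1 w
  apply (isInvertible_chartDeriv hy.1).injective
  rw [chartDeriv_connection_chartField D hy.1
    ((hsW.contDiffAt (hW.mem_nhds hy.2)).of_le (by exact ENat.LEInfty.out)),
    (hs _ hy.2.1).fderiv]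
  simp

end ParallelFields

/-! ### Functions with vanishing derivative -/

section LocallyConstant

variable {E : Type*} [NormedAddCommGroup E] [NormedSpace ℂ E]
  {M : Type*} [TopologicalSpace M] [ChartedSpace E M] [IsManifold 𝓘(ℂ, E) ω M]

/-- A function with vanishing derivative is locally constant. -/
lemma eventually_eq_of_mvfderiv_eq_zero {F : Type*} [NormedAddCommGroup F] [NormedSpace ℝ F]
    {f : M → F} {x : M}
    (h : ∀ᶠ y in nhds x, MDifferentiableAt 𝓘(ℝ, E) 𝓘(ℝ, F) f y ∧ mvfderiv 𝓘(ℝ, E) f y = 0) :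
    ∀ᶠ y in nhds x, f y = f x := by
  have ht : (extChartAt 𝓘(ℝ, E) x).target ∈ nhds (extChartAt 𝓘(ℝ, E) x x) :=
    (isOpen_extChartAt_target x).mem_nhds (mem_extChartAt_target x)
  have hc : Filter.Tendsto (extChartAt 𝓘(ℝ, E) x).symm (nhds (extChartAt 𝓘(ℝ, E) x x)) (nhds x) := by
    simpa [ContinuousAt] using continuousAt_extChartAt_symm (I := 𝓘(ℝ, E)) x
  obtain ⟨r, hr, hB⟩ := Metric.eventually_nhds_iff_ball.1 ((hc.eventually h).and ht)
  have hconst : ∀ q ∈ Metric.ball (extChartAt 𝓘(ℝ, E) x x) r,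
      (f ∘ (extChartAt 𝓘(ℝ, E) x).symm) q = f x := by
    intro q hq
    have hd : ∀ q ∈ Metric.ball (extChartAt 𝓘(ℝ, E) x x) r,
        HasFDerivAt (f ∘ (extChartAt 𝓘(ℝ, E) x).symm) (0 : E →L[ℝ] F) q := fun q hq => by
      obtain ⟨⟨h1, h2⟩, h3⟩ := hB q hq
      have h4 : MDifferentiableAt 𝓘(ℝ, E) 𝓘(ℝ, E) (extChartAt 𝓘(ℝ, E) x).symm q :=
        ((contMDiffOn_extChartAt_symm (I := 𝓘(ℝ, E)) (n := ∞) x).contMDiffAt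
          ((isOpen_extChartAt_target x).mem_nhds h3)).mdifferentiableAt (by simp)
      have h5 := HasMFDerivAt.comp q h1.hasMFDerivAt h4.hasMFDerivAt
      have h6 : mfderiv 𝓘(ℝ, E) 𝓘(ℝ, F) f ((extChartAt 𝓘(ℝ, E) x).symm q) = 0 := h2
      rw [h6, ContinuousLinearMap.zero_comp] at h5
      exact hasMFDerivAt_iff_hasFDerivAt.1 h5
    have h0 := (convex_ball (extChartAt 𝓘(ℝ, E) x x) r).is_const_of_fderivWithin_eq_zero (𝕜 := ℝ)
      (fun q hq => (hd q hq).differentiableAt.differentiableWithinAt)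
      (fun q hq => (hd q hq).hasFDerivWithinAt.fderivWithin
        (Metric.isOpen_ball.uniqueDiffWithinAt hq)) hq (Metric.mem_ball_self hr)
    rw [h0]
    simp
  filter_upwards [(continuousAt_extChartAt (I := 𝓘(ℝ, E)) x).preimage_mem_nhds
    (Metric.ball_mem_nhds _ hr), (chartAt E x).open_source.mem_nhds (mem_chart_source E x)]
    with y hy hy2
  have h7 := hconst _ hy
  rwa [Function.comp_apply, extChartAt_symm_apply hy2] at h7

end LocallyConstant

/-! ### The action of `J` on fields, and integrability -/

section Fields

variable {E : Type*} [NormedAddCommGroup E] [NormedSpace ℂ E]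
  {M : Type*} [TopologicalSpace M] [ChartedSpace E M] [IsManifold 𝓘(ℂ, E) ω M]

/-- The vector field `J X`. -/
def VF.J (X : VF E M) : VF E M := fun y => BismutFlat.J y (X y)

lemma VF.J_J (X : VF E M) : X.J.J = -X := funext fun y => BismutFlat.J_J y (X y)

lemma eventually_eq_chartField {p : M} (X : VF E M) :
    ∀ᶠ y in nhds p, X y = chartField p (chartRep p X) y := by
  filter_upwards [(chartAt E p).open_source.mem_nhds (mem_chart_source E p)] with y hy
  exact (chartField_chartRep hy X).symm

lemma eventually_J_eq_chartField {p : M} (X : VF E M) :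
    ∀ᶠ y in nhds p, X.J y = chartField p (fun q => Complex.I • chartRep p X q) y := by
  filter_upwards [(chartAt E p).open_source.mem_nhds (mem_chart_source E p)] with y hy
  rw [← J_chartField hy, chartField_chartRep hy]
  rfl

lemma VF.SmoothAt.neg {X : VF E M} {x : M} (h : X.SmoothAt x) : (-X).SmoothAt x :=
  ContMDiffAt.neg_section h

variable [CompleteSpace E]

lemma VF.SmoothAt.J {X : VF E M} {x : M} (h : X.SmoothAt x) : X.J.SmoothAt x :=
  (smoothAt_chartField (mem_chart_source E x)
    ((contDiffAt_chartRep (mem_chart_source E x) h).const_smul Complex.I)).congr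
    (eventually_J_eq_chartField X)

/-- The Nijenhuis tensor of `J` vanishes. -/
lemma nijenhuis_eq_zero {X Y : VF E M} {x : M} (hX : X.SmoothAt x) (hY : Y.SmoothAt x) :
    VectorField.mlieBracket 𝓘(ℝ, E) X.J Y.J x - VectorField.mlieBracket 𝓘(ℝ, E) X Y x
      - J x (VectorField.mlieBracket 𝓘(ℝ, E) X.J Y x)
      - J x (VectorField.mlieBracket 𝓘(ℝ, E) X Y.J x) = 0 := by
  have hx := mem_chart_source E x
  have hs := (contDiffAt_chartRep hx hX).of_le (m := 1) (by exact ENat.LEInfty.out)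
  have ht := (contDiffAt_chartRep hx hY).of_le (m := 1) (by exact ENat.LEInfty.out)
  have hIs := hs.const_smul Complex.I
  have hIt := ht.const_smul Complex.I
  have eX := eventually_eq_chartField (p := x) X
  have eY := eventually_eq_chartField (p := x) Y
  have eJX := eventually_J_eq_chartField (p := x) X
  have eJY := eventually_J_eq_chartField (p := x) Y
  rw [Filter.EventuallyEq.mlieBracket_vectorField_eq eJX eJY,
    Filter.EventuallyEq.mlieBracket_vectorField_eq eX eY,
    Filter.EventuallyEq.mlieBracket_vectorField_eq eJX eY,
    Filter.EventuallyEq.mlieBracket_vectorField_eq eX eJY,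
    mlieBracket_chartField hx hIs hIt, mlieBracket_chartField hx hs ht,
    mlieBracket_chartField hx hIs ht, mlieBracket_chartField hx hs hIt]
  -- In the chart `J` is the constant operator `I`, which commutes with differentiation, and the
  -- eight derivative terms cancel in pairs.
  apply (isInvertible_chartDeriv hx).injective
  simp only [map_sub, map_zero, chartDeriv_J hx, chartDeriv_chartField hx, VectorField.lieBracket]
  have d1 := (hs.differentiableAt one_ne_zero).hasFDerivAt
  have d2 := (ht.differentiableAt one_ne_zero).hasFDerivAt
  have e1 : fderiv ℝ (fun q => Complex.I • chartRep x X q) (extChartAt 𝓘(ℝ, E) x x)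
    = Complex.I • fderiv ℝ (chartRep x X) (extChartAt 𝓘(ℝ, E) x x) := (d1.const_smul Complex.I).fderiv
  have e2 : fderiv ℝ (fun q => Complex.I • chartRep x Y q) (extChartAt 𝓘(ℝ, E) x x)
    = Complex.I • fderiv ℝ (chartRep x Y) (extChartAt 𝓘(ℝ, E) x x) := (d2.const_smul Complex.I).fderiv
  rw [e1, e2]
  simp only [smul_apply, smul_sub, smul_smul, Complex.I_mul_I, neg_smul, one_smul]
  abel

/-- Scalar products of smooth vector fields are smooth. -/
lemma smoothAt_inner (g : HermitianMetric E M) {X Y : VF E M} {x : M} (hX : X.SmoothAt x)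
    (hY : Y.SmoothAt x) :
    ContMDiffAt 𝓘(ℝ, E) 𝓘(ℝ) ∞ (fun y => g.inner y (X y) (Y y)) x := by
  letI : RiemannianBundle (TangentSpace 𝓘(ℝ, E) : M → Type _) :=
    ⟨g.toContMDiffRiemannianMetric.toRiemannianMetric⟩
  exact ContMDiffAt.inner_bundle (F := E) (E := (TangentSpace 𝓘(ℝ, E) : M → Type _)) hX hY

/-- The vector field `X` is smooth and parallel on `U`. -/
structure VF.ParallelOn (D : Connection E M) (X : VF E M) (U : Set M) : Prop where
  smooth : ∀ y ∈ U, X.SmoothAt y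
  parallel : ∀ y ∈ U, D X y = 0

lemma VF.ParallelOn.mono {D : Connection E M} {X : VF E M} {U V : Set M} (h : X.ParallelOn D U)
    (hV : V ⊆ U) : X.ParallelOn D V :=
  ⟨fun y hy => h.smooth y (hV hy), fun y hy => h.parallel y (hV hy)⟩

lemma VF.ParallelOn.J {g : HermitianMetric E M} {D : Connection E M}
    (hD : IsHermitianConnection g D) {X : VF E M} {U : Set M} (h : X.ParallelOn D U) :
    X.J.ParallelOn D U :=
  ⟨fun y hy => (h.smooth y hy).J, fun y hy => by
    ext1 w
    have := hD.complex y X (h.smooth y hy).differentiableAt w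
    rw [h.parallel y hy] at this
    exact this.trans (by simp)⟩

end Fields

/-! ### Bismut torsion on parallel fields: Bianchi identity and integrability -/

section Torsion

variable {E : Type*} [NormedAddCommGroup E] [NormedSpace ℂ E]
  {M : Type*} [TopologicalSpace M] [ChartedSpace E M] [IsManifold 𝓘(ℂ, E) ω M]
  [FiniteDimensional ℂ E] [CompleteSpace E]

/-- The function `⟨T(X, Y), Z⟩`. -/
def torsionForm (g : HermitianMetric E M) (D : Connection E M) (X Y Z : VF E M) (y : M) : ℝ :=
  g.inner y (CovariantDerivative.torsion D y (X y) (Y y)) (Z y)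

/-- The vector field `T(X, Y)`. -/
def torsionField (D : Connection E M) (X Y : VF E M) : VF E M :=
  fun y => CovariantDerivative.torsion D y (X y) (Y y)

variable {g : HermitianMetric E M} {D : Connection E M} {U : Set M} {X Y Z W : VF E M}

lemma mlieBracket_of_parallel (hX : X.ParallelOn D U) (hY : Y.ParallelOn D U) {x : M} (hx : x ∈ U) :
    VectorField.mlieBracket 𝓘(ℝ, E) X Y x = - torsionField D X Y x := by
  have h := CovariantDerivative.torsion_apply D (hX.smooth x hx).differentiableAt
    (hY.smooth x hx).differentiableAt
  rw [hX.parallel x hx, hY.parallel x hx] at h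
  rw [torsionField, h]
  simp

/-- Near `x` the field is minus a Lie bracket of smooth fields, so smoothness of the torsion tensor
itself is never needed. -/
lemma smoothAt_torsionField (hU : IsOpen U) (hX : X.ParallelOn D U) (hY : Y.ParallelOn D U)
    {x : M} (hx : x ∈ U) : (torsionField D X Y).SmoothAt x := by
  have : IsManifold 𝓘(ℝ, E) (((⊤ : ℕ∞) : WithTop ℕ∞) + 1) M :=
    (inferInstance : IsManifold 𝓘(ℝ, E) ∞ M)
  have h : VF.SmoothAt (VectorField.mlieBracket 𝓘(ℝ, E) X Y) x :=
    ContMDiffAt.mlieBracket_vectorField (m := ⊤) (n := ⊤) (hX.smooth x hx) (hY.smooth x hx)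
      (by rw [minSmoothness_of_isRCLikeNormedField]; rfl)
  refine h.neg.congr ?_
  filter_upwards [hU.mem_nhds hx] with y hy
  rw [Pi.neg_apply, mlieBracket_of_parallel hX hY hy, neg_neg]

lemma smoothAt_torsionForm (hU : IsOpen U) (hX : X.ParallelOn D U) (hY : Y.ParallelOn D U)
    (hZ : Z.ParallelOn D U) {x : M} (hx : x ∈ U) :
    ContMDiffAt 𝓘(ℝ, E) 𝓘(ℝ) ∞ (torsionForm g D X Y Z) x :=
  smoothAt_inner g (smoothAt_torsionField hU hX hY hx) (hZ.smooth x hx)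

/-- The derivative of `⟨T(X, Y), Z⟩` in the direction `W`. -/
def torsionDeriv (g : HermitianMetric E M) (D : Connection E M) (x : M) (W X Y Z : VF E M) : ℝ :=
  mvfderiv 𝓘(ℝ, E) (torsionForm g D X Y Z) x (W x)

/-- One term of the Jacobi identity: `[Z, [X, Y]] = -D_Z (T(X, Y)) + T(Z, T(X, Y))`. Pairing with
the parallel field `W` turns the first term into a derivative of a function, and skewness of `T`
turns the second into a scalar product of two torsions. -/
lemma inner_mlieBracket_mlieBracket (hb : IsBismut g D) (hU : IsOpen U) (hX : X.ParallelOn D U)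
    (hY : Y.ParallelOn D U) (hZ : Z.ParallelOn D U) (hW : W.ParallelOn D U) {x : M} (hx : x ∈ U) :
    g.inner x (VectorField.mlieBracket 𝓘(ℝ, E) Z (VectorField.mlieBracket 𝓘(ℝ, E) X Y) x) (W x)
      = - torsionDeriv g D x Z X Y W
        - g.inner x (torsionField D X Y x) (torsionField D Z W x) := by
  have hτ := smoothAt_torsionField hU hX hY hx
  have h1 : VectorField.mlieBracket 𝓘(ℝ, E) Z (VectorField.mlieBracket 𝓘(ℝ, E) X Y) x
      = - VectorField.mlieBracket 𝓘(ℝ, E) Z (torsionField D X Y) x := by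
    have h2 : ∀ᶠ y in nhds x, VectorField.mlieBracket 𝓘(ℝ, E) X Y y
        = ((-1 : ℝ) • torsionField D X Y : VF E M) y := by
      filter_upwards [hU.mem_nhds hx] with y hy
      rw [mlieBracket_of_parallel hX hY hy, Pi.smul_apply, neg_one_smul]
    rw [Filter.EventuallyEq.mlieBracket_vectorField_eq (V := Z)
      (Filter.Eventually.of_forall fun _ => rfl) h2,
      VectorField.mlieBracket_const_smul_right hτ.differentiableAt, neg_one_smul]
  have h3 := CovariantDerivative.torsion_apply D (hZ.smooth x hx).differentiableAt
    hτ.differentiableAt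
  have h4 := hb.metric x (torsionField D X Y) W hτ.differentiableAt
    (hW.smooth x hx).differentiableAt (Z x)
  have h5 := hb.torsion_skew x (Z x) (torsionField D X Y x) (W x)
  rw [hZ.parallel x hx] at h3
  rw [hW.parallel x hx] at h4
  have h6 : VectorField.mlieBracket 𝓘(ℝ, E) Z (torsionField D X Y) x
      = D (torsionField D X Y) x (Z x)
        - CovariantDerivative.torsion D x (Z x) (torsionField D X Y x) := by
    rw [h3]; simp
  simp only [zero_apply, map_zero, add_zero] at h4
  have h7 : torsionDeriv g D x Z X Y W = g.inner x (D (torsionField D X Y) x (Z x)) (W x) := h4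
  have h8 : g.inner x (torsionField D X Y x) (torsionField D Z W x)
      = g.inner x (CovariantDerivative.torsion D x (Z x) (W x)) (torsionField D X Y x) :=
    g.symm x _ _
  rw [h1, h6, map_neg, neg_apply, map_sub, sub_apply, h5,
    h7, h8]
  ring

lemma torsionForm_swap₁₂ (X Y Z : VF E M) (y : M) :
    torsionForm g D Y X Z y = - torsionForm g D X Y Z y := by
  rw [torsionForm, torsionForm, CovariantDerivative.torsion_antisymm, map_neg,
    neg_apply]

lemma torsionForm_swap₂₃ (hb : IsBismut g D) (X Y Z : VF E M) (y : M) :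
    torsionForm g D X Z Y y = - torsionForm g D X Y Z y :=
  hb.torsion_skew y (X y) (Z y) (Y y)

/-- The indices here and in `torsionDeriv_swap₂₃` number the three torsion arguments; in
`torsionDeriv_swap₁₄` the direction of differentiation counts as the first of four. -/
lemma torsionDeriv_swap₁₂ (x : M) (W X Y Z : VF E M) :
    torsionDeriv g D x W Y X Z = - torsionDeriv g D x W X Y Z := by
  have : torsionForm g D Y X Z = - torsionForm g D X Y Z :=
    funext fun y => torsionForm_swap₁₂ X Y Z y
  rw [torsionDeriv, this, mvfderiv_neg]
  rfl

lemma torsionDeriv_swap₂₃ (hb : IsBismut g D) (x : M) (W X Y Z : VF E M) :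
    torsionDeriv g D x W X Z Y = - torsionDeriv g D x W X Y Z := by
  have : torsionForm g D X Z Y = - torsionForm g D X Y Z :=
    funext fun y => torsionForm_swap₂₃ hb X Y Z y
  rw [torsionDeriv, this, mvfderiv_neg]
  rfl

/-- The Jacobi identity for `X, Y, Z` paired with `W`: a first Bianchi identity without curvature.
-/
lemma torsionDeriv_cyclic (hb : IsBismut g D) (hU : IsOpen U) (hX : X.ParallelOn D U)
    (hY : Y.ParallelOn D U) (hZ : Z.ParallelOn D U) (hW : W.ParallelOn D U) {x : M} (hx : x ∈ U) :
    torsionDeriv g D x Z X Y W + torsionDeriv g D x X Y Z W + torsionDeriv g D x Y Z X W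
      + g.inner x (torsionField D X Y x) (torsionField D Z W x)
      + g.inner x (torsionField D Y Z x) (torsionField D X W x)
      + g.inner x (torsionField D Z X x) (torsionField D Y W x) = 0 := by
  have hs : ∀ {X : VF E M}, X.ParallelOn D U → ContMDiffAt 𝓘(ℝ, E) 𝓘(ℝ, E).tangent
      (minSmoothness ℝ 2) (fun y => (⟨y, X y⟩ : TangentBundle 𝓘(ℝ, E) M)) x := fun h =>
    ContMDiffAt.of_le (h.smooth x hx)
      (by rw [minSmoothness_of_isRCLikeNormedField]; exact ENat.LEInfty.out)
  have hJ := VectorField.leibniz_identity_mlieBracket_apply (hs hZ) (hs hX) (hs hY)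
  rw [VectorField.mlieBracket_swap_apply (V := VectorField.mlieBracket 𝓘(ℝ, E) Z X)] at hJ
  have hJ2 := congrArg (fun v => g.inner x v (W x)) hJ
  simp only [map_add, map_neg, add_apply, neg_apply,
    inner_mlieBracket_mlieBracket hb hU hX hY hZ hW hx,
    inner_mlieBracket_mlieBracket hb hU hZ hX hY hW hx,
    inner_mlieBracket_mlieBracket hb hU hZ hY hX hW hx] at hJ2
  have e1 := torsionDeriv_swap₁₂ (g := g) (D := D) x X Y Z W
  have e2 : torsionField D Z Y x = - torsionField D Y Z x :=
    CovariantDerivative.torsion_antisymm D _ _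
  rw [e2, map_neg, neg_apply] at hJ2
  linarith

/-- The derivative of the torsion of a flat Bismut connection is skew-symmetric in all four
arguments. -/
lemma torsionDeriv_swap₁₄ (hb : IsBismut g D) (hU : IsOpen U) (hX : X.ParallelOn D U)
    (hY : Y.ParallelOn D U) (hZ : Z.ParallelOn D U) (hW : W.ParallelOn D U) {x : M} (hx : x ∈ U) :
    torsionDeriv g D x W X Y Z = - torsionDeriv g D x Z X Y W := by
  -- Add the cyclic identity to the one with `Z` and `W` exchanged. The quadratic part is skew in
  -- `Z, W` and cancels, as do the derivatives along `X` and `Y` by skewness of the torsion; only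
  -- the derivatives along `Z` and `W` survive.
  have h1 := torsionDeriv_cyclic hb hU hX hY hZ hW hx
  have h2 := torsionDeriv_cyclic hb hU hX hY hW hZ hx
  have a1 := torsionDeriv_swap₂₃ hb x X Y Z W
  have a2 := torsionDeriv_swap₁₂ (g := g) (D := D) x Y Z X W
  have a3 := torsionDeriv_swap₂₃ hb x Y X Z W
  have a4 := torsionDeriv_swap₁₂ (g := g) (D := D) x Y W X Z
  have e : ∀ X Y : VF E M, torsionField D X Y x = - torsionField D Y X x := fun X Y =>
    CovariantDerivative.torsion_antisymm D _ _
  have b1 : g.inner x (torsionField D X Y x) (torsionField D W Z x)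
      = - g.inner x (torsionField D X Y x) (torsionField D Z W x) := by
    rw [e W Z, map_neg]
  have b2 : g.inner x (torsionField D Y W x) (torsionField D X Z x)
      = - g.inner x (torsionField D Z X x) (torsionField D Y W x) := by
    rw [e X Z, map_neg, g.symm]
  have b3 : g.inner x (torsionField D W X x) (torsionField D Y Z x)
      = - g.inner x (torsionField D Y Z x) (torsionField D X W x) := by
    rw [e W X, map_neg, neg_apply, g.symm]
  linarith

/-- The torsion of a Bismut connection has no `(3,0)` part. -/
lemma torsionForm_integrable (hb : IsBismut g D) (hX : X.ParallelOn D U)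
    (hY : Y.ParallelOn D U) (Z : VF E M) {x : M} (hx : x ∈ U) :
    torsionForm g D X.J Y.J Z x - torsionForm g D X Y Z x + torsionForm g D X.J Y Z.J x
      + torsionForm g D X Y.J Z.J x = 0 := by
  have hJX := hX.J hb.toIsHermitianConnection
  have hJY := hY.J hb.toIsHermitianConnection
  have h := nijenhuis_eq_zero (hX.smooth x hx) (hY.smooth x hx)
  rw [mlieBracket_of_parallel hX hY hx, mlieBracket_of_parallel hJX hY hx,
    mlieBracket_of_parallel hX hJY hx, mlieBracket_of_parallel hJX hJY hx] at h
  have h2 := congrArg (fun v => g.inner x v (Z x)) h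
  simp only [map_sub, map_neg, sub_apply, neg_apply,
    g.inner_J_left, map_zero, zero_apply] at h2
  simp only [torsionForm]
  simp only [torsionField] at h2
  simp only [VF.J] at h2 ⊢
  linarith

/-- `J` preserves parallel fields, so `torsionForm_integrable` is an identity between smooth
functions on all of `U` and can be differentiated. -/
lemma torsionDeriv_integrable (hb : IsBismut g D) (hU : IsOpen U) (hX : X.ParallelOn D U)
    (hY : Y.ParallelOn D U) (hZ : Z.ParallelOn D U) (W : VF E M) {x : M} (hx : x ∈ U) :
    torsionDeriv g D x W X.J Y.J Z - torsionDeriv g D x W X Y Z + torsionDeriv g D x W X.J Y Z.J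
      + torsionDeriv g D x W X Y.J Z.J = 0 := by
  have hJX := hX.J hb.toIsHermitianConnection
  have hJY := hY.J hb.toIsHermitianConnection
  have hJZ := hZ.J hb.toIsHermitianConnection
  have d1 : MDifferentiableAt 𝓘(ℝ, E) 𝓘(ℝ) (torsionForm g D X Y Z) x :=
    (smoothAt_torsionForm hU hX hY hZ hx).mdifferentiableAt (by simp)
  have d2 : MDifferentiableAt 𝓘(ℝ, E) 𝓘(ℝ) (torsionForm g D X.J Y Z.J) x :=
    (smoothAt_torsionForm hU hJX hY hJZ hx).mdifferentiableAt (by simp)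
  have d3 : MDifferentiableAt 𝓘(ℝ, E) 𝓘(ℝ) (torsionForm g D X Y.J Z.J) x :=
    (smoothAt_torsionForm hU hX hJY hJZ hx).mdifferentiableAt (by simp)
  have h : torsionForm g D X.J Y.J Z =ᶠ[nhds x]
      torsionForm g D X Y Z - torsionForm g D X.J Y Z.J - torsionForm g D X Y.J Z.J := by
    filter_upwards [hU.mem_nhds hx] with y hy
    have := torsionForm_integrable hb hX hY Z hy
    simp only [Pi.sub_apply]
    linarith
  have h2 : mvfderiv 𝓘(ℝ, E) (torsionForm g D X.J Y.J Z) x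
      = mvfderiv 𝓘(ℝ, E) (torsionForm g D X Y Z) x
        - mvfderiv 𝓘(ℝ, E) (torsionForm g D X.J Y Z.J) x
        - mvfderiv 𝓘(ℝ, E) (torsionForm g D X Y.J Z.J) x := by
    rw [← mvfderiv_sub d1 d2, ← mvfderiv_sub (d1.sub d2) d3]
    exact congrArg _ h.mfderiv_eq
  simp only [torsionDeriv, h2, sub_apply]
  ring

end Torsion

/-- The real and imaginary part maps on `ℂ ⊗ V` separate the two terms. -/
lemma tmul_add_I_tmul_eq_zero {V : Type*} [AddCommGroup V] [Module ℝ V] {p q : V}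
    (h : (1 : ℂ) ⊗ₜ[ℝ] p + Complex.I ⊗ₜ[ℝ] q = 0) : p = 0 ∧ q = 0 := by
  have h1 := congrArg (TensorProduct.lift ((LinearMap.lsmul ℝ V).comp Complex.reLm)) h
  have h2 := congrArg (TensorProduct.lift ((LinearMap.lsmul ℝ V).comp Complex.imLm)) h
  simp at h1 h2
  exact ⟨h1, h2⟩

/-! ### Holomorphy of the conjugate torsion components -/

section TorsionComponents

variable {E : Type*} [NormedAddCommGroup E] [NormedSpace ℂ E]
  {M : Type*} [TopologicalSpace M] [ChartedSpace E M] [IsManifold 𝓘(ℂ, E) ω M]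

lemma connection_eq_zero_of_covC {D : Connection E M} {v : VF E M} {x : M} (h : covC D v x = 0) :
    D v x = 0 := by
  ext1 w
  have h1 := DFunLike.congr_fun h ((1 : ℂ) ⊗ₜ[ℝ] w)
  simp only [covC, LinearMap.sub_apply, LinearMap.smul_apply, LinearMap.baseChange_tmul,
    ContinuousLinearMap.coe_coe, TensorProduct.smul_tmul', LinearMap.zero_apply, smul_eq_mul,
    mul_one] at h1
  rw [sub_eq_add_neg, ← TensorProduct.tmul_neg] at h1
  exact (tmul_add_I_tmul_eq_zero h1).1

lemma covC_eq_zero {g : HermitianMetric E M} {D : Connection E M} (hD : IsHermitianConnection g D)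
    {v : VF E M} {x : M} (hv : v.DifferentiableAt x) (h : D v x = 0) : covC D v x = 0 := by
  have h2 : D (fun y => J y (v y)) x = 0 := by
    ext1 w
    rw [hD.complex x v hv w, h]
    simp
  rw [covC, h, h2]
  ext w
  simp

variable [FiniteDimensional ℂ E] [CompleteSpace E]

lemma torsionC_tmul (D : Connection E M) {x : M} (a b : ℂ) (v w : TM E x) :
    torsionC D x (a ⊗ₜ[ℝ] v) (b ⊗ₜ[ℝ] w) = (a * b) ⊗ₜ[ℝ] CovariantDerivative.torsion D x v w :=
  LinearMap.BilinMap.baseChange_tmul ..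

lemma torsionC_type10_type01 (D : Connection E M) {x : M} (v w : TM E x) :
    torsionC D x (type10 v) (type01 w)
      = (1 : ℂ) ⊗ₜ[ℝ] (CovariantDerivative.torsion D x v w
          + CovariantDerivative.torsion D x (J x v) (J x w))
        + Complex.I ⊗ₜ[ℝ] (CovariantDerivative.torsion D x v (J x w)
          - CovariantDerivative.torsion D x (J x v) w) := by
  have hI : ∀ u : TM E x, (-1 : ℂ) ⊗ₜ[ℝ] u = - ((1 : ℂ) ⊗ₜ[ℝ] u) := fun u =>
    TensorProduct.neg_tmul _ _
  simp only [type10, type01, map_sub, map_add, LinearMap.sub_apply,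
    torsionC_tmul, mul_one, one_mul, Complex.I_mul_I, hI,
    TensorProduct.tmul_add, TensorProduct.tmul_sub]
  abel

lemma torsionC_type10_type10 (D : Connection E M) {x : M} (v w : TM E x) :
    torsionC D x (type10 v) (type10 w)
      = (1 : ℂ) ⊗ₜ[ℝ] (CovariantDerivative.torsion D x v w
          - CovariantDerivative.torsion D x (J x v) (J x w))
        - Complex.I ⊗ₜ[ℝ] (CovariantDerivative.torsion D x (J x v) w
          + CovariantDerivative.torsion D x v (J x w)) := by
  have hI : ∀ u : TM E x, (-1 : ℂ) ⊗ₜ[ℝ] u = - ((1 : ℂ) ⊗ₜ[ℝ] u) := fun u =>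
    TensorProduct.neg_tmul _ _
  simp only [type10, map_sub, LinearMap.sub_apply,
    torsionC_tmul, mul_one, one_mul, Complex.I_mul_I, hI,
    TensorProduct.tmul_add, TensorProduct.tmul_sub]
  abel

lemma IsChern.torsion_one_one {g : HermitianMetric E M} {D : Connection E M} (hc : IsChern g D)
    {x : M} (v w : TM E x) :
    CovariantDerivative.torsion D x v w
        + CovariantDerivative.torsion D x (J x v) (J x w) = 0 ∧
      CovariantDerivative.torsion D x v (J x w)
        - CovariantDerivative.torsion D x (J x v) w = 0 :=
  tmul_add_I_tmul_eq_zero ((torsionC_type10_type01 D v w).symm.trans (hc.torsion_type x v w))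

/-- The real part of `⟨T(X - √-1 J X, Y - √-1 J Y), Z + √-1 J Z⟩`. -/
def torsionRe (g : HermitianMetric E M) (D : Connection E M) (X Y Z : VF E M) : M → ℝ :=
  torsionForm g D X Y Z - torsionForm g D X.J Y.J Z + torsionForm g D X.J Y Z.J
    + torsionForm g D X Y.J Z.J

/-- The imaginary part of `⟨T(X - √-1 J X, Y - √-1 J Y), Z + √-1 J Z⟩`. -/
def torsionIm (g : HermitianMetric E M) (D : Connection E M) (X Y Z : VF E M) : M → ℝ :=
  torsionForm g D X Y Z.J - torsionForm g D X.J Y.J Z.J - torsionForm g D X.J Y Z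
    - torsionForm g D X Y.J Z

lemma gC_torsionC (g : HermitianMetric E M) (D : Connection E M) (X Y Z : VF E M) (x : M) :
    g.gC x (torsionC D x (type10 (X x)) (type10 (Y x))) (type01 (Z x))
      = (torsionRe g D X Y Z x : ℂ) + Complex.I * (torsionIm g D X Y Z x : ℂ) := by
  rw [torsionC_type10_type10]
  simp only [HermitianMetric.gC, type01, map_sub, map_add, LinearMap.sub_apply,
    LinearMap.BilinForm.baseChange_tmul, ContinuousLinearMap.toBilinForm_apply,
    LinearMap.add_apply, torsionRe, torsionIm, torsionForm,
    Pi.add_apply, Pi.sub_apply, VF.J]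
  simp only [Complex.real_smul, Complex.ofReal_sub, Complex.ofReal_add]
  linear_combination (- (g.inner x (CovariantDerivative.torsion D x (J x (X x)) (Y x))
    (J x (Z x)) : ℂ) - (g.inner x (CovariantDerivative.torsion D x (X x) (J x (Y x)))
    (J x (Z x)) : ℂ)) * Complex.I_mul_I

variable {g : HermitianMetric E M} {Db Dc : Connection E M} {U : Set M} {X Y Z W : VF E M}

lemma torsionForm_neg₃ (g : HermitianMetric E M) (D : Connection E M) (X Y Z : VF E M) :
    torsionForm g D X Y (-Z) = - torsionForm g D X Y Z := by
  funext y
  simp [torsionForm]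

lemma torsionDeriv_neg₄ (g : HermitianMetric E M) (D : Connection E M) (x : M) (W X Y Z : VF E M) :
    torsionDeriv g D x W X Y (-Z) = - torsionDeriv g D x W X Y Z := by
  rw [torsionDeriv, torsionForm_neg₃, mvfderiv_neg]
  rfl

lemma smoothAt_torsionRe (hb : IsBismut g Db) (hU : IsOpen U) (hX : X.ParallelOn Db U)
    (hY : Y.ParallelOn Db U) (hZ : Z.ParallelOn Db U) {x : M} (hx : x ∈ U) :
    ContMDiffAt 𝓘(ℝ, E) 𝓘(ℝ) ∞ (torsionRe g Db X Y Z) x := by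
  have hJX := hX.J hb.toIsHermitianConnection
  have hJY := hY.J hb.toIsHermitianConnection
  have hJZ := hZ.J hb.toIsHermitianConnection
  exact (((smoothAt_torsionForm hU hX hY hZ hx).sub (smoothAt_torsionForm hU hJX hJY hZ hx)).add
    (smoothAt_torsionForm hU hJX hY hJZ hx)).add (smoothAt_torsionForm hU hX hJY hJZ hx)

lemma smoothAt_torsionIm (hb : IsBismut g Db) (hU : IsOpen U) (hX : X.ParallelOn Db U)
    (hY : Y.ParallelOn Db U) (hZ : Z.ParallelOn Db U) {x : M} (hx : x ∈ U) :
    ContMDiffAt 𝓘(ℝ, E) 𝓘(ℝ) ∞ (torsionIm g Db X Y Z) x := by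
  have hJX := hX.J hb.toIsHermitianConnection
  have hJY := hY.J hb.toIsHermitianConnection
  have hJZ := hZ.J hb.toIsHermitianConnection
  exact (((smoothAt_torsionForm hU hX hY hJZ hx).sub (smoothAt_torsionForm hU hJX hJY hJZ hx)).sub
    (smoothAt_torsionForm hU hJX hY hZ hx)).sub (smoothAt_torsionForm hU hX hJY hZ hx)

lemma mvfderiv_torsionRe (hb : IsBismut g Db) (hU : IsOpen U) (hX : X.ParallelOn Db U)
    (hY : Y.ParallelOn Db U) (hZ : Z.ParallelOn Db U) (W : VF E M) {x : M} (hx : x ∈ U) :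
    mvfderiv 𝓘(ℝ, E) (torsionRe g Db X Y Z) x (W x)
      = torsionDeriv g Db x W X Y Z - torsionDeriv g Db x W X.J Y.J Z
        + torsionDeriv g Db x W X.J Y Z.J + torsionDeriv g Db x W X Y.J Z.J := by
  have hJX := hX.J hb.toIsHermitianConnection
  have hJY := hY.J hb.toIsHermitianConnection
  have hJZ := hZ.J hb.toIsHermitianConnection
  have d1 := (smoothAt_torsionForm (g := g) hU hX hY hZ hx).mdifferentiableAt (by simp)
  have d2 := (smoothAt_torsionForm (g := g) hU hJX hJY hZ hx).mdifferentiableAt (by simp)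
  have d3 := (smoothAt_torsionForm (g := g) hU hJX hY hJZ hx).mdifferentiableAt (by simp)
  have d4 := (smoothAt_torsionForm (g := g) hU hX hJY hJZ hx).mdifferentiableAt (by simp)
  rw [torsionRe, mvfderiv_add ((d1.sub d2).add d3) d4, mvfderiv_add (d1.sub d2) d3,
    mvfderiv_sub d1 d2]
  rfl

lemma mvfderiv_torsionIm (hb : IsBismut g Db) (hU : IsOpen U) (hX : X.ParallelOn Db U)
    (hY : Y.ParallelOn Db U) (hZ : Z.ParallelOn Db U) (W : VF E M) {x : M} (hx : x ∈ U) :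
    mvfderiv 𝓘(ℝ, E) (torsionIm g Db X Y Z) x (W x)
      = torsionDeriv g Db x W X Y Z.J - torsionDeriv g Db x W X.J Y.J Z.J
        - torsionDeriv g Db x W X.J Y Z - torsionDeriv g Db x W X Y.J Z := by
  have hJX := hX.J hb.toIsHermitianConnection
  have hJY := hY.J hb.toIsHermitianConnection
  have hJZ := hZ.J hb.toIsHermitianConnection
  have d1 := (smoothAt_torsionForm (g := g) hU hX hY hJZ hx).mdifferentiableAt (by simp)
  have d2 := (smoothAt_torsionForm (g := g) hU hJX hJY hJZ hx).mdifferentiableAt (by simp)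
  have d3 := (smoothAt_torsionForm (g := g) hU hJX hY hZ hx).mdifferentiableAt (by simp)
  have d4 := (smoothAt_torsionForm (g := g) hU hX hJY hZ hx).mdifferentiableAt (by simp)
  rw [torsionIm, mvfderiv_sub ((d1.sub d2).sub d3) d4, mvfderiv_sub (d1.sub d2) d3,
    mvfderiv_sub d1 d2]
  rfl

/-- First Cauchy–Riemann equation for the conjugate component. `torsionDeriv_swap₁₄` moves the
direction `W` or `J W` into the last torsion slot; the difference of the two sides is then a sum of
derivatives, along `Z` and `J Z`, of the vanishing `(3,0)` part. -/
lemma mvfderiv_torsionRe_J (hb : IsBismut g Db) (hU : IsOpen U) (hX : X.ParallelOn Db U)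
    (hY : Y.ParallelOn Db U) (hZ : Z.ParallelOn Db U) (hW : W.ParallelOn Db U) {x : M}
    (hx : x ∈ U) :
    mvfderiv 𝓘(ℝ, E) (torsionRe g Db X Y Z) x (J x (W x))
      = mvfderiv 𝓘(ℝ, E) (torsionIm g Db X Y Z) x (W x) := by
  have hJX := hX.J hb.toIsHermitianConnection
  have hJY := hY.J hb.toIsHermitianConnection
  have hJZ := hZ.J hb.toIsHermitianConnection
  have hJW := hW.J hb.toIsHermitianConnection
  have e : J x (W x) = W.J x := rfl
  rw [e, mvfderiv_torsionRe hb hU hX hY hZ W.J hx, mvfderiv_torsionIm hb hU hX hY hZ W hx]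
  have n1 := torsionDeriv_integrable hb hU hX hY hJW Z hx
  have n2 := torsionDeriv_integrable hb hU hX hY hW Z.J hx
  rw [VF.J_J, torsionDeriv_neg₄, torsionDeriv_neg₄] at n1
  rw [torsionDeriv_swap₁₄ hb hU hX hY hZ hJW hx, torsionDeriv_swap₁₄ hb hU hJX hJY hZ hJW hx,
    torsionDeriv_swap₁₄ hb hU hJX hY hJZ hJW hx, torsionDeriv_swap₁₄ hb hU hX hJY hJZ hJW hx,
    torsionDeriv_swap₁₄ hb hU hX hY hJZ hW hx, torsionDeriv_swap₁₄ hb hU hJX hJY hJZ hW hx,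
    torsionDeriv_swap₁₄ hb hU hJX hY hZ hW hx, torsionDeriv_swap₁₄ hb hU hX hJY hZ hW hx]
  linarith

/-- The second Cauchy–Riemann equation is the first one at `J W`. -/
lemma mvfderiv_torsionIm_J (hb : IsBismut g Db) (hU : IsOpen U) (hX : X.ParallelOn Db U)
    (hY : Y.ParallelOn Db U) (hZ : Z.ParallelOn Db U) (hW : W.ParallelOn Db U) {x : M}
    (hx : x ∈ U) :
    mvfderiv 𝓘(ℝ, E) (torsionIm g Db X Y Z) x (J x (W x))
      = - mvfderiv 𝓘(ℝ, E) (torsionRe g Db X Y Z) x (W x) := by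
  have h := mvfderiv_torsionRe_J hb hU hX hY hZ (hW.J hb.toIsHermitianConnection) hx
  have e : J x (W.J x) = - W x := J_J x (W x)
  rw [e, map_neg] at h
  exact h.symm

/-- The conjugate of the component of the Chern torsion, in terms of the Bismut torsion. -/
def torsionHol (g : HermitianMetric E M) (D : Connection E M) (X Y Z : VF E M) (y : M) : ℂ :=
  torsionRe g D X Y Z y • (-(1 / 2) : ℂ) + torsionIm g D X Y Z y • (Complex.I / 2)

lemma smoothAt_torsionHol (hb : IsBismut g Db) (hU : IsOpen U) (hX : X.ParallelOn Db U)
    (hY : Y.ParallelOn Db U) (hZ : Z.ParallelOn Db U) {x : M} (hx : x ∈ U) :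
    ContMDiffAt 𝓘(ℝ, E) 𝓘(ℝ, ℂ) ∞ (torsionHol g Db X Y Z) x :=
  ((smoothAt_torsionRe hb hU hX hY hZ hx).smul contMDiffAt_const).add
    ((smoothAt_torsionIm hb hU hX hY hZ hx).smul contMDiffAt_const)

/-- The conjugates of the torsion components in a parallel frame are holomorphic. -/
lemma mdifferentiableAt_torsionHol [T2Space M] (hb : IsBismut g Db) (hflat : IsFlat Db)
    (hU : IsOpen U) (hX : X.ParallelOn Db U)
    (hY : Y.ParallelOn Db U) (hZ : Z.ParallelOn Db U) {x : M} (hx : x ∈ U) :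
    MDifferentiableAt 𝓘(ℂ, E) 𝓘(ℂ) (torsionHol g Db X Y Z) x := by
  refine mdifferentiableAt_complex_of_real
    ((smoothAt_torsionHol hb hU hX hY hZ hx).mdifferentiableAt (by simp)) fun v => ?_
  -- The Cauchy–Riemann equations were proved for parallel directions; flatness extends any tangent
  -- vector to such a field.
  obtain ⟨V, hV, hxV, W, hW, rfl, hW0⟩ := exists_parallel_field hb.smooth hflat x v
  have hUV := hU.inter hV
  have hX' := hX.mono (Set.inter_subset_left (t := V))
  have hY' := hY.mono (Set.inter_subset_left (t := V))
  have hZ' := hZ.mono (Set.inter_subset_left (t := V))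
  have hW' : W.ParallelOn Db (U ∩ V) :=
    ⟨fun y hy => hW.smoothAt hV hy.2, fun y hy => hW0 y hy.2⟩
  have d1 := (smoothAt_torsionRe hb hU hX hY hZ hx).mdifferentiableAt (by simp)
  have d2 := (smoothAt_torsionIm hb hU hX hY hZ hx).mdifferentiableAt (by simp)
  have key : ∀ u : TM E x, mvfderiv 𝓘(ℝ, E) (torsionHol g Db X Y Z) x u
      = mvfderiv 𝓘(ℝ, E) (torsionRe g Db X Y Z) x u • (-(1 / 2) : ℂ)
        + mvfderiv 𝓘(ℝ, E) (torsionIm g Db X Y Z) x u • (Complex.I / 2) := fun u => by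
    have e : torsionHol g Db X Y Z = (torsionRe g Db X Y Z • fun _ => (-(1 / 2) : ℂ))
      + torsionIm g Db X Y Z • fun _ => (Complex.I / 2) := rfl
    have c1 : MDifferentiableAt 𝓘(ℝ, E) 𝓘(ℝ, ℂ) (fun _ : M => (-(1 / 2) : ℂ)) x :=
      mdifferentiableAt_const
    have c2 : MDifferentiableAt 𝓘(ℝ, E) 𝓘(ℝ, ℂ) (fun _ : M => Complex.I / 2) x :=
      mdifferentiableAt_const
    rw [e, mvfderiv_add (d1.smul c1) (d2.smul c2), mvfderiv_smul d1 c1, mvfderiv_smul d2 c2,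
      mvfderiv_const, mvfderiv_const]
    simp
  rw [key, key, mvfderiv_torsionRe_J hb hUV hX' hY' hZ' hW' ⟨hx, hxV⟩,
    mvfderiv_torsionIm_J hb hUV hX' hY' hZ' hW' ⟨hx, hxV⟩]
  simp only [Complex.real_smul, smul_eq_mul, Complex.ofReal_neg]
  linear_combination (-(mvfderiv 𝓘(ℝ, E) (torsionIm g Db X Y Z) x (W x) : ℂ) / 2) * Complex.I_mul_I

end TorsionComponents

/-! ### Chern torsion in terms of Bismut torsion -/

section ChernBismut

variable {E : Type*} [NormedAddCommGroup E] [NormedSpace ℂ E]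
  {M : Type*} [TopologicalSpace M] [ChartedSpace E M] [IsManifold 𝓘(ℂ, E) ω M]

lemma mvfderiv_inner_eq_zero {g : HermitianMetric E M} {D : Connection E M}
    (hD : IsHermitianConnection g D) {U : Set M} {X Y : VF E M} (hX : X.ParallelOn D U)
    (hY : Y.ParallelOn D U) {x : M} (hx : x ∈ U) :
    mvfderiv 𝓘(ℝ, E) (fun y => g.inner y (X y) (Y y)) x = 0 := by
  ext1 w
  rw [hD.metric x X Y (hX.smooth x hx).differentiableAt (hY.smooth x hx).differentiableAt w,
    hX.parallel x hx, hY.parallel x hx]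
  simp

variable [FiniteDimensional ℂ E] [CompleteSpace E]

variable {g : HermitianMetric E M} {Db Dc : Connection E M} {U : Set M} {X Y Z W : VF E M}

lemma torsionForm_eq_of_parallel (D : Connection E M) (hX : X.ParallelOn Db U)
    (hY : Y.ParallelOn Db U) (Z : VF E M) {x : M} (hx : x ∈ U) :
    torsionForm g D X Y Z x = torsionForm g Db X Y Z x + g.inner x (D Y x (X x)) (Z x)
      - g.inner x (D X x (Y x)) (Z x) := by
  have h := CovariantDerivative.torsion_apply D (hX.smooth x hx).differentiableAt
    (hY.smooth x hx).differentiableAt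
  rw [mlieBracket_of_parallel hX hY hx] at h
  simp only [torsionForm, h, map_sub, map_neg, sub_apply,
    neg_apply, torsionField]
  ring

/-- Reduces the comparison of the two torsions to their real parts. -/
lemma torsionIm_eq_torsionRe (g : HermitianMetric E M) (D : Connection E M) (X Y Z : VF E M) :
    torsionIm g D X Y Z = torsionRe g D X Y Z.J := by
  rw [torsionIm, torsionRe, VF.J_J, torsionForm_neg₃, torsionForm_neg₃]
  abel

/-- On parallel fields `A(X, Y, Z) = ⟨∇^c_X Y, Z⟩` is the difference of the connections: skew in `Y,
Z`, compatible with `J`, and `T^c(X, Y) = T^b(X, Y) + A(X, Y) - A(Y, X)`. For `X, Y` of type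
`(1,0)`, the vanishing of `⟨T^c(X, Z̄), Y⟩` forces `A(X, Y, Z̄) = -T^b(X, Y, Z̄)`, since `A(Z̄, X,
Y) = 0` by type. The same holds with `X, Y` exchanged, so `T^c = T^b - 2 T^b`. -/
lemma torsionRe_chern (hb : IsBismut g Db) (hc : IsChern g Dc) (hX : X.ParallelOn Db U)
    (hY : Y.ParallelOn Db U) (hZ : Z.ParallelOn Db U) {x : M} (hx : x ∈ U) :
    torsionRe g Dc X Y Z x = - torsionRe g Db X Y Z x := by
  have hJX := hX.J hb.toIsHermitianConnection
  have hJY := hY.J hb.toIsHermitianConnection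
  have hJZ := hZ.J hb.toIsHermitianConnection
  obtain ⟨A, hA⟩ : ∃ A : VF E M → VF E M → VF E M → ℝ,
    ∀ X Y Z, A X Y Z = g.inner x (Dc Y x (X x)) (Z x) := ⟨_, fun _ _ _ => rfl⟩
  have skew : ∀ {X Y Z : VF E M}, Y.ParallelOn Db U → Z.ParallelOn Db U →
      A X Z Y = - A X Y Z := fun {X Y Z} hY hZ => by
    have h := hc.metric x Y Z (hY.smooth x hx).differentiableAt
      (hZ.smooth x hx).differentiableAt (X x)
    rw [mvfderiv_inner_eq_zero hb.toIsHermitianConnection hY hZ hx] at h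
    rw [hA, hA, g.symm x (Dc Z x (X x))]
    simp only [zero_apply] at h
    linarith
  have cplx : ∀ {X Y Z : VF E M}, Y.ParallelOn Db U → A X Y.J Z = - A X Y Z.J :=
    fun {X Y Z} hY => by
      have h := hc.complex x Y (hY.smooth x hx).differentiableAt (X x)
      have h' : Dc Y.J x (X x) = J x (Dc Y x (X x)) := h
      rw [hA, hA, h', g.inner_J_left]
      rfl
  have tc : ∀ {X Y Z : VF E M}, X.ParallelOn Db U → Y.ParallelOn Db U →
      torsionForm g Dc X Y Z x = torsionForm g Db X Y Z x + A X Y Z - A Y X Z :=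
    fun {X Y Z} hX hY => by
      rw [hA, hA, torsionForm_eq_of_parallel Dc hX hY Z hx]
  have one_one : ∀ X Y Z : VF E M,
      torsionForm g Dc X Y Z x + torsionForm g Dc X.J Y.J Z x = 0 := fun X Y Z => by
    have h := congrArg (fun v => g.inner x v (Z x)) (hc.torsion_one_one (X x) (Y x)).1
    simpa [torsionForm, VF.J] using h
  have one_one' : ∀ X Y Z : VF E M,
      torsionForm g Dc X Y.J Z x - torsionForm g Dc X.J Y Z x = 0 := fun X Y Z => by
    have h := congrArg (fun v => g.inner x v (Z x)) (hc.torsion_one_one (X x) (Y x)).2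
    simpa [torsionForm, VF.J] using h
  have cplx₂ : ∀ {X Y Z : VF E M}, Y.ParallelOn Db U → A X Y.J Z.J = A X Y Z := fun {X Y Z} hY => by
    rw [cplx hY, VF.J_J, hA, hA]
    simp
  -- Real form of `⟨T^c(X, Z̄), Y⟩ = 0` and `⟨T^c(Y, Z̄), X⟩ = 0` for the `(1,0)` vectors built from
  -- `X, Y, Z`; the rest is linear algebra in the values of `A` and `T^b`.
  have r1 := one_one X Z Y
  have r1' := one_one' X Z Y.J
  have r2 := one_one Y Z X
  have r2' := one_one' Y Z X.J
  rw [tc hX hZ, tc hJX hJZ] at r1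
  rw [tc hX hJZ, tc hJX hZ] at r1'
  rw [tc hY hZ, tc hJY hJZ] at r2
  rw [tc hY hJZ, tc hJY hZ] at r2'
  simp only [torsionRe, Pi.add_apply, Pi.sub_apply]
  rw [tc hX hY, tc hJX hJY, tc hJX hY, tc hX hJY]
  have s₁₂ := fun X Y Z => torsionForm_swap₁₂ (g := g) (D := Db) X Y Z x
  have s₂₃ := fun X Y Z => torsionForm_swap₂₃ hb X Y Z x
  linarith [skew hY hZ (X := X), skew hJY hZ (X := X.J), skew hX hZ (X := Y),
    skew hJX hZ (X := Y.J), cplx₂ hX (X := Z) (Z := Y), cplx hX (X := Z.J) (Z := Y),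
    cplx₂ hY (X := Z) (Z := X), cplx hY (X := Z.J) (Z := X), cplx₂ hZ (X := X) (Z := Y),
    cplx hZ (X := X.J) (Z := Y), cplx₂ hZ (X := Y) (Z := X), cplx hZ (X := Y.J) (Z := X),
    cplx₂ hY (X := X) (Z := Z), cplx hY (X := X.J) (Z := Z), cplx₂ hX (X := Y) (Z := Z),
    cplx hX (X := Y.J) (Z := Z), s₂₃ X Y Z, s₂₃ X.J Y Z.J, s₂₃ X Y.J Z.J, s₂₃ X.J Y.J Z,
    s₂₃ Y X Z, s₂₃ Y.J X Z.J, s₂₃ Y X.J Z.J, s₂₃ Y.J X.J Z, s₁₂ X Y Z, s₁₂ X.J Y Z.J,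
    s₁₂ X Y.J Z.J, s₁₂ X.J Y.J Z]

end ChernBismut

/-! ### Independence of `|T|²` from the unitary basis -/

section UnitaryBases

variable {E : Type*} [NormedAddCommGroup E] [NormedSpace ℂ E]
  {M : Type*} [TopologicalSpace M] [ChartedSpace E M]

/-- Because `J v - √-1 J J v = √-1 (v - √-1 J v)`; for `type01` the same computation gives the
conjugate scalar. -/
lemma type10_smul {x : M} (c : ℂ) (u : E) :
    type10 (x := x) (c • u : E) = c • type10 (x := x) (u : E) := by
  have h1 : c • u = c.re • u + c.im • (Complex.I • u) := by
    conv_lhs => rw [← Complex.re_add_im c]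
    rw [add_smul, mul_smul, Complex.coe_smul, Complex.coe_smul]
  have key : ∀ (a b : ℝ) (u : TM E x), type10 (a • u + b • J x u) = (a + b * Complex.I : ℂ) • type10 u := by
    intro a b u
    have e1 : ∀ z : ℂ, z ⊗ₜ[ℝ] u = z • ((1 : ℂ) ⊗ₜ[ℝ] u) := fun z => by
      rw [TensorProduct.smul_tmul', smul_eq_mul, mul_one]
    have e2 : ∀ z : ℂ, z ⊗ₜ[ℝ] J x u = z • ((1 : ℂ) ⊗ₜ[ℝ] J x u) := fun z => by
      rw [TensorProduct.smul_tmul', smul_eq_mul, mul_one]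
    have e3 : ∀ (a : ℝ) (y : CTM E x), a • y = (a : ℂ) • y := fun a y =>
      (algebraMap_smul ℂ a y).symm
    simp only [type10, map_add, map_smul, J_J, TensorProduct.tmul_add, TensorProduct.tmul_smul,
      TensorProduct.tmul_neg, e1 Complex.I, e2 Complex.I, smul_neg, e3]
    have hI : ((b : ℂ) * Complex.I) * Complex.I = -b := by
      rw [mul_assoc, Complex.I_mul_I]; ring
    simp only [smul_sub, add_smul, smul_smul, add_mul, hI, neg_smul]
    abel
  have h2 := key c.re c.im u
  rw [Complex.re_add_im] at h2
  rw [h1]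
  exact h2

lemma type01_smul {x : M} (c : ℂ) (u : E) :
    type01 (x := x) (c • u : E) = conj c • type01 (x := x) (u : E) := by
  have h1 : c • u = c.re • u + c.im • (Complex.I • u) := by
    conv_lhs => rw [← Complex.re_add_im c]
    rw [add_smul, mul_smul, Complex.coe_smul, Complex.coe_smul]
  have key : ∀ (a b : ℝ) (u : TM E x), type01 (a • u + b • J x u) = (a - b * Complex.I : ℂ) • type01 u := by
    intro a b u
    have e1 : ∀ z : ℂ, z ⊗ₜ[ℝ] u = z • ((1 : ℂ) ⊗ₜ[ℝ] u) := fun z => by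
      rw [TensorProduct.smul_tmul', smul_eq_mul, mul_one]
    have e2 : ∀ z : ℂ, z ⊗ₜ[ℝ] J x u = z • ((1 : ℂ) ⊗ₜ[ℝ] J x u) := fun z => by
      rw [TensorProduct.smul_tmul', smul_eq_mul, mul_one]
    have e3 : ∀ (a : ℝ) (y : CTM E x), a • y = (a : ℂ) • y := fun a y =>
      (algebraMap_smul ℂ a y).symm
    simp only [type01, map_add, map_smul, J_J, TensorProduct.tmul_add, TensorProduct.tmul_smul,
      TensorProduct.tmul_neg, e1 Complex.I, e2 Complex.I, smul_neg, e3]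
    have hI : ((b : ℂ) * Complex.I) * Complex.I = -b := by
      rw [mul_assoc, Complex.I_mul_I]; ring
    simp only [sub_smul, smul_add, smul_smul, sub_mul, hI, neg_smul]
    abel
  have h2 := key c.re c.im u
  have h3 : (c.re - c.im * Complex.I : ℂ) = conj c := by
    apply Complex.ext <;> simp
  rw [h3] at h2
  rw [h1]
  exact h2

lemma type10_add {x : M} (u v : TM E x) : type10 (u + v) = type10 u + type10 v := by
  simp only [type10, map_add, TensorProduct.tmul_add]
  abel

lemma type01_add {x : M} (u v : TM E x) : type01 (u + v) = type01 u + type01 v := by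
  simp only [type01, map_add, TensorProduct.tmul_add]
  abel

/-- The complex linear isomorphism of `T_x M` with `T^{1,0}_x M`, as a map to the complexified
tangent space. -/
def type10Map (x : M) : E →ₗ[ℂ] CTM E x where
  toFun u := type10 (x := x) (u : E)
  map_add' := type10_add (x := x)
  map_smul' := type10_smul

lemma conj_gC [IsManifold 𝓘(ℂ, E) ω M] (g : HermitianMetric E M) {x : M} (v w : TM E x) :
    conj (g.gC x (type10 v) (type01 w)) = g.gC x (type10 w) (type01 v) := by
  have h := g.inner_J_left x v w
  have h2 := g.symm x (J x v) w
  rw [g.gC_type10_type01, g.gC_type10_type01, g.symm x w v, ← h2, h]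
  apply Complex.ext <;> simp

variable [IsManifold 𝓘(ℂ, E) ω M] [FiniteDimensional ℂ E]

/-- Expansion of a tangent vector in a unitary basis. -/
lemma eq_sum_coframe {g : HermitianMetric E M} {x : M} {v : Fin (Module.finrank ℂ E) → E}
    (hv : IsUnitaryAt g x v) (u : E) :
    u = ∑ a, coframe g x v a (type10 (x := x) u) • v a := by
  let P : Fin (Module.finrank ℂ E) → E →ₗ[ℂ] ℂ := fun a => coframe g x v a ∘ₗ type10Map x
  have hP : ∀ a b, P a (v b) = if b = a then 1 else 0 := fun a b => hv b a
  have hPs : ∀ (c : Fin (Module.finrank ℂ E) → ℂ) a, P a (∑ b, c b • v b) = c a := fun c a => by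
    rw [map_sum]
    simp only [map_smul, hP, smul_eq_mul, mul_ite, mul_one, mul_zero, Finset.sum_ite_eq',
      Finset.mem_univ, if_true]
  have hli : LinearIndependent ℂ v := by
    rw [Fintype.linearIndependent_iff]
    intro c hc a
    rw [← hPs c a, hc, map_zero]
  have hspan : u ∈ Submodule.span ℂ (Set.range v) := by
    rw [hli.span_eq_top_of_card_eq_finrank' (by simp)]
    trivial
  obtain ⟨c, hc⟩ := (Submodule.mem_span_range_iff_exists_fun ℂ).1 hspan
  have h : ∀ a, coframe g x v a (type10 (x := x) u) = c a := fun a => by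
    rw [← hPs c a, hc]
    rfl
  simp only [h]
  exact hc.symm

lemma sum_norm_sq_mulVec {n : Type*} [Fintype n] [DecidableEq n] {C : Matrix n n ℂ}
    (hC : C.conjTranspose * C = 1) (z : n → ℂ) : ∑ i, ‖(C.mulVec z) i‖ ^ 2 = ∑ i, ‖z i‖ ^ 2 := by
  have h : ∀ z : n → ℂ, ((∑ i, ‖z i‖ ^ 2 : ℝ) : ℂ) = star z ⬝ᵥ z := fun z => by
    push_cast
    refine Finset.sum_congr rfl fun i _ => ?_
    rw [← Complex.conj_mul']
    rfl
  have h2 : ((∑ i, ‖(C.mulVec z) i‖ ^ 2 : ℝ) : ℂ) = ((∑ i, ‖z i‖ ^ 2 : ℝ) : ℂ) := by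
    rw [h, h, Matrix.star_mulVec, Matrix.dotProduct_mulVec, Matrix.vecMul_vecMul, hC,
      Matrix.vecMul_one]
  exact_mod_cast h2

/-- The norm of a linear functional can be computed in every unitary basis. -/
lemma sum_norm_sq_eq {g : HermitianMetric E M} {x : M} {v w : Fin (Module.finrank ℂ E) → TM E x}
    (hv : IsUnitaryAt g x v) (hw : IsUnitaryAt g x w) (l : E →ₗ[ℂ] ℂ) :
    ∑ i, ‖l (w i)‖ ^ 2 = ∑ i, ‖l (v i)‖ ^ 2 := by
  let C : Matrix (Fin (Module.finrank ℂ E)) (Fin (Module.finrank ℂ E)) ℂ :=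
    fun i a => coframe g x v a (type10 (w i))
  have hexp : ∀ l : E →ₗ[ℂ] ℂ, ∀ i, l (w i) = C.mulVec (fun a => l (v a)) i := fun l i =>
    (congrArg l (eq_sum_coframe (v := v) hv (w i))).trans
      ((map_sum l _ _).trans (Finset.sum_congr rfl fun a _ => l.map_smul _ _))
  -- Expanding the coframe of `w` in the basis `v` shows that the change of basis is unitary.
  have h1 : C * C.conjTranspose = 1 := by
    ext i j
    have h2 := hexp (coframe g x w j ∘ₗ type10Map x) i
    have h3 : (coframe g x w j ∘ₗ type10Map x) (w i) = if i = j then 1 else 0 := hw i j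
    rw [h3] at h2
    rw [Matrix.one_apply, h2, Matrix.mul_apply, Matrix.mulVec, dotProduct]
    refine Finset.sum_congr rfl fun a _ => ?_
    rw [Matrix.conjTranspose_apply]
    congr 1
    exact conj_gC g (w j) (v a)
  rw [← sum_norm_sq_mulVec (mul_eq_one_comm.1 h1) fun a => l (v a)]
  exact Finset.sum_congr rfl fun i _ => by rw [hexp l i]

variable [CompleteSpace E]

/-- `|T|²` does not depend on the unitary basis. -/
lemma sum_torsionCoeff_eq (g : HermitianMetric E M) (D : Connection E M) {x : M}
    {v w : Fin (Module.finrank ℂ E) → TM E x}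
    (hv : IsUnitaryAt g x v) (hw : IsUnitaryAt g x w) :
    ∑ i, ∑ j, ∑ k, ‖torsionCoeff g D x w i j k‖ ^ 2
      = ∑ i, ∑ j, ∑ k, ‖torsionCoeff g D x v i j k‖ ^ 2 := by
  let t : TM E x → TM E x → TM E x → ℂ := fun a b c =>
    (1 / 2) * g.gC x (torsionC D x (type10 a) (type10 b)) (type01 c)
  have h1 : ∀ b c, ∑ i, ‖t (w i) b c‖ ^ 2 = ∑ i, ‖t (v i) b c‖ ^ 2 := fun b c =>
    sum_norm_sq_eq hv hw ((1 / 2 : ℂ) • ((g.gC x).flip (type01 c) ∘ₗ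
      (torsionC D x).flip (type10 b) ∘ₗ type10Map x))
  have h2 : ∀ a c, ∑ i, ‖t a (w i) c‖ ^ 2 = ∑ i, ‖t a (v i) c‖ ^ 2 := fun a c =>
    sum_norm_sq_eq hv hw ((1 / 2 : ℂ) • ((g.gC x).flip (type01 c) ∘ₗ
      torsionC D x (type10 a) ∘ₗ type10Map x))
  have h3 : ∀ a b, ∑ i, ‖t a b (w i)‖ ^ 2 = ∑ i, ‖t a b (v i)‖ ^ 2 := fun a b => by
    -- In its last slot `t` is conjugate linear; conjugation makes `sum_norm_sq_eq` applicable there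
    -- too, so the three slots can be changed one at a time.
    let l : E →ₗ[ℂ] ℂ :=
      { toFun := fun c => conj (g.gC x ((1 / 2 : ℂ) • torsionC D x (type10 a) (type10 b))
          (type01 (x := x) (c : E)))
        map_add' := fun c d => by
          have := type01_add (x := x) (E := E) c d
          rw [← map_add, ← map_add]
          exact congrArg _ (congrArg _ this)
        map_smul' := fun r c => by
          rw [type01_smul, map_smul, smul_eq_mul, map_mul, Complex.conj_conj]
          rfl }
    have hl : ∀ c : TM E x, ‖l c‖ = ‖t a b c‖ := fun c => by
      change ‖conj _‖ = _
      rw [RCLike.norm_conj, map_smul]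
      rfl
    have := sum_norm_sq_eq hv hw l
    simpa only [hl] using this
  change ∑ i, ∑ j, ∑ k, ‖t (w j) (w k) (w i)‖ ^ 2 = ∑ i, ∑ j, ∑ k, ‖t (v j) (v k) (v i)‖ ^ 2
  calc ∑ i, ∑ j, ∑ k, ‖t (w j) (w k) (w i)‖ ^ 2
      = ∑ i, ∑ j, ∑ k, ‖t (w j) (v k) (w i)‖ ^ 2 := by simp only [h2]
    _ = ∑ i, ∑ k, ∑ j, ‖t (w j) (v k) (w i)‖ ^ 2 :=
      Finset.sum_congr rfl fun i _ => Finset.sum_comm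
    _ = ∑ i, ∑ k, ∑ j, ‖t (v j) (v k) (w i)‖ ^ 2 := by simp only [h1]
    _ = ∑ k, ∑ i, ∑ j, ‖t (v j) (v k) (w i)‖ ^ 2 := Finset.sum_comm
    _ = ∑ k, ∑ j, ∑ i, ‖t (v j) (v k) (w i)‖ ^ 2 :=
      Finset.sum_congr rfl fun i _ => Finset.sum_comm
    _ = ∑ k, ∑ j, ∑ i, ‖t (v j) (v k) (v i)‖ ^ 2 := by simp only [h3]
    _ = ∑ k, ∑ i, ∑ j, ‖t (v j) (v k) (v i)‖ ^ 2 :=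
      Finset.sum_congr rfl fun i _ => Finset.sum_comm
    _ = ∑ i, ∑ k, ∑ j, ‖t (v j) (v k) (v i)‖ ^ 2 := Finset.sum_comm
    _ = _ := Finset.sum_congr rfl fun i _ => Finset.sum_comm

/-- Replaces the arbitrary basis chosen in `torsionNormSq`, in particular by the values of a
parallel frame. -/
lemma torsionNormSq_eq (g : HermitianMetric E M) (D : Connection E M) {x : M}
    {v : Fin (Module.finrank ℂ E) → TM E x} (hv : IsUnitaryAt g x v) :
    torsionNormSq g D x = ∑ i, ∑ j, ∑ k, ‖torsionCoeff g D x v i j k‖ ^ 2 :=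
  sum_torsionCoeff_eq g D hv (exists_isUnitaryAt g x).choose_spec

end UnitaryBases

/-! ### Parallel unitary frames -/

section ParallelFrames

variable {E : Type*} [NormedAddCommGroup E] [NormedSpace ℂ E]
  {M : Type*} [TopologicalSpace M] [ChartedSpace E M] [IsManifold 𝓘(ℂ, E) ω M]
  [FiniteDimensional ℂ E] [CompleteSpace E]
  {g : HermitianMetric E M} {Db Dc : Connection E M}

lemma IsUnitaryFrameOn.parallelOn {v : Fin (Module.finrank ℂ E) → VF E M} {U : Set M}
    (hv : IsUnitaryFrameOn g v U) (hp : IsParallelOn Db v U) (i : Fin (Module.finrank ℂ E)) :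
    (v i).ParallelOn Db U :=
  ⟨fun y hy => (hv.smooth i).smoothAt hv.isOpen hy, fun y hy =>
    connection_eq_zero_of_covC (hp i y hy)⟩

/-- The factor `1 / 2` of `torsionCoeff` and the sign of `torsionRe_chern` account for the
coefficients `-1 / 2` and `I / 2` in `torsionHol`. -/
lemma torsionComp_eq_conj_torsionHol (hb : IsBismut g Db) (hc : IsChern g Dc)
    {v : Fin (Module.finrank ℂ E) → VF E M} {U : Set M}
    (hv : IsUnitaryFrameOn g v U) (hp : IsParallelOn Db v U) (i j k : Fin (Module.finrank ℂ E))
    {x : M} (hx : x ∈ U) :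
    torsionComp g Dc v i j k x = conj (torsionHol g Db (v j) (v k) (v i) x) := by
  have h := gC_torsionC g Dc (v j) (v k) (v i) x
  have h' : torsionComp g Dc v i j k x
      = 1 / 2 * g.gC x (torsionC Dc x (type10 (v j x)) (type10 (v k x))) (type01 (v i x)) := rfl
  rw [h', h, torsionIm_eq_torsionRe,
    torsionRe_chern hb hc (hv.parallelOn hp j) (hv.parallelOn hp k) (hv.parallelOn hp i) hx,
    torsionRe_chern hb hc (hv.parallelOn hp j) (hv.parallelOn hp k)
      ((hv.parallelOn hp i).J hb.toIsHermitianConnection) hx, torsionHol, torsionIm_eq_torsionRe]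
  simp only [map_add, Complex.real_smul, map_mul, Complex.conj_ofReal, map_neg, map_div₀,
    Complex.conj_I, map_one, map_ofNat]
  push_cast
  ring

/-- Local unitary parallel frames of a flat Hermitian connection. -/
lemma exists_parallel_unitary_frame [T2Space M] (hD : IsHermitianConnection g Db)
    (hflat : IsFlat Db) (p : M) :
    ∃ (U : Set M) (v : Fin (Module.finrank ℂ E) → VF E M), p ∈ U ∧ IsUnitaryFrameOn g v U ∧
      IsParallelOn Db v U := by
  obtain ⟨v₀, hv₀⟩ := exists_isUnitaryAt g p
  choose U hU hpU X hX hXp hX0 using fun i => exists_parallel_field hD.smooth hflat p (v₀ i)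
  have hXU : ∀ i, (X i).ParallelOn Db (⋂ i, U i) := fun i =>
    ⟨fun y hy => (hX i).smoothAt (hU i) (Set.mem_iInter.1 hy i), fun y hy =>
      hX0 i y (Set.mem_iInter.1 hy i)⟩
  have hUU : IsOpen (⋂ i, U i) := isOpen_iInter_of_finite hU
  have hpUU : p ∈ ⋂ i, U i := Set.mem_iInter.2 hpU
  -- Scalar products of parallel fields are locally constant, so the unitarity arranged at `p`
  -- persists nearby.
  have hconst : ∀ {Y Z : VF E M}, Y.ParallelOn Db (⋂ i, U i) → Z.ParallelOn Db (⋂ i, U i) →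
      ∀ᶠ y in nhds p, g.inner y (Y y) (Z y) = g.inner p (Y p) (Z p) := fun {Y Z} hY hZ => by
    refine eventually_eq_of_mvfderiv_eq_zero (E := E) (f := fun y => g.inner y (Y y) (Z y)) ?_
    filter_upwards [hUU.mem_nhds hpUU] with y hy
    exact ⟨(smoothAt_inner g (hY.smooth y hy) (hZ.smooth y hy)).mdifferentiableAt (by simp),
      mvfderiv_inner_eq_zero hD hY hZ hy⟩
  have hun : ∀ᶠ y in nhds p, IsUnitaryAt g y (fun i => X i y) := by
    have h : ∀ᶠ y in nhds p, ∀ i j, g.inner y (X i y) (X j y) = g.inner p (X i p) (X j p) ∧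
        g.inner y (X i y) ((X j).J y) = g.inner p (X i p) ((X j).J p) :=
      Filter.eventually_all.2 fun i => Filter.eventually_all.2 fun j =>
        (hconst (hXU i) (hXU j)).and (hconst (hXU i) ((hXU j).J hD))
    filter_upwards [h] with y hy i j
    have h2 := hv₀ i j
    rw [← hXp i, ← hXp j, g.gC_type10_type01] at h2
    rw [g.gC_type10_type01, ← h2]
    have h3 := hy i j
    simp only [VF.J] at h3
    rw [h3.1, h3.2]
  obtain ⟨V, hV, hVo, hpV⟩ := eventually_nhds_iff.1 hun
  refine ⟨V ∩ ⋂ i, U i, X, ⟨hpV, hpUU⟩, ⟨hVo.inter hUU, fun i => VF.smoothOn_of_smoothAt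
    fun y hy => (hXU i).smooth y hy.2, fun y hy => hV y hy.1⟩, fun i y hy => ?_⟩
  exact covC_eq_zero hD ((hXU i).smooth y hy.2).differentiableAt ((hXU i).parallel y hy.2)

end ParallelFrames

/-! ### `∂∂̄` of a sum of squared moduli of holomorphic functions -/

section DelDbar

variable {E : Type*} [NormedAddCommGroup E] [NormedSpace ℂ E]

/-- The `(0,1)`-form `∑ h_i · conj(∂h_i)`, which is `∂̄ ∑ |h_i|²` for holomorphic `h_i`. -/
def dbarSumNormSq {ι : Type*} [Fintype ι] (h : ι → E → ℂ) (q : E) : E →L[ℝ] ℂ :=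
  ∑ i, h i q • (Complex.conjCLE : ℂ →L[ℝ] ℂ).comp (fderiv ℝ (h i) q)

lemma dbar_sum_normSq {ι : Type*} [Fintype ι] {h : ι → E → ℂ} {F : E → ℂ} {q : E}
    (hd : ∀ i, DifferentiableAt ℝ (h i) q)
    (hI : ∀ i w, fderiv ℝ (h i) q (Complex.I • w) = Complex.I * fderiv ℝ (h i) q w)
    (hF : ∀ᶠ q in nhds q, F q = ∑ i, h i q * conj (h i q)) :
    dbar F q = ContinuousAlternatingMap.ofSubsingleton ℝ E ℂ 0 (dbarSumNormSq h q) := by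
  have h1 : fderiv ℝ F q = ∑ i, (h i q • (Complex.conjCLE : ℂ →L[ℝ] ℂ).comp (fderiv ℝ (h i) q)
      + conj (h i q) • fderiv ℝ (h i) q) := by
    have h2 : HasFDerivAt (fun q => ∑ i, h i q * conj (h i q))
        (∑ i, (h i q • (Complex.conjCLE : ℂ →L[ℝ] ℂ).comp (fderiv ℝ (h i) q)
          + conj (h i q) • fderiv ℝ (h i) q)) q := by
      refine HasFDerivAt.fun_sum fun i _ => ?_
      exact (hd i).hasFDerivAt.mul
        ((Complex.conjCLE : ℂ →L[ℝ] ℂ).hasFDerivAt.comp q (hd i).hasFDerivAt)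
    rw [Filter.EventuallyEq.fderiv_eq (hF : F =ᶠ[nhds q] fun q => ∑ i, h i q * conj (h i q)),
      h2.fderiv]
  rw [dbar]
  congr 1
  ext w
  rw [h1, dbarSumNormSq]
  simp only [smul_apply, add_apply, sum_apply, ContinuousLinearMap.comp_apply, ContinuousLinearMap.id_apply, hI,
    smul_eq_mul, ContinuousLinearEquiv.coe_coe, Complex.conjCLE_apply, map_mul, Complex.conj_I,
    Finset.mul_sum, ← Finset.sum_add_distrib]
  refine Finset.sum_congr rfl fun i _ => ?_
  linear_combination (1 / 2) * (conj (h i q) * fderiv ℝ (h i) q w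
    - h i q * conj (fderiv ℝ (h i) q w)) * Complex.I_mul_I

/-- Differentiating `∑ h_i conj(∂h_i)` gives `∑ ∂h_i ∧ conj(∂h_i)`; the second derivatives drop out
by symmetry. -/
lemma del01_dbar_sum_normSq {ι : Type*} [Fintype ι] {h : ι → E → ℂ} {F : E → ℂ} {q₀ : E}
    (hd : ∀ i, ContDiffAt ℝ 2 (h i) q₀)
    (hI : ∀ᶠ q in nhds q₀, ∀ i w,
      fderiv ℝ (h i) q (Complex.I • w) = Complex.I * fderiv ℝ (h i) q w)
    (hF : ∀ᶠ q in nhds q₀, F q = ∑ i, h i q * conj (h i q)) (w₁ w₂ : E) :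
    del01 (dbar F) q₀ w₁ w₂
      = ∑ i, (fderiv ℝ (h i) q₀ w₁ * conj (fderiv ℝ (h i) q₀ w₂)
        - fderiv ℝ (h i) q₀ w₂ * conj (fderiv ℝ (h i) q₀ w₁)) := by
  have hd1 : ∀ i, DifferentiableAt ℝ (h i) q₀ := fun i => (hd i).differentiableAt two_ne_zero
  have hdd : ∀ i, DifferentiableAt ℝ (fderiv ℝ (h i)) q₀ := fun i =>
    ((hd i).fderiv_right (m := 1) (by norm_num)).differentiableAt one_ne_zero
  have hdb : dbar F =ᶠ[nhds q₀]
      fun q => ContinuousAlternatingMap.ofSubsingleton ℝ E ℂ 0 (dbarSumNormSq h q) := by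
    have hev : ∀ᶠ q in nhds q₀, ∀ i, DifferentiableAt ℝ (h i) q :=
      Filter.eventually_all.2 fun i => ((hd i).eventually (by simp)).mono fun q hq =>
        hq.differentiableAt two_ne_zero
    filter_upwards [hev, hI, hF.eventually_nhds] with q h1 h2 h3
    exact dbar_sum_normSq h1 h2 h3
  have hL : HasFDerivAt (dbarSumNormSq h) (fderiv ℝ (dbarSumNormSq h) q₀) q₀ := by
    refine DifferentiableAt.hasFDerivAt ?_
    unfold dbarSumNormSq
    exact DifferentiableAt.fun_sum fun i _ => (hd1 i).smul
      ((differentiableAt_const _).clm_comp (hdd i))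
  have hω : DifferentiableAt ℝ
      (fun q => ContinuousAlternatingMap.ofSubsingleton ℝ E ℂ (0 : Fin 1) (dbarSumNormSq h q)) q₀ :=
    (ContinuousAlternatingMap.ofSubsingletonLIE (𝕜 := ℝ) (E := E) (F := ℂ) (0 : Fin 1)).differentiableAt.comp q₀
      hL.differentiableAt
  have hap : ∀ w₁ w₂ : E, extDeriv (dbar F) q₀ ![w₁, w₂]
      = ∑ i, (fderiv ℝ (h i) q₀ w₁ * conj (fderiv ℝ (h i) q₀ w₂)
        - fderiv ℝ (h i) q₀ w₂ * conj (fderiv ℝ (h i) q₀ w₁)) := fun w₁ w₂ => by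
    have hLw : ∀ w, HasFDerivAt (fun q => dbarSumNormSq h q w)
        (∑ i, (h i q₀ • (Complex.conjCLE : ℂ →L[ℝ] ℂ).comp ((fderiv ℝ (fderiv ℝ (h i)) q₀).flip w)
          + conj (fderiv ℝ (h i) q₀ w) • fderiv ℝ (h i) q₀)) q₀ := fun w => by
      have e : (fun q => dbarSumNormSq h q w)
          = fun q => ∑ i, h i q * conj (fderiv ℝ (h i) q w) := by
        funext q
        simp [dbarSumNormSq]
      rw [e]
      refine HasFDerivAt.fun_sum fun i _ => ?_
      have h3 : HasFDerivAt (fun q => fderiv ℝ (h i) q w) ((fderiv ℝ (fderiv ℝ (h i)) q₀).flip w)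
          q₀ := by
        have := (hdd i).hasFDerivAt.clm_apply (hasFDerivAt_const w q₀)
        simpa using this
      exact (hd1 i).hasFDerivAt.mul ((Complex.conjCLE : ℂ →L[ℝ] ℂ).hasFDerivAt.comp q₀ h3)
    rw [hdb.extDeriv_eq, extDeriv_apply hω, Fin.sum_univ_two]
    have e1 : (fun q => ContinuousAlternatingMap.ofSubsingleton ℝ E ℂ (0 : Fin 1)
        (dbarSumNormSq h q) ((0 : Fin 2).removeNth ![w₁, w₂]))
        = fun q => dbarSumNormSq h q w₂ := by
      funext q; rfl
    have e2 : (fun q => ContinuousAlternatingMap.ofSubsingleton ℝ E ℂ (0 : Fin 1)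
        (dbarSumNormSq h q) ((1 : Fin 2).removeNth ![w₁, w₂]))
        = fun q => dbarSumNormSq h q w₁ := by
      funext q; rfl
    have hsym : ∀ i, fderiv ℝ (fderiv ℝ (h i)) q₀ w₁ w₂ = fderiv ℝ (fderiv ℝ (h i)) q₀ w₂ w₁ :=
      fun i => (hd i).isSymmSndFDerivAt (by simp) w₁ w₂
    rw [e1, e2, (hLw w₁).fderiv, (hLw w₂).fderiv]
    simp only [add_apply, sum_apply, smul_apply, ContinuousLinearMap.comp_apply,
      ContinuousLinearMap.flip_apply, smul_eq_mul, ContinuousLinearEquiv.coe_coe,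
      Complex.conjCLE_apply, hsym, Matrix.cons_val_zero, Matrix.cons_val_one]
    simp only [Fin.val_zero, Fin.val_one, pow_zero, pow_one, one_smul, neg_smul, ← sub_eq_add_neg,
      ← Finset.sum_sub_distrib]
    refine Finset.sum_congr rfl fun i _ => ?_
    ring
  have hI0 := hI.self_of_nhds
  -- The exterior derivative is already of type `(1,1)`: replacing both vectors by their multiples
  -- by `I` introduces the factor `I * conj I = 1`, so the averaging in `del01` changes nothing.
  rw [del01, hap, hap]
  simp only [hI0, map_mul, Complex.conj_I]
  rw [← Finset.sum_add_distrib, Finset.mul_sum]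
  refine Finset.sum_congr rfl fun i _ => ?_
  linear_combination (-(1 / 2) * (fderiv ℝ (h i) q₀ w₁ * conj (fderiv ℝ (h i) q₀ w₂)
        - fderiv ℝ (h i) q₀ w₂ * conj (fderiv ℝ (h i) q₀ w₁))) * Complex.I_mul_I

end DelDbar

/-! ### Derivatives on the manifold and in the chart -/

section ChartDerivatives

variable {E : Type*} [NormedAddCommGroup E] [NormedSpace ℂ E]
  {M : Type*} [TopologicalSpace M] [ChartedSpace E M] [IsManifold 𝓘(ℂ, E) ω M]

lemma mvfderiv_eq_fderiv {F : Type*} [NormedAddCommGroup F] [NormedSpace ℝ F] {f : M → F} {x : M}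
    (h : MDifferentiableAt 𝓘(ℝ, E) 𝓘(ℝ, F) f x) (w : E) :
    mvfderiv 𝓘(ℝ, E) f x (w : E)
      = fderiv ℝ (f ∘ (extChartAt 𝓘(ℝ, E) x).symm) (extChartAt 𝓘(ℝ, E) x x) w := by
  have h2 : mvfderiv 𝓘(ℝ, E) f x = mfderiv 𝓘(ℝ, E) 𝓘(ℝ, F) f x := rfl
  have h3 : mfderiv 𝓘(ℝ, E) 𝓘(ℝ, F) f x
      = fderiv ℝ (f ∘ (extChartAt 𝓘(ℝ, E) x).symm) (extChartAt 𝓘(ℝ, E) x x) := by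
    have h4 : mfderiv 𝓘(ℝ, E) 𝓘(ℝ, F) f x
        = fderivWithin ℝ (f ∘ (extChartAt 𝓘(ℝ, E) x).symm) Set.univ (extChartAt 𝓘(ℝ, E) x x) := by
      have h5 := h.mfderiv
      rw [modelWithCornersSelf_coe, Set.range_id] at h5
      exact h5
    exact h4.trans (congrArg (fun A => A (extChartAt 𝓘(ℝ, E) x x)) fderivWithin_univ)
  exact DFunLike.congr_fun h3 w

lemma differentiableAt_comp_extChartAt_symm {F : Type*} [NormedAddCommGroup F] [NormedSpace ℂ F]
    {f : M → F} {p : M} {q : E} (hq : q ∈ (extChartAt 𝓘(ℝ, E) p).target)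
    (h : MDifferentiableAt 𝓘(ℂ, E) 𝓘(ℂ, F) f ((extChartAt 𝓘(ℝ, E) p).symm q)) :
    DifferentiableAt ℂ (f ∘ (extChartAt 𝓘(ℝ, E) p).symm) q := by
  have hs : ContMDiffOn 𝓘(ℂ, E) 𝓘(ℂ, E) ω (extChartAt 𝓘(ℂ, E) p).symm
      (extChartAt 𝓘(ℂ, E) p).target := contMDiffOn_extChartAt_symm p
  have hs1 : MDifferentiableAt 𝓘(ℂ, E) 𝓘(ℂ, E) (extChartAt 𝓘(ℝ, E) p).symm q :=
    (hs.contMDiffAt ((isOpen_extChartAt_target p).mem_nhds hq)).mdifferentiableAt (by simp)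
  exact mdifferentiableAt_iff_differentiableAt.1 (MDifferentiableAt.comp q h hs1)

end ChartDerivatives

/-! ### Covariant derivatives of the torsion in a parallel frame -/

section Main

variable {E : Type*} [NormedAddCommGroup E] [NormedSpace ℂ E]
  {M : Type*} [TopologicalSpace M] [ChartedSpace E M] [IsManifold 𝓘(ℂ, E) ω M]
  [FiniteDimensional ℂ E] [CompleteSpace E]
  {g : HermitianMetric E M} {Db Dc : Connection E M}
  {v : Fin (Module.finrank ℂ E) → VF E M} {U : Set M}

lemma torsionNormSq_eq_sum_torsionHol (hb : IsBismut g Db) (hc : IsChern g Dc)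
    (hv : IsUnitaryFrameOn g v U) (hp : IsParallelOn Db v U) {x : M} (hx : x ∈ U) :
    torsionNormSq g Dc x
      = ∑ a : Fin (Module.finrank ℂ E) × Fin (Module.finrank ℂ E) × Fin (Module.finrank ℂ E),
        ‖torsionHol g Db (v a.2.1) (v a.2.2) (v a.1) x‖ ^ 2 := by
  rw [torsionNormSq_eq g Dc (hv.unitary x hx), Fintype.sum_prod_type]
  refine Finset.sum_congr rfl fun i _ => ?_
  rw [Fintype.sum_prod_type]
  refine Finset.sum_congr rfl fun j _ => Finset.sum_congr rfl fun k _ => ?_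
  have h := torsionComp_eq_conj_torsionHol hb hc hv hp i j k hx
  rw [torsionComp] at h
  rw [h, RCLike.norm_conj]

/-- In a parallel frame the connection forms vanish and only the plain derivative of `conj h` is
left. Along `w + √-1 J w` the two halves coincide because `h` is holomorphic, hence the factor `2`.
-/
lemma torsionCov_type01 [T2Space M] (hb : IsBismut g Db) (hflat : IsFlat Db) (hc : IsChern g Dc)
    (hv : IsUnitaryFrameOn g v U) (hp : IsParallelOn Db v U) (i j k : Fin (Module.finrank ℂ E))
    {x : M} (hx : x ∈ U) (w : TM E x) :
    torsionCov g Db Dc v i j k x (type01 w)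
      = 2 * conj (mvfderiv 𝓘(ℝ, E) (torsionHol g Db (v j) (v k) (v i)) x w) := by
  have hθ : ∀ r s, connForm g Db v r s x = 0 := fun r s => by
    rw [connForm, hp r x hx, LinearMap.comp_zero]
  simp only [torsionCov, hθ, LinearMap.zero_apply, zero_mul, Finset.sum_const_zero, sub_zero,
    add_zero]
  have hpar := fun i => hv.parallelOn hp i
  have hol := mdifferentiableAt_torsionHol hb hflat hv.isOpen (hpar j) (hpar k) (hpar i) hx
  have hd := (smoothAt_torsionHol hb hv.isOpen (hpar j) (hpar k) (hpar i) hx).mdifferentiableAt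
    (by simp)
  have hJ : mvfderiv 𝓘(ℝ, E) (torsionHol g Db (v j) (v k) (v i)) x (J x w)
      = Complex.I * mvfderiv 𝓘(ℝ, E) (torsionHol g Db (v j) (v k) (v i)) x w :=
    mfderiv_J_of_complex hol w
  have hconj : ∀ u : TM E x, mvfderiv 𝓘(ℝ, E) (torsionComp g Dc v i j k) x u
      = conj (mvfderiv 𝓘(ℝ, E) (torsionHol g Db (v j) (v k) (v i)) x u) := fun u => by
    have h1 : HasMFDerivAt 𝓘(ℝ, E) 𝓘(ℝ, ℂ)
        (fun y => (Complex.conjCLE : ℂ →L[ℝ] ℂ) (torsionHol g Db (v j) (v k) (v i) y)) x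
        ((Complex.conjCLE : ℂ →L[ℝ] ℂ).comp
          (mvfderiv 𝓘(ℝ, E) (torsionHol g Db (v j) (v k) (v i)) x)) :=
      HasMFDerivAt.comp x (Complex.conjCLE : ℂ →L[ℝ] ℂ).hasMFDerivAt hd.hasMFDerivAt
    have h2 : HasMFDerivAt 𝓘(ℝ, E) 𝓘(ℝ, ℂ) (torsionComp g Dc v i j k) x
        ((Complex.conjCLE : ℂ →L[ℝ] ℂ).comp
          (mvfderiv 𝓘(ℝ, E) (torsionHol g Db (v j) (v k) (v i)) x)) := by
      refine h1.congr_of_eventuallyEq ?_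
      filter_upwards [hv.isOpen.mem_nhds hx] with y hy
      exact torsionComp_eq_conj_torsionHol hb hc hv hp i j k hy
    exact DFunLike.congr_fun h2.mfderiv u
  rw [type01, map_add, dC, LinearMap.liftBaseChange_tmul, LinearMap.liftBaseChange_tmul,
    ContinuousLinearMap.coe_coe, hconj, hconj, hJ, map_mul, Complex.conj_I]
  simp only [smul_eq_mul]
  linear_combination (-conj (mvfderiv 𝓘(ℝ, E) (torsionHol g Db (v j) (v k) (v i)) x w))
    * Complex.I_mul_I

/-- Expansion of the differential of a holomorphic function in the coframe. -/
lemma mvfderiv_eq_sum_coframe {f : M → ℂ} {x : M} (hf : MDifferentiableAt 𝓘(ℂ, E) 𝓘(ℂ) f x)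
    {v : Fin (Module.finrank ℂ E) → TM E x} (hv : IsUnitaryAt g x v) (w : TM E x) :
    mvfderiv 𝓘(ℝ, E) f x w
      = ∑ a, 2 * coframe g x v a ((1 : ℂ) ⊗ₜ[ℝ] w) * mvfderiv 𝓘(ℝ, E) f x (v a) := by
  have h0 : mvfderiv 𝓘(ℝ, E) f x = (mfderiv 𝓘(ℂ, E) 𝓘(ℂ) f x).restrictScalars ℝ :=
    (hasMFDerivAt_restrictScalars hf.hasMFDerivAt).mfderiv
  -- `type10 w` is `v - √-1 J v` without the factor `1 / 2`, so it differs from `2 w` by a `(0,1)`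
  -- vector, which the coframe kills.
  have h1 : ∀ a, coframe g x v a (type10 w) = 2 * coframe g x v a ((1 : ℂ) ⊗ₜ[ℝ] w) := fun a => by
    have h2 : type10 w = (2 : ℂ) • ((1 : ℂ) ⊗ₜ[ℝ] w) - type01 w := by
      rw [type10, type01, two_smul]
      abel
    rw [h2, map_sub, map_smul, coframe_type01, sub_zero, smul_eq_mul]
  let l : E →ₗ[ℂ] ℂ := (mfderiv 𝓘(ℂ, E) 𝓘(ℂ) f x : E →L[ℂ] ℂ).toLinearMap
  have hl : ∀ u : E, mvfderiv 𝓘(ℝ, E) f x (u : E) = l u := fun u => by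
    rw [h0]; rfl
  have h3 : l w = ∑ a, coframe g x v a (type10 w) * l (v a) :=
    (congrArg l (eq_sum_coframe (v := v) hv w)).trans
      ((map_sum l _ _).trans (Finset.sum_congr rfl fun a _ => l.map_smul _ _))
  refine (hl w).trans (h3.trans (Finset.sum_congr rfl fun a _ => ?_))
  rw [h1]
  exact congrArg _ (hl (v a)).symm

end Main

/-- Used with `d a` the derivative of `h` along `v_a` and `p`, `q` the coframe values on two
vectors: it expands `∂h ∧ conj(∂h)`, where `2 * conj (d l)` is `T_{,l̄}`. -/
lemma sum_mul_conj_sum_sub {ι : Type*} [Fintype ι] (d p q : ι → ℂ) :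
    (∑ a, 2 * p a * d a) * conj (∑ a, 2 * q a * d a)
        - (∑ a, 2 * q a * d a) * conj (∑ a, 2 * p a * d a)
      = ∑ l, ∑ m, (2 * conj (d l)) * conj (2 * conj (d m))
        * (p m * conj (q l) - q m * conj (p l)) := by
  have h : ∀ p q : ι → ℂ, (∑ a, 2 * p a * d a) * conj (∑ a, 2 * q a * d a)
      = ∑ l, ∑ m, (2 * p m * d m) * (2 * conj (q l) * conj (d l)) := fun p q => by
    rw [map_sum, Finset.sum_mul_sum, Finset.sum_comm]
    simp only [map_mul, map_ofNat]
  rw [h, h, ← Finset.sum_sub_distrib]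
  refine Finset.sum_congr rfl fun l _ => ?_
  rw [← Finset.sum_sub_distrib]
  refine Finset.sum_congr rfl fun m _ => ?_
  simp only [map_mul, map_ofNat, Complex.conj_conj]
  ring

/-! ### Plurisubharmonicity, the `∂∂̄` formula and the compact case -/

section Main

variable {E : Type*} [NormedAddCommGroup E] [NormedSpace ℂ E]
  {M : Type*} [TopologicalSpace M] [ChartedSpace E M] [IsManifold 𝓘(ℂ, E) ω M]
  [FiniteDimensional ℂ E] [CompleteSpace E] [T2Space M]
  {g : HermitianMetric E M} {Db Dc : Connection E M}
  {v : Fin (Module.finrank ℂ E) → VF E M} {U : Set M}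

/-- The conjugates of all torsion components, as one vector-valued function. -/
def torsionHolVec (g : HermitianMetric E M) (D : Connection E M)
    (v : Fin (Module.finrank ℂ E) → VF E M) (y : M) :
    EuclideanSpace ℂ (Fin (Module.finrank ℂ E) × Fin (Module.finrank ℂ E) × Fin (Module.finrank ℂ E)) :=
  WithLp.toLp 2 fun a => torsionHol g D (v a.2.1) (v a.2.2) (v a.1) y

lemma norm_torsionHolVec_sq (hb : IsBismut g Db) (hc : IsChern g Dc)
    (hv : IsUnitaryFrameOn g v U) (hp : IsParallelOn Db v U) {x : M} (hx : x ∈ U) :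
    torsionNormSq g Dc x = ‖torsionHolVec g Db v x‖ ^ 2 := by
  rw [torsionNormSq_eq_sum_torsionHol hb hc hv hp hx, EuclideanSpace.norm_sq_eq]
  rfl

lemma contMDiff_torsionNormSq (hb : IsBismut g Db) (hflat : IsFlat Db) (hc : IsChern g Dc) :
    ContMDiff 𝓘(ℝ, E) 𝓘(ℝ) ∞ (torsionNormSq g Dc) := by
  intro p
  obtain ⟨U, v, hpU, hv, hp⟩ := exists_parallel_unitary_frame (g := g)
    hb.toIsHermitianConnection hflat p
  have h : ContMDiffAt 𝓘(ℝ, E) 𝓘(ℝ) ∞ (fun x => ∑ a : Fin (Module.finrank ℂ E) ×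
      Fin (Module.finrank ℂ E) × Fin (Module.finrank ℂ E),
      ‖torsionHol g Db (v a.2.1) (v a.2.2) (v a.1) x‖ ^ 2) p := by
    refine contMDiffAt_finsetSum fun a _ => ?_
    exact (contDiff_norm_sq ℝ).contDiffAt.contMDiffAt.comp p (smoothAt_torsionHol hb hv.isOpen
      (hv.parallelOn hp _) (hv.parallelOn hp _) (hv.parallelOn hp _) hpU)
  refine h.congr_of_eventuallyEq ?_
  filter_upwards [hv.isOpen.mem_nhds hpU] with y hy
  exact torsionNormSq_eq_sum_torsionHol hb hc hv hp hy

lemma isPlurisubharmonic_torsionNormSq (hb : IsBismut g Db) (hflat : IsFlat Db)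
    (hc : IsChern g Dc) : IsPlurisubharmonic E (torsionNormSq g Dc) := by
  refine ⟨(contMDiff_torsionNormSq hb hflat hc).continuous.upperSemicontinuous,
    fun V γ hV hVB hγ => ?_⟩
  refine circleIntegrable_and_le_circleAverage (W := EuclideanSpace ℂ (Fin (Module.finrank ℂ E) ×
    Fin (Module.finrank ℂ E) × Fin (Module.finrank ℂ E))) fun z hz => ?_
  obtain ⟨U, v, hpU, hv, hp⟩ := exists_parallel_unitary_frame (g := g)
    hb.toIsHermitianConnection hflat (γ z)
  refine ⟨V ∩ γ ⁻¹' U, hγ.continuousOn.isOpen_inter_preimage hV hv.isOpen, ⟨hVB hz, hpU⟩,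
    fun w => torsionHolVec g Db v (γ w), ?_, fun w hw => norm_torsionHolVec_sq hb hc hv hp hw.2⟩
  intro w hw
  refine DifferentiableAt.differentiableWithinAt (differentiableAt_euclidean.2 fun a => ?_)
  have h := mdifferentiableAt_torsionHol hb hflat hv.isOpen (hv.parallelOn hp a.2.1)
    (hv.parallelOn hp a.2.2) (hv.parallelOn hp a.1) hw.2
  exact mdifferentiableAt_iff_differentiableAt.1
    (MDifferentiableAt.comp w h ((hγ w hw.1).mdifferentiableAt (hV.mem_nhds hw.1)))

lemma contMDiffOn_torsionComp (hb : IsBismut g Db) (hc : IsChern g Dc)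
    (hv : IsUnitaryFrameOn g v U) (hp : IsParallelOn Db v U) (i j k : Fin (Module.finrank ℂ E)) :
    ContMDiffOn 𝓘(ℝ, E) 𝓘(ℝ, ℂ) ∞ (torsionComp g Dc v i j k) U := by
  intro x hx
  have h : ContMDiffAt 𝓘(ℝ, E) 𝓘(ℝ, ℂ) ∞
      (fun y => (Complex.conjCLE : ℂ →L[ℝ] ℂ) (torsionHol g Db (v j) (v k) (v i) y)) x :=
    (Complex.conjCLE : ℂ →L[ℝ] ℂ).contMDiff.contMDiffAt.comp x (smoothAt_torsionHol hb hv.isOpen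
      (hv.parallelOn hp _) (hv.parallelOn hp _) (hv.parallelOn hp _) hx)
  refine (h.congr_of_eventuallyEq ?_).contMDiffWithinAt
  filter_upwards [hv.isOpen.mem_nhds hx] with y hy
  exact torsionComp_eq_conj_torsionHol hb hc hv hp i j k hy

lemma deldbar_torsionNormSq (hb : IsBismut g Db) (hflat : IsFlat Db) (hc : IsChern g Dc)
    (hv : IsUnitaryFrameOn g v U) (hp : IsParallelOn Db v U) {x : M} (hx : x ∈ U)
    (w₁ w₂ : TM E x) :
    deldbar (fun y => (torsionNormSq g Dc y : ℂ)) x w₁ w₂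
      = ∑ i, ∑ j, ∑ k, ∑ l, ∑ m,
          torsionCov g Db Dc v i j k x (type01 (v l x))
            * conj (torsionCov g Db Dc v i j k x (type01 (v m x)))
            * wedgeConj (coframe g x (fun r => v r x) m)
                (coframe g x (fun r => v r x) l) w₁ w₂ := by
  let f : Fin (Module.finrank ℂ E) × Fin (Module.finrank ℂ E) × Fin (Module.finrank ℂ E) → M → ℂ :=
    fun a => torsionHol g Db (v a.2.1) (v a.2.2) (v a.1)
  have hol : ∀ a, ∀ y ∈ U, MDifferentiableAt 𝓘(ℂ, E) 𝓘(ℂ) (f a) y := fun a y hy =>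
    mdifferentiableAt_torsionHol hb hflat hv.isOpen (hv.parallelOn hp _) (hv.parallelOn hp _)
      (hv.parallelOn hp _) hy
  have hsm : ∀ a, ContMDiffAt 𝓘(ℝ, E) 𝓘(ℝ, ℂ) ∞ (f a) x := fun a =>
    smoothAt_torsionHol hb hv.isOpen (hv.parallelOn hp _) (hv.parallelOn hp _)
      (hv.parallelOn hp _) hx
  have hx' := mem_chart_source E x
  have hcd : ∀ a, ContDiffAt ℝ 2 (f a ∘ (extChartAt 𝓘(ℝ, E) x).symm) (extChartAt 𝓘(ℝ, E) x x) :=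
    fun a => by
      have h1 : ContMDiffAt 𝓘(ℝ, E) 𝓘(ℝ, ℂ) ∞ (f a)
          ((extChartAt 𝓘(ℝ, E) x).symm (extChartAt 𝓘(ℝ, E) x x)) := by
        rw [extChartAt_symm_apply hx']; exact hsm a
      exact (contMDiffAt_iff_contDiffAt.1 (h1.comp _ (contMDiffAt_extChartAt_symm hx'))).of_le
        (by exact ENat.LEInfty.out)
  have hnear : ∀ᶠ q in nhds (extChartAt 𝓘(ℝ, E) x x), q ∈ (extChartAt 𝓘(ℝ, E) x).target ∧
      (extChartAt 𝓘(ℝ, E) x).symm q ∈ U := by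
    refine Filter.Eventually.and ((isOpen_extChartAt_target x).mem_nhds (mem_extChartAt_target x)) ?_
    have hc : Filter.Tendsto (extChartAt 𝓘(ℝ, E) x).symm (nhds (extChartAt 𝓘(ℝ, E) x x))
        (nhds x) := by
      simpa [ContinuousAt] using continuousAt_extChartAt_symm (I := 𝓘(ℝ, E)) x
    exact hc (hv.isOpen.mem_nhds hx)
  have key := del01_dbar_sum_normSq (h := fun a => f a ∘ (extChartAt 𝓘(ℝ, E) x).symm)
    (F := (fun y => (torsionNormSq g Dc y : ℂ)) ∘ (extChartAt 𝓘(ℝ, E) x).symm) hcd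
    (by
      filter_upwards [hnear] with q hq a w
      have h := differentiableAt_comp_extChartAt_symm hq.1 (hol a _ hq.2)
      rw [h.fderiv_restrictScalars ℝ]
      exact (fderiv ℂ (f a ∘ (extChartAt 𝓘(ℝ, E) x).symm) q).map_smul Complex.I w)
    (by
      filter_upwards [hnear] with q hq
      rw [Function.comp_apply, torsionNormSq_eq_sum_torsionHol hb hc hv hp hq.2]
      push_cast
      exact Finset.sum_congr rfl fun a _ => (Complex.mul_conj' _).symm)
    w₁ w₂
  rw [deldbar, key, Fintype.sum_prod_type]
  refine Finset.sum_congr rfl fun i _ => ?_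
  rw [Fintype.sum_prod_type]
  refine Finset.sum_congr rfl fun j _ => Finset.sum_congr rfl fun k _ => ?_
  have hd : ∀ w : TM E x, fderiv ℝ (f (i, j, k) ∘ (extChartAt 𝓘(ℝ, E) x).symm)
      (extChartAt 𝓘(ℝ, E) x x) w
      = ∑ a, 2 * coframe g x (fun r => v r x) a ((1 : ℂ) ⊗ₜ[ℝ] w)
        * mvfderiv 𝓘(ℝ, E) (f (i, j, k)) x (v a x) := fun w =>
    (mvfderiv_eq_fderiv ((hsm (i, j, k)).mdifferentiableAt (by simp)) w).symm.trans
      (mvfderiv_eq_sum_coframe (hol (i, j, k) x hx) (hv.unitary x hx) w)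
  rw [hd, hd, sum_mul_conj_sum_sub]
  refine Finset.sum_congr rfl fun l _ => Finset.sum_congr rfl fun m _ => ?_
  rw [torsionCov_type01 hb hflat hc hv hp i j k hx, torsionCov_type01 hb hflat hc hv hp i j k hx]
  rfl

/-- The maximum principle for `|T|²`. -/
lemma eventually_torsionHolVec_eq (hb : IsBismut g Db) (hflat : IsFlat Db) (hc : IsChern g Dc)
    (hv : IsUnitaryFrameOn g v U) (hp : IsParallelOn Db v U) {x : M} (hx : x ∈ U)
    (hmax : IsLocalMax (torsionNormSq g Dc) x) :
    ∀ᶠ y in nhds x, torsionHolVec g Db v y = torsionHolVec g Db v x := by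
  have hx' := mem_chart_source E x
  have hc' : Filter.Tendsto (extChartAt 𝓘(ℝ, E) x).symm (nhds (extChartAt 𝓘(ℝ, E) x x))
      (nhds x) := by
    simpa [ContinuousAt] using continuousAt_extChartAt_symm (I := 𝓘(ℝ, E)) x
  have hU := hv.isOpen.mem_nhds hx
  -- The target is strictly convex, so a local maximum of the norm forces the holomorphic vector
  -- itself to be locally constant.
  have h := Complex.eventually_eq_of_isLocalMax_norm
    (f := torsionHolVec g Db v ∘ (extChartAt 𝓘(ℝ, E) x).symm) (c := extChartAt 𝓘(ℝ, E) x x)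
    (by
      filter_upwards [hc' hU, (isOpen_extChartAt_target (I := 𝓘(ℝ, E)) x).mem_nhds
        (mem_extChartAt_target x)] with q hq hqt
      refine differentiableAt_euclidean.2 fun a => ?_
      exact differentiableAt_comp_extChartAt_symm hqt (mdifferentiableAt_torsionHol hb hflat
        hv.isOpen (hv.parallelOn hp a.2.1) (hv.parallelOn hp a.2.2) (hv.parallelOn hp a.1) hq))
    (by
      filter_upwards [hc' hU, hc'.eventually hmax] with q hq hq2
      rw [norm_torsionHolVec_sq hb hc hv hp hq, norm_torsionHolVec_sq hb hc hv hp hx] at hq2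
      simp only [Function.comp_apply, extChartAt_symm_apply hx']
      exact le_of_sq_le_sq hq2 (norm_nonneg _))
  filter_upwards [(continuousAt_extChartAt (I := 𝓘(ℝ, E)) x).eventually h,
    (chartAt E x).open_source.mem_nhds hx'] with y hy hy2
  simpa only [Function.comp_apply, extChartAt_symm_apply hy2, extChartAt_symm_apply hx'] using hy

/-- `M` need not be connected. A component is compact, and open because `M` is locally connected;
the maximum over it is attained, and the set where it is attained is clopen by the maximum
principle. -/
lemma torsionNormSq_eq_of_mem_connectedComponent [CompactSpace M] (hb : IsBismut g Db)
    (hflat : IsFlat Db) (hc : IsChern g Dc) (x₀ : M) :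
    ∃ c : ℝ, ∀ y ∈ connectedComponent x₀, torsionNormSq g Dc y = c := by
  have hcont : Continuous (torsionNormSq g Dc) := (contMDiff_torsionNormSq hb hflat hc).continuous
  have : LocallyConnectedSpace M := ChartedSpace.locallyConnectedSpace E M
  obtain ⟨m, hm, hmax⟩ := (isClosed_connectedComponent (x := x₀)).isCompact.exists_isMaxOn
    ⟨x₀, mem_connectedComponent⟩ hcont.continuousOn
  refine ⟨torsionNormSq g Dc m, ?_⟩
  have hCo : IsOpen (connectedComponent x₀) := isOpen_connectedComponent
  let S := connectedComponent x₀ ∩ {y | torsionNormSq g Dc y = torsionNormSq g Dc m}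
  have hSc : IsClosed S := isClosed_connectedComponent.inter
    (isClosed_eq hcont continuous_const)
  have hSo : IsOpen S := by
    refine isOpen_iff_mem_nhds.2 fun y hy => ?_
    obtain ⟨U, v, hyU, hv, hp⟩ := exists_parallel_unitary_frame (g := g)
      hb.toIsHermitianConnection hflat y
    have hloc : IsLocalMax (torsionNormSq g Dc) y := by
      filter_upwards [hCo.mem_nhds hy.1] with z hz
      have h := hmax hz
      rw [← hy.2] at h
      exact h
    filter_upwards [eventually_torsionHolVec_eq hb hflat hc hv hp hyU hloc, hCo.mem_nhds hy.1,
      hv.isOpen.mem_nhds hyU] with z hz hzC hzU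
    refine ⟨hzC, ?_⟩
    rw [Set.mem_ofPred_eq, norm_torsionHolVec_sq hb hc hv hp hzU, hz,
      ← norm_torsionHolVec_sq hb hc hv hp hyU]
    exact hy.2
  have hsub := IsClopen.connectedComponent_subset ⟨hSc, hSo⟩ (show m ∈ S from ⟨hm, rfl⟩)
  rw [← connectedComponent_eq hm] at hsub
  exact fun y hy => (hsub hy).2

/-- `U` lies in one component, on which `|T|²` is constant. Every point of `U` is therefore a local
maximum, the components are locally constant, and preconnectedness finishes. -/
lemma torsionComp_constant [CompactSpace M] (hb : IsBismut g Db)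
    (hflat : IsFlat Db) (hc : IsChern g Dc)
    (hv : IsUnitaryFrameOn g v U) (hp : IsParallelOn Db v U) (hU : IsPreconnected U)
    (i j k : Fin (Module.finrank ℂ E)) : ∃ c : ℂ, ∀ x ∈ U, torsionComp g Dc v i j k x = c := by
  rcases U.eq_empty_or_nonempty with rfl | ⟨x₀, hx₀⟩
  · exact ⟨0, fun x hx => hx.elim⟩
  obtain ⟨r, hr⟩ := torsionNormSq_eq_of_mem_connectedComponent hb hflat hc x₀
  have hsub := hU.subset_connectedComponent hx₀
  have hloc : ∀ x ∈ U, ∀ᶠ y in nhds x, torsionComp g Dc v i j k y = torsionComp g Dc v i j k x := by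
    intro x hx
    have hmax : IsLocalMax (torsionNormSq g Dc) x := by
      filter_upwards [hv.isOpen.mem_nhds hx] with y hy
      rw [hr y (hsub hy), hr x (hsub hx)]
    filter_upwards [eventually_torsionHolVec_eq hb hflat hc hv hp hx hmax,
      hv.isOpen.mem_nhds hx] with y hy hyU
    rw [torsionComp_eq_conj_torsionHol hb hc hv hp i j k hyU,
      torsionComp_eq_conj_torsionHol hb hc hv hp i j k hx]
    exact congrArg conj (congrArg (fun h => h (i, j, k)) hy)
  refine ⟨torsionComp g Dc v i j k x₀, ?_⟩
  let A := {y | y ∈ U ∧ torsionComp g Dc v i j k y = torsionComp g Dc v i j k x₀}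
  let B := {y | y ∈ U ∧ torsionComp g Dc v i j k y ≠ torsionComp g Dc v i j k x₀}
  have hA : IsOpen A := isOpen_iff_mem_nhds.2 fun y hy => by
    filter_upwards [hloc y hy.1, hv.isOpen.mem_nhds hy.1] with z hz hzU
    exact ⟨hzU, hz.trans hy.2⟩
  have hB : IsOpen B := isOpen_iff_mem_nhds.2 fun y hy => by
    filter_upwards [hloc y hy.1, hv.isOpen.mem_nhds hy.1] with z hz hzU
    exact ⟨hzU, fun h => hy.2 (hz.symm.trans h)⟩
  have hAB : Disjoint A B := Set.disjoint_left.2 fun y h1 h2 => h2.2 h1.2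
  have hcov : U ⊆ A ∪ B := fun y hy => (em _).imp (fun h => ⟨hy, h⟩) fun h => ⟨hy, h⟩
  intro x hx
  exact (hU.subset_left_of_subset_union hA hB hAB hcov ⟨x₀, hx₀, hx₀, rfl⟩ hx).2

end Main

end BismutFlat

end

theorem lemma11 {E : Type*} [NormedAddCommGroup E] [NormedSpace ℂ E] [FiniteDimensional ℂ E]
    [CompleteSpace E] {M : Type*} [TopologicalSpace M] [T2Space M] [ChartedSpace E M]
    [IsManifold 𝓘(ℂ, E) ω M]
    (g : BismutFlat.HermitianMetric E M) (Db Dc : BismutFlat.Connection E M)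
    (hb : BismutFlat.IsBismut g Db) (hflat : BismutFlat.IsFlat Db)
    (hc : BismutFlat.IsChern g Dc) :
    ContMDiff 𝓘(ℝ, E) 𝓘(ℝ) ∞ (BismutFlat.torsionNormSq g Dc) ∧
    BismutFlat.IsPlurisubharmonic E (BismutFlat.torsionNormSq g Dc) ∧
    (∀ (U : Set M) (v : Fin (Module.finrank ℂ E) → BismutFlat.VF E M),
      BismutFlat.IsUnitaryFrameOn g v U → BismutFlat.IsParallelOn Db v U →
      (∀ i j k, ContMDiffOn 𝓘(ℝ, E) 𝓘(ℝ, ℂ) ∞ (BismutFlat.torsionComp g Dc v i j k) U) ∧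
      ∀ x ∈ U, ∀ w₁ w₂ : BismutFlat.TM E x,
        BismutFlat.deldbar (fun y => (BismutFlat.torsionNormSq g Dc y : ℂ)) x w₁ w₂
          = ∑ i, ∑ j, ∑ k, ∑ l, ∑ m,
              BismutFlat.torsionCov g Db Dc v i j k x (BismutFlat.type01 (v l x))
                * conj (BismutFlat.torsionCov g Db Dc v i j k x (BismutFlat.type01 (v m x)))
                * BismutFlat.wedgeConj (BismutFlat.coframe g x (fun r => v r x) m)
                    (BismutFlat.coframe g x (fun r => v r x) l) w₁ w₂) ∧
    (CompactSpace M →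
      ∀ (U : Set M) (v : Fin (Module.finrank ℂ E) → BismutFlat.VF E M),
        BismutFlat.IsUnitaryFrameOn g v U → BismutFlat.IsParallelOn Db v U → IsPreconnected U →
        ∀ i j k, ∃ c : ℂ, ∀ x ∈ U, BismutFlat.torsionComp g Dc v i j k x = c) :=
  ⟨BismutFlat.contMDiff_torsionNormSq hb hflat hc,
    BismutFlat.isPlurisubharmonic_torsionNormSq hb hflat hc,
    fun _U _v hv hp => ⟨fun i j k => BismutFlat.contMDiffOn_torsionComp hb hc hv hp i j k,
      fun _x hx w₁ w₂ => BismutFlat.deldbar_torsionNormSq hb hflat hc hv hp hx w₁ w₂⟩,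
    fun _ _U _v hv hp hU i j k => BismutFlat.torsionComp_constant hb hflat hc hv hp hU i j k⟩
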